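/- **Abstract Nash–Moser bifurcation theorem.** Let $\mathbb T=\mathbb R/2\pi\mathbb Z$ and fix an integer $m\ge 2$. For $k\ge 0$ put $$X^k=\Big\{f\in H^k(\mathbb T): f=\sum_{j\ge1}a_{jm}\cos(jmx)\Big\},\qquad Y^k=\Big\{f\in H^k(\mathbb T): f=\sum_{j\ge1}a_{jm}\sin(jmx)\Big\},$$ normed by $\|f\|_{H^k}^2=\sum_{n\in\mathbb Z}(1+n^2)^k|\hat f(n)|^2$ (products carry a product norm, written $|\cdot|$), write $C^\infty=C^\infty(\mathbb T)$, and let $f\cdot g$ denote the $L^2(\mathbb T)^3$ inner product, to which all orthogonal complements refer. $A\lesssim_k B$ means $A\le C_kB$ with a constant $C_k$ depending only on $k$ (not on $\Theta,R,h$); similarly for $\lesssim_{k,\sigma}$. Let $\Theta^*\in\mathbb R$, let $I\subset\mathbb R$ be an open neighbourhood of $\Theta^*$ and $V$ an open neighbourhood of $0$ in $X^3$. Let $G$ be a map that for every integer $k\ge2$ restricts to a map $G: I\times\big(V^3\cap(X^{k+1})^3\big)\to(Y^k)^3$ of class $C^2$; $D$ denotes the derivative in $R$ and $\partial_\Theta$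 the derivative in $\Theta$. For $(\Theta,R)\in I\times(V^3\cap(C^\infty)^3)$ let $A(\Theta,R)$ and $a(\Theta,R)$ be linear operators which, for every $k\ge2$, are bounded as maps $a(\Theta,R):(X^{k+1})^3\to(Y^k)^3$ and $A(\Theta,R):(X^{k+1})^3\to Y^{k+1}\times(Y^k)^2$. Assume that for every $k\ge2$ the following hold for all $(\Theta,R)\in I\times(V^3\cap(C^\infty)^3)$ and $h\in (X^{k+1})^3$. * **(a) Trivial solutions.** $G(\Theta,0)=0$ for all $\Theta\in I$. * **(b) Regularity.** The derivatives $\partial_\Theta D^2G(\Theta^*,R)[h,h]$ and $\partial_{\Theta\Theta}DG(\Theta,R)[h]$ exist in $(Y^k)^3$, and $$|G(\Theta,R)|_{(Y^k)^3}\lesssim_k1+|R|_{(X^{k+1})^3},\qquad |\partial_\Theta G(\Theta,R)|_{(Y^k)^3}\lesssim_k1+|R|_{(X^{k+1})^3},$$ $$|D^2G(\Theta,R)[h,h]|_{(Y^k)^3}\lesssim_k(1+|R|_{(X^{k+3})^3})|h|^2_{(X^{k+1})^3},\qquad |\partial_\Theta DG(\Theta,R)[h]|_{(Y^k)^3}\lesssim_k(1+|R|_{(X^{k+3})^3})|h|_{(X^{k+1})^3},$$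 $$|\partial_\Theta D^2G(\Theta^*,R)[h,h]|_{(Y^k)^3}\lesssim_k(1+|R|_{(X^{k+3})^3})|h|^2_{(X^{k+1})^3},\qquad |\partial_{\Theta\Theta}DG(\Theta,R)[h]|_{(Y^k)^3}\lesssim_k(1+|R|_{(X^{k+3})^3})|h|_{(X^{k+1})^3}.$$ * **(c) Decomposition.** $DG(\Theta,R)[h]=a(\Theta,R)[h]+A(\Theta,R)[h]$, and there is $0<\eta<1$ (depending on $k$) such that if $|R|_{(X^{k+2})^3}\le\eta$, then $$|a(\Theta,R)[h]|_{(Y^k)^3}\lesssim_k|G(\Theta,R)|_{(Y^k)^3}|h|_{(X^{k+1})^3},\qquad |A(\Theta,R)[h]|_{Y^{k+1}\times(Y^k)^2}\lesssim_k(1+|R|_{(X^{k+3})^3})|h|_{(X^{k+1})^3}.$$ * **(d) Lipschitz continuity of $A$.** For $(\Theta^1,R^1),(\Theta^2,R^2)\in I\times(V^3\cap(C^\infty)^3)$ with $|R^1|_{(X^{k+3})^3},|R^2|_{(X^{k+3})^3}\le1$, $$|A(\Theta^1,R^1)[h]-A(\Theta^2,R^2)[h]|_{Y^{k+1}\times(Y^k)^2}\lesssim_k\big(|\Theta^1-\Theta^2|+|R^1-R^2|_{(X^{k+3})^3}\big)|h|_{(X^{k+1})^3}.$$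 * **(e) Tame estimates.** There is $0<\eta<1$ (depending on $k$) such that if $|R|_{(X^{k+3})^3}\le\eta$, $A(\Theta,R)[h]=z$ with $z\in(C^\infty)^3$, and $h\in\operatorname{Ker}(A(\Theta^*,0))^\perp$, then $h\in(C^\infty)^3$ and for every even integer $\sigma\ge0$ $$|h|_{(X^{k+1+\sigma})^3}\lesssim_{k,\sigma}(1+|R|_{(X^{k+4+\sigma})^3})|z|_{Y^{k+1}\times(Y^k)^2}+|z|_{Y^{k+1+\sigma}\times(Y^{k+\sigma})^2}.$$ * **(f) Fredholm index zero.** There are non-zero vectors $v\in\mathbb R^3\cos(mx)$ and $w\in\mathbb R^3\sin(mx)$, independent of $k$, such that, for $A(\Theta^*,0):(X^{k+1})^3\to Y^{k+1}\times(Y^k)^2$, $$\operatorname{Ker}A(\Theta^*,0)=\operatorname{span}\{v\},\qquad \operatorname{Im}(A(\Theta^*,0))^\perp=\operatorname{span}\{w\},$$ and $\operatorname{Im}A(\Theta^*,0)$ has codimension one in $Y^{k+1}\times(Y^k)^2$. * **(g) Transversality.** $\partial_\Theta A(\Theta^*,0)[v]\notin\operatorname{Im}A(\Theta^*,0)$.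 Then for every $k_0\ge2$ there are $s_0=s_0(k_0)>0$ and a continuous curve $[0,s_0)\ni s\mapsto(\Theta(s),R(s))\in I\times\big(V^3\cap(X^{k_0+1})^3\big)$ with $(\Theta(0),R(0))=(\Theta^*,0)$ such that $G(\Theta(s),R(s))=0$ for all $s\in[0,s_0)$ and $R(s)\neq0$ for $0<s<s_0$. -/

import Mathlib

open MeasureTheory

noncomputable section

namespace NashMoser

/-! ### Square integrable functions on the circle, cosine and sine modes -/

instance factTwoPiPos : Fact (0 < 2 * Real.pi) := ⟨Real.two_pi_pos⟩

/-- The circle of length `2π`. -/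
abbrev Circ : Type := AddCircle (2 * Real.pi)

/-- Real square integrable functions on the circle (with respect to `dx / 2π`). -/
abbrev L2 : Type := Lp ℝ 2 (AddCircle.haarAddCircle : Measure Circ)

/-- The function `x ↦ cos (n x)` on the circle. -/
def cosFun (n : ℕ) : C(Circ, ℝ) :=
  ⟨fun x => (fourier (n : ℤ) x).re, Complex.continuous_re.comp (fourier (n : ℤ)).continuous⟩

/-- The function `x ↦ sin (n x)` on the circle. -/
def sinFun (n : ℕ) : C(Circ, ℝ) :=
  ⟨fun x => (fourier (n : ℤ) x).im, Complex.continuous_im.comp (fourier (n : ℤ)).continuous⟩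

theorem fourier_coe_eq (n : ℕ) (x : ℝ) :
    fourier (n : ℤ) (x : Circ) = Complex.exp (((n * x : ℝ) : ℂ) * Complex.I) := by
  rw [fourier_coe_apply]
  congr 1
  have : (Real.pi : ℂ) ≠ 0 := by exact_mod_cast Real.pi_ne_zero
  push_cast
  field_simp

theorem cosFun_coe (n : ℕ) (x : ℝ) : cosFun n (x : Circ) = Real.cos (n * x) := by
  change (fourier (n : ℤ) (x : Circ)).re = _
  rw [fourier_coe_eq, Complex.exp_ofReal_mul_I_re]

theorem sinFun_coe (n : ℕ) (x : ℝ) : sinFun n (x : Circ) = Real.sin (n * x) := by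
  change (fourier (n : ℤ) (x : Circ)).im = _
  rw [fourier_coe_eq, Complex.exp_ofReal_mul_I_im]

/-- `cos (n x)` as an element of `L²`. -/
def cosMode (n : ℕ) : L2 := ContinuousMap.toLp 2 AddCircle.haarAddCircle ℝ (cosFun n)

/-- `sin (n x)` as an element of `L²`. -/
def sinMode (n : ℕ) : L2 := ContinuousMap.toLp 2 AddCircle.haarAddCircle ℝ (sinFun n)

/-- The functions of the form `∑_{j ≥ 1} a_j e_{jm}`, for a given family `e` of modes. -/
def seriesSpace (e : ℕ → L2) (m : ℕ) : Submodule ℝ L2 where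
  carrier := {f | ∃ a : ℕ → ℝ, HasSum (fun j => a j • e ((j + 1) * m)) f}
  add_mem' := by
    rintro f g ⟨a, ha⟩ ⟨b, hb⟩
    exact ⟨fun j => a j + b j, by simpa only [add_smul] using ha.add hb⟩
  zero_mem' := ⟨fun _ => 0, by simp⟩
  smul_mem' := by
    rintro c f ⟨a, ha⟩
    exact ⟨fun j => c * a j, by simpa only [mul_smul] using ha.const_smul c⟩

/-- Functions `∑_{j ≥ 1} a_{jm} cos (j m x)`. -/
abbrev cosSpace (m : ℕ) : Submodule ℝ L2 := seriesSpace cosMode m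

/-- Functions `∑_{j ≥ 1} a_{jm} sin (j m x)`. -/
abbrev sinSpace (m : ℕ) : Submodule ℝ L2 := seriesSpace sinMode m

/-! ### Sobolev spaces on the circle -/

/-- The `n`-th (complex) Fourier coefficient `(1 / 2π) ∫ f(x) e^{-inx} dx` of `f`. -/
def coeff (f : L2) (n : ℤ) : ℂ := fourierCoeff (fun x => ((f x : ℝ) : ℂ)) n

theorem integrable_ofReal (f : L2) :
    Integrable (fun x => ((f x : ℝ) : ℂ)) (AddCircle.haarAddCircle : Measure Circ) :=
  ((Lp.memLp f).integrable (by norm_num)).ofReal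

theorem coeff_add (f g : L2) (n : ℤ) : coeff (f + g) n = coeff f n + coeff g n := by
  have h := congrFun (fourierCoeff.add (integrable_ofReal f) (integrable_ofReal g)) n
  rw [Pi.add_apply] at h
  unfold coeff
  rw [← h]
  refine congrFun (fourierCoeff_congr_ae ?_) n
  filter_upwards [Lp.coeFn_add f g] with x hx
  rw [hx]
  simp

theorem coeff_smul (c : ℝ) (f : L2) (n : ℤ) : coeff (c • f) n = c • coeff f n := by
  unfold coeff
  have h := fourierCoeff.const_smul (fun x => ((f x : ℝ) : ℂ)) (c : ℂ) n
  rw [← Complex.coe_smul, ← h]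
  refine congrFun (fourierCoeff_congr_ae ?_) n
  filter_upwards [Lp.coeFn_smul c f] with x hx
  rw [hx]
  simp

theorem coeff_zero (n : ℤ) : coeff 0 n = 0 := by
  simpa using coeff_smul 0 0 n

theorem eq_zero_of_coeff (f : L2) (h : ∀ n, coeff f n = 0) : f = 0 := by
  have hm : MemLp (fun x => ((f x : ℝ) : ℂ)) 2 (AddCircle.haarAddCircle : Measure Circ) :=
    (Lp.memLp f).ofReal
  have hz : hm.toLp _ = 0 := by
    apply (fourierBasis (T := 2 * Real.pi)).repr.injective
    ext n
    rw [fourierBasis_repr, congrFun (fourierCoeff_congr_ae hm.coeFn_toLp) n, map_zero]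
    exact h n
  have h0 : (fun x => ((f x : ℝ) : ℂ)) =ᵐ[AddCircle.haarAddCircle] 0 := by
    have := hm.coeFn_toLp
    rw [hz] at this
    exact this.symm.trans (Lp.coeFn_zero _ _ _)
  rw [Lp.eq_zero_iff_ae_eq_zero]
  filter_upwards [h0] with x hx
  simpa using hx

/-- The weight `(1 + n²)^{k/2}`. -/
def wt (k : ℕ) (n : ℤ) : ℝ := Real.sqrt ((1 + (n : ℝ) ^ 2) ^ k)

/-- The weighted Fourier coefficients `(1 + n²)^{k/2} f̂(n)`. -/
def wcoeff (k : ℕ) (f : L2) : ℤ → ℂ := fun n => wt k n • coeff f n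

/-- The elements of `S` that lie in the Sobolev space `H^k` of the circle, i.e. for which
`∑ (1 + n²)^k |f̂(n)|² < ∞`. -/
def sobolevSub (S : Submodule ℝ L2) (k : ℕ) : Submodule ℝ L2 where
  carrier := {f | f ∈ S ∧ Memℓp (wcoeff k f) 2}
  add_mem' := by
    rintro f g ⟨hf, hf'⟩ ⟨hg, hg'⟩
    refine ⟨S.add_mem hf hg, ?_⟩
    have : wcoeff k (f + g) = wcoeff k f + wcoeff k g := by
      funext n; simp only [wcoeff, coeff_add, smul_add, Pi.add_apply]
    rw [this]; exact hf'.add hg'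
  zero_mem' := by
    refine ⟨S.zero_mem, ?_⟩
    have : wcoeff k 0 = 0 := by funext n; simp [wcoeff, coeff_zero]
    rw [this]; exact zero_memℓp
  smul_mem' := by
    rintro c f ⟨hf, hf'⟩
    refine ⟨S.smul_mem c hf, ?_⟩
    have : wcoeff k (c • f) = c • wcoeff k f := by
      funext n; simp only [wcoeff, coeff_smul, Pi.smul_apply]; rw [smul_comm]
    rw [this]; exact hf'.const_smul c

/-- `S ∩ H^k` as a type of its own, to be normed by the `H^k` norm. -/
def HSp (S : Submodule ℝ L2) (k : ℕ) : Type := sobolevSub S k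

namespace HSp

variable {S : Submodule ℝ L2} {k : ℕ}

instance : AddCommGroup (HSp S k) := inferInstanceAs (AddCommGroup (sobolevSub S k))

instance : Module ℝ (HSp S k) := inferInstanceAs (Module ℝ (sobolevSub S k))

/-- The underlying function of an element of `S ∩ H^k`. -/
def toL2 : HSp S k →ₗ[ℝ] L2 := (sobolevSub S k).subtype

instance : CoeOut (HSp S k) L2 := ⟨fun f => toL2 f⟩

/-- The isometry `f ↦ ((1 + n²)^{k/2} f̂(n))_n` that defines the `H^k` norm. -/
def toSeq : HSp S k →ₗ[ℝ] lp (fun _ : ℤ => ℂ) 2 where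
  toFun f := ⟨wcoeff k f.1, f.2.2⟩
  map_add' f g := by
    ext n
    change wt k n • coeff (f.1 + g.1) n = wt k n • coeff f.1 n + wt k n • coeff g.1 n
    rw [coeff_add, smul_add]
  map_smul' c f := by
    ext n
    change wt k n • coeff (c • f.1) n = c • (wt k n • coeff f.1 n)
    rw [coeff_smul, smul_comm]

theorem wt_pos (k : ℕ) (n : ℤ) : 0 < wt k n := Real.sqrt_pos.2 (by positivity)

theorem toSeq_injective : Function.Injective (toSeq : HSp S k → lp (fun _ : ℤ => ℂ) 2) := by
  rw [injective_iff_map_eq_zero]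
  intro f hf
  apply Subtype.ext
  refine eq_zero_of_coeff f.1 fun n => ?_
  have h : wt k n • coeff f.1 n = 0 := congrFun (congrArg Subtype.val hf) n
  exact (smul_eq_zero.1 h).resolve_left (wt_pos k n).ne'

instance : NormedAddCommGroup (HSp S k) :=
  NormedAddCommGroup.induced (HSp S k) (lp (fun _ : ℤ => ℂ) 2) toSeq toSeq_injective

instance : NormedSpace ℝ (HSp S k) :=
  NormedSpace.induced ℝ (HSp S k) (lp (fun _ : ℤ => ℂ) 2) toSeq

/-- The norm is the Sobolev norm: `‖f‖² = ∑ (1 + n²)^k |f̂(n)|²`. -/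
theorem norm_sq_eq (f : HSp S k) :
    ‖f‖ ^ 2 = ∑' n : ℤ, (1 + (n : ℝ) ^ 2) ^ k * ‖coeff (f : L2) n‖ ^ 2 := by
  have h := lp.norm_rpow_eq_tsum (p := 2) (by norm_num) (toSeq f)
  change ‖toSeq f‖ ^ 2 = _
  have h2 : (2 : ENNReal).toReal = ((2 : ℕ) : ℝ) := by norm_num
  simp only [h2, Real.rpow_natCast] at h
  rw [h]
  refine tsum_congr fun n => ?_
  change ‖wt k n • coeff f.1 n‖ ^ 2 = _ * ‖coeff f.1 n‖ ^ 2
  rw [norm_smul, mul_pow, Real.norm_eq_abs, sq_abs, wt, Real.sq_sqrt (by positivity)]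

end HSp

/-! ### Smooth functions -/

/-- `f` is (almost everywhere equal to) a `C^∞` function on the circle. -/
def IsSmooth (f : L2) : Prop :=
  ∃ g : Circ → ℝ, ContDiff ℝ (⊤ : ℕ∞) (fun x : ℝ => g x) ∧
    (f : Circ → ℝ) =ᵐ[AddCircle.haarAddCircle] g

/-- The smooth elements of `S`. -/
def smoothSub (S : Submodule ℝ L2) : Submodule ℝ L2 where
  carrier := {f | f ∈ S ∧ IsSmooth f}
  add_mem' := by
    rintro f g ⟨hf, u, hu, hfu⟩ ⟨hg, v, hv, hgv⟩
    refine ⟨S.add_mem hf hg, fun x => u x + v x, hu.add hv, ?_⟩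
    filter_upwards [Lp.coeFn_add f g, hfu, hgv] with x h1 h2 h3
    rw [h1, Pi.add_apply, h2, h3]
  zero_mem' := ⟨S.zero_mem, fun _ => 0, contDiff_const, Lp.coeFn_zero _ _ _⟩
  smul_mem' := by
    rintro c f ⟨hf, u, hu, hfu⟩
    refine ⟨S.smul_mem c hf, fun x => c * u x, contDiff_const.mul hu, ?_⟩
    filter_upwards [Lp.coeFn_smul c f, hfu] with x h1 h2
    rw [h1, Pi.smul_apply, h2, smul_eq_mul]

theorem two_pi_lt : (0 : ℝ) < 0 + 2 * Real.pi := by linarith [Real.two_pi_pos]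

theorem fourierCoeffOn_decay (j : ℕ) : ∀ F : ℝ → ℂ, ContDiff ℝ (⊤ : ℕ∞) F →
    Function.Periodic F (2 * Real.pi) →
    ∃ C : ℝ, 0 ≤ C ∧ ∀ n : ℤ, n ≠ 0 → ‖fourierCoeffOn two_pi_lt F n‖ * |(n : ℝ)| ^ j ≤ C := by
  induction j with
  | zero =>
    intro F hF _
    obtain ⟨M, hM⟩ := (isCompact_Icc (a := (0 : ℝ)) (b := 0 + 2 * Real.pi)).exists_bound_of_continuousOn
      hF.continuous.continuousOn
    have hM0 : 0 ≤ M := (norm_nonneg _).trans (hM 0 ⟨le_rfl, two_pi_lt.le⟩)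
    refine ⟨M, hM0, fun n _ => ?_⟩
    rw [pow_zero, mul_one, fourierCoeffOn_eq_integral, norm_smul]
    have h := intervalIntegral.norm_integral_le_of_norm_le_const (a := (0 : ℝ))
      (b := 0 + 2 * Real.pi) (C := M)
      (f := fun x => fourier (-n) (x : AddCircle (0 + 2 * Real.pi - 0)) • F x) (by
        intro x hx
        rw [Set.uIoc_of_le two_pi_lt.le] at hx
        rw [norm_smul, fourier_apply, Circle.norm_coe, one_mul]
        exact hM x ⟨hx.1.le, hx.2⟩)
    refine (mul_le_mul_of_nonneg_left h (norm_nonneg _)).trans (le_of_eq ?_)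
    have hp := Real.two_pi_pos
    rw [zero_add, sub_zero, Real.norm_of_nonneg (by positivity), abs_of_pos hp]
    field_simp
  | succ j ih =>
    intro F hF hP
    have hF' : ContDiff ℝ (⊤ : ℕ∞) (deriv F) := (contDiff_infty_iff_deriv.1 hF).2
    have hP' : Function.Periodic (deriv F) (2 * Real.pi) := by
      intro x
      rw [← deriv_comp_add_const]
      congr 1
      funext y
      exact hP y
    obtain ⟨C, hC0, hC⟩ := ih (deriv F) hF' hP'
    refine ⟨C, hC0, fun n hn => ?_⟩
    have hn' : (n : ℂ) ≠ 0 := by exact_mod_cast hn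
    have hna : 0 < |(n : ℝ)| := abs_pos.2 (by exact_mod_cast hn)
    have hd : ∀ x, HasDerivAt F (deriv F x) x := fun x =>
      (hF.differentiable (by simp) x).hasDerivAt
    have h := fourierCoeffOn_of_hasDerivAt two_pi_lt hn (fun x _ => hd x)
      (hF'.continuous.intervalIntegrable _ _)
    have h0 : F (0 + 2 * Real.pi) - F 0 = 0 := by rw [hP 0, sub_self]
    rw [h0, mul_zero, zero_sub] at h
    have hp := Real.pi_pos
    have hnorm : ‖fourierCoeffOn two_pi_lt F n‖ * |(n : ℝ)|
        = ‖fourierCoeffOn two_pi_lt (deriv F) n‖ := by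
      rw [h, norm_mul, norm_neg, norm_mul, norm_div]
      simp only [norm_mul, norm_neg, norm_one, Complex.norm_I, Complex.norm_intCast,
        Complex.norm_real, Complex.norm_ofNat, zero_add, Complex.ofReal_mul, Complex.ofReal_zero,
        sub_zero, Real.norm_of_nonneg hp.le, Complex.ofReal_ofNat]
      field_simp
    rw [pow_succ', ← mul_assoc, hnorm]
    exact hC n hn

theorem coeff_eq_fourierCoeffOn {f : L2} {g : Circ → ℝ}
    (h : (f : Circ → ℝ) =ᵐ[AddCircle.haarAddCircle] g) (n : ℤ) :
    coeff f n = fourierCoeffOn two_pi_lt (fun x : ℝ => ((g x : ℝ) : ℂ)) n := by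
  have h1 : coeff f n = fourierCoeff (fun x => ((g x : ℝ) : ℂ)) n := by
    refine congrFun (fourierCoeff_congr_ae ?_) n
    filter_upwards [h] with x hx
    rw [hx]
  rw [h1, ← fourierCoeff_liftIoc_eq (T := 2 * Real.pi) (a := 0)]
  congr 1
  funext x
  obtain ⟨y, hy, rfl⟩ : ∃ y ∈ Set.Ioc (0 : ℝ) (0 + 2 * Real.pi), (y : Circ) = x := by
    have := (AddCircle.coe_image_Ioc_eq (2 * Real.pi) 0).ge (Set.mem_univ x)
    exact this
  rw [AddCircle.liftIoc_coe_apply hy]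

/-- Smooth functions belong to every `H^k`. -/
theorem smoothSub_le (S : Submodule ℝ L2) (k : ℕ) : smoothSub S ≤ sobolevSub S k := by
  rintro f ⟨hf, g, hg, hfg⟩
  refine ⟨hf, ?_⟩
  have hG : ContDiff ℝ (⊤ : ℕ∞) (fun x : ℝ => ((g x : ℝ) : ℂ)) :=
    Complex.ofRealCLM.contDiff.comp hg
  obtain ⟨C, hC0, hC⟩ := fourierCoeffOn_decay (k + 1) _ hG (fun x => by simp)
  apply memℓp_gen
  have h2 : (2 : ENNReal).toReal = ((2 : ℕ) : ℝ) := by norm_num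
  simp only [h2, Real.rpow_natCast]
  have hs : Summable fun n : ℤ => 2 ^ k * C ^ 2 * (1 / (n : ℝ) ^ 2) :=
    (Real.summable_one_div_int_pow.2 (by norm_num)).mul_left _
  refine hs.of_norm_bounded_eventually ?_
  rw [Filter.eventually_cofinite]
  refine (Set.finite_singleton (0 : ℤ)).subset fun n hn => ?_
  by_contra hne
  refine hn ?_
  have hne' : n ≠ 0 := hne
  have hn1 : (1 : ℝ) ≤ (n : ℝ) ^ 2 := by
    have : (1 : ℤ) ≤ n ^ 2 := by have := sq_pos_of_ne_zero hne'; omega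
    exact_mod_cast this
  have hb := hC n hne'
  rw [← coeff_eq_fourierCoeffOn hfg] at hb
  have hb2 : ‖coeff f n‖ ^ 2 * ((n : ℝ) ^ 2) ^ (k + 1) ≤ C ^ 2 := by
    have := pow_le_pow_left₀ (by positivity) hb 2
    rwa [mul_pow, ← pow_mul, mul_comm (k + 1) 2, pow_mul, sq_abs] at this
  have hw : ‖wcoeff k f n‖ ^ 2 = (1 + (n : ℝ) ^ 2) ^ k * ‖coeff f n‖ ^ 2 := by
    rw [wcoeff, norm_smul, mul_pow, Real.norm_eq_abs, sq_abs, wt, Real.sq_sqrt (by positivity)]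
  rw [norm_pow, norm_norm, hw, mul_one_div, le_div_iff₀ (by positivity)]
  calc (1 + (n : ℝ) ^ 2) ^ k * ‖coeff f n‖ ^ 2 * (n : ℝ) ^ 2
      ≤ (2 * (n : ℝ) ^ 2) ^ k * ‖coeff f n‖ ^ 2 * (n : ℝ) ^ 2 := by
        gcongr; linarith
    _ = 2 ^ k * (‖coeff f n‖ ^ 2 * ((n : ℝ) ^ 2) ^ (k + 1)) := by ring
    _ ≤ 2 ^ k * C ^ 2 := by gcongr

/-- `S ∩ C^∞` as a type. -/
abbrev CInf (S : Submodule ℝ L2) : Type := smoothSub S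

/-- The inclusion `S ∩ C^∞ ⊆ S ∩ H^k`. -/
def toH {S : Submodule ℝ L2} (k : ℕ) : CInf S →ₗ[ℝ] HSp S k :=
  Submodule.inclusion (smoothSub_le S k)

/-! ### The spaces `X^k`, `Y^k` and their products -/

/-- `X^{k,m}`: the functions `∑_{j ≥ 1} a_{jm} cos (j m x)` in `H^k`, with the `H^k` norm. -/
abbrev X (m k : ℕ) : Type := HSp (cosSpace m) k

/-- `Y^{k,m}`: the functions `∑_{j ≥ 1} a_{jm} sin (j m x)` in `H^k`, with the `H^k` norm. -/
abbrev Y (m k : ℕ) : Type := HSp (sinSpace m) k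

/-- `(X^k)³`. -/
abbrev X3 (m k : ℕ) : Type := Fin 3 → X m k

/-- `(Y^k)³`. -/
abbrev Y3 (m k : ℕ) : Type := Fin 3 → Y m k

/-- `Y^{k+1} × (Y^k)²`. -/
abbrev YT (m k : ℕ) : Type := Y m (k + 1) × Y m k × Y m k

/-- `(X^k)³ ∩ (C^∞)³`, which does not depend on `k`. -/
abbrev XInf (m : ℕ) : Type := Fin 3 → CInf (cosSpace m)

/-- `(Y^k)³ ∩ (C^∞)³`, which does not depend on `k`. -/
abbrev YInf (m : ℕ) : Type := Fin 3 → CInf (sinSpace m)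

/-- The inclusion of the smooth triples into `(X^k)³`. -/
def XInf.to {m : ℕ} (k : ℕ) (R : XInf m) : X3 m k := fun i => toH k (R i)

/-- The inclusion of the smooth triples into `Y^{k+1} × (Y^k)²`. -/
def YInf.to {m : ℕ} (k : ℕ) (z : YInf m) : YT m k :=
  (toH (k + 1) (z 0), toH k (z 1), toH k (z 2))

/-- The triple of functions underlying an element of a product of three Sobolev spaces. -/
def fn3 {S : Submodule ℝ L2} {k : ℕ} (R : Fin 3 → HSp S k) : Fin 3 → L2 := fun i => (R i : L2)

/-- The triple of functions underlying an element of `Y^{k+1} × (Y^k)²`. -/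
def fnT {m k : ℕ} (z : YT m k) : Fin 3 → L2 := ![(z.1 : L2), (z.2.1 : L2), (z.2.2 : L2)]

/-- The triple of functions underlying a smooth triple. -/
def fnInf {S : Submodule ℝ L2} (R : Fin 3 → CInf S) : Fin 3 → L2 := fun i => (R i : L2)

/-- The `L²` inner product of triples. -/
def dot (f g : Fin 3 → L2) : ℝ := ∑ i, inner ℝ (f i) (g i)

/-- `(X^k)³ ∩ V³`. -/
def cube (V : Set L2) (m k : ℕ) : Set (X3 m k) := {R | ∀ i, fn3 R i ∈ V}

/-- `V³ ∩ (C^∞)³`. -/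
def smoothCube (V : Set L2) (m : ℕ) : Set (XInf m) := {R | ∀ i, fnInf R i ∈ V}

end NashMoser

end

open NashMoser

noncomputable section

/-! ### Fourier coefficients of real functions as products with cosines and sines. -/

namespace NashMoser

/-! Write R = s(v + ρ) and, for each small s > 0, solve F_s(Θ, ρ) = s⁻¹ G(Θ, s(v + ρ)) = 0 for (Θ,
ρ) near (Θ*, 0); F_s is `resid`. Because G(Θ, 0) = 0, the part a(Θ, 0) of DG(Θ, 0) vanishes, and as
s → 0 the linearization of F_s at (Θ*, 0) becomes (θ, h) ↦ θ ∂_ΘA(Θ*, 0)[v] + A(Θ*, 0)[h]. With the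
extra row ⟨h, v⟩ it is a bijection onto Y^{k+1} × (Y^k)² × ℝ: this is what the kernel, the
codimension and transversality say (`bordered_bijective`). So far this is Crandall–Rabinowitz, but
derivatives are lost: A depends on R in X^{k+3} while its inverse only returns X^{k+1}, and a
residual in (Y^k)³ need not lie in Y^{k+1} × (Y^k)². The implicit function theorem is replaced by a
Newton scheme with sharp Fourier truncations S_N.

In one step DG is replaced by A, the residual F and p = s⁻¹ ∂_ΘG are truncated, the bordered system
is solved for (θ, h), and (θ, S_N h) is added. While s, Θ - Θ* and ρ in X^{k+3} are small and N is
large, the bordered operator is close in norm to the one at (Θ*, 0), so its inverse is uniformly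
bounded (`exists_newtonOp_inverse`). The new residual is a Taylor remainder, plus the truncation
errors of F and p, plus a[S_N h], minus A[h - S_N h] (`resid_newton_eq`). The Taylor remainder is
quadratic, and so is a[S_N h], because a is controlled by G. The other terms need high norms: if v +
ρ only has frequencies up to M, then F and p grow like M^σ in Y^{k+σ}, uniformly in s
(`exists_bound_rescaled`, `exists_resid_high`), and the tame estimate bounds the tail of h by
M^(σ+2) / N^σ (`exists_tail`). With f and f' the old and new residual norms, f' ≤ C (N² f² + M^(σ+2)
/ N^σ) (`exists_newton_step`).

With τ_{n+1} = τ_n^{3/2}, N = τ³, M = τ² and σ = 34 the bound f_n ≤ τ_n^(-14) reproduces itself, and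
the increments in X^{k+3} are at most of order N³ f ≤ τ^(-5), which is summable
(`exists_iter_bounds`). It holds at the start for small s because F_s(Θ*, 0) → 0, as v lies in the
kernel. Every iterate is continuous in s up to s = 0 and the convergence is uniform in s, so the
limit is a continuous curve; ρ stays smaller than v, hence R(s) ≠ 0 for s > 0. -/

theorem coeff_re (f : L2) (n : ℕ) : (coeff f n).re = inner ℝ (cosMode n) f := by
  have hi : Integrable (fun x => fourier (-(n : ℤ)) x • ((f x : ℝ) : ℂ))
      (AddCircle.haarAddCircle : Measure Circ) := (integrable_ofReal f).fourier_smul _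
  rw [coeff, fourierCoeff, L2.inner_def]
  refine (Complex.reCLM.integral_comp_comm hi).symm.trans (integral_congr_ae ?_)
  filter_upwards [ContinuousMap.coeFn_toLp (p := 2) (𝕜 := ℝ)
    (AddCircle.haarAddCircle : Measure Circ) (cosFun n)] with x hx
  rw [cosMode, hx, fourier_neg]
  simp [cosFun, mul_comm]

theorem coeff_im (f : L2) (n : ℕ) : (coeff f n).im = -inner ℝ (sinMode n) f := by
  have hi : Integrable (fun x => fourier (-(n : ℤ)) x • ((f x : ℝ) : ℂ))
      (AddCircle.haarAddCircle : Measure Circ) := (integrable_ofReal f).fourier_smul _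
  rw [coeff, fourierCoeff, L2.inner_def, ← integral_neg]
  refine (Complex.imCLM.integral_comp_comm hi).symm.trans (integral_congr_ae ?_)
  filter_upwards [ContinuousMap.coeFn_toLp (p := 2) (𝕜 := ℝ)
    (AddCircle.haarAddCircle : Measure Circ) (sinFun n)] with x hx
  rw [sinMode, hx, fourier_neg]
  simp [sinFun, mul_comm]

theorem coeff_neg_index (f : L2) (n : ℤ) : coeff f (-n) = starRingEnd ℂ (coeff f n) := by
  rw [coeff, coeff, fourierCoeff, fourierCoeff, ← integral_conj]
  refine integral_congr_ae (Filter.Eventually.of_forall fun x => ?_)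
  simp only [smul_eq_mul, map_mul, Complex.conj_ofReal, fourier_neg, Complex.conj_conj]

/-- The functions are real, so the coefficients of negative index are conjugates of the others. -/
theorem coeff_ext {f g : L2} (h : ∀ n : ℕ, coeff f n = coeff g n) : f = g := by
  rw [← sub_eq_zero]
  have key : ∀ n : ℤ, coeff f n = coeff g n := by
    intro n
    obtain ⟨k, rfl | rfl⟩ := n.eq_nat_or_neg
    · exact h k
    · rw [coeff_neg_index, coeff_neg_index, h]
  refine eq_zero_of_coeff _ fun n => ?_
  rw [sub_eq_add_neg, ← neg_one_smul ℝ g, coeff_add, coeff_smul, key]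
  simp

theorem coeff_toLp (F : C(Circ, ℝ)) (n : ℤ) :
    coeff (ContinuousMap.toLp 2 AddCircle.haarAddCircle ℝ F) n
      = fourierCoeff (fun x => ((F x : ℝ) : ℂ)) n := by
  refine congrFun (fourierCoeff_congr_ae ?_) n
  filter_upwards [ContinuousMap.coeFn_toLp (p := 2) (𝕜 := ℝ)
    (AddCircle.haarAddCircle : Measure Circ) F] with x hx
  rw [hx]

theorem integrable_fourier (j : ℤ) :
    Integrable (fun x => fourier j x) (AddCircle.haarAddCircle : Measure Circ) :=
  (fourier j).continuous.integrable_of_hasCompactSupport (HasCompactSupport.of_compactSpace _)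

/-- For natural n only the exponential of frequency +j can contribute; j = 0 is excluded because
there the two exponentials coincide. -/
theorem coeff_cosMode (j n : ℕ) (hj : j ≠ 0) :
    coeff (cosMode j) n = if n = j then 1 / 2 else 0 := by
  have e : (fun x : Circ => ((cosFun j x : ℝ) : ℂ))
      = (1 / 2 : ℂ) • (⇑(fourier (j : ℤ)) + ⇑(fourier (-(j : ℤ))) : Circ → ℂ) := by
    funext x
    change (((fourier (j : ℤ) x).re : ℝ) : ℂ) = _
    rw [Pi.smul_apply, Pi.add_apply, fourier_neg, Complex.re_eq_add_conj]
    simp only [smul_eq_mul]; ring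
  rw [cosMode, coeff_toLp, e, fourierCoeff.const_smul,
    fourierCoeff.add (integrable_fourier _) (integrable_fourier _), Pi.add_apply,
    fourierCoeff_fourier, fourierCoeff_fourier]
  have h1 : (n : ℤ) ≠ -(j : ℤ) := by omega
  by_cases h : n = j
  · subst h; simp [h1]
  · simp [h, h1]

theorem coeff_sinMode (j n : ℕ) (hj : j ≠ 0) :
    coeff (sinMode j) n = if n = j then -(1 / 2) * Complex.I else 0 := by
  have e : (fun x : Circ => ((sinFun j x : ℝ) : ℂ))
      = (-(1 / 2) * Complex.I : ℂ) •
        (⇑(fourier (j : ℤ)) + (-1 : ℂ) • ⇑(fourier (-(j : ℤ))) : Circ → ℂ) := by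
    funext x
    change (((fourier (j : ℤ) x).im : ℝ) : ℂ) = _
    rw [Pi.smul_apply, Pi.add_apply, Pi.smul_apply, fourier_neg, Complex.im_eq_sub_conj, div_eq_iff (by simp)]
    simp only [smul_eq_mul]
    ring_nf
    rw [Complex.I_sq]; ring
  have h1 : (n : ℤ) ≠ -(j : ℤ) := by omega
  rw [sinMode, coeff_toLp, e, fourierCoeff.const_smul,
    fourierCoeff.add (integrable_fourier _) ((integrable_fourier _).smul _), Pi.add_apply,
    fourierCoeff.const_smul, fourierCoeff_fourier, fourierCoeff_fourier]
  by_cases h : n = j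
  · subst h; simp [h1]
  · simp [h, h1]

theorem inner_cos_cos (i j : ℕ) (hj : j ≠ 0) :
    inner ℝ (cosMode i) (cosMode j) = if i = j then (1 / 2 : ℝ) else 0 := by
  rw [← coeff_re, coeff_cosMode j i hj]; split_ifs <;> simp

theorem inner_sin_cos (i j : ℕ) (hj : j ≠ 0) : inner ℝ (sinMode i) (cosMode j) = 0 := by
  rw [← neg_eq_zero, ← coeff_im, coeff_cosMode j i hj]; split_ifs <;> simp

theorem inner_sin_sin (i j : ℕ) (hj : j ≠ 0) :
    inner ℝ (sinMode i) (sinMode j) = if i = j then (1 / 2 : ℝ) else 0 := by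
  rw [← neg_inj, ← coeff_im, coeff_sinMode j i hj]; split_ifs <;> simp

theorem inner_cos_sin (i j : ℕ) (hj : j ≠ 0) : inner ℝ (cosMode i) (sinMode j) = 0 := by
  rw [← coeff_re, coeff_sinMode j i hj]; split_ifs <;> simp

theorem isSmooth_cosMode (n : ℕ) : IsSmooth (cosMode n) := by
  refine ⟨cosFun n, ?_, ContinuousMap.coeFn_toLp _ _⟩
  simp only [cosFun_coe]
  fun_prop

theorem isSmooth_sinMode (n : ℕ) : IsSmooth (sinMode n) := by
  refine ⟨sinFun n, ?_, ContinuousMap.coeFn_toLp _ _⟩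
  simp only [sinFun_coe]
  fun_prop

/-! ### Spaces spanned by a family of orthogonal modes -/

/-- `e` is one of the two families of modes and `e'` the other one. -/
structure IsModePair (e e' : ℕ → L2) : Prop where
  inner_self : ∀ i j, j ≠ 0 → inner ℝ (e i) (e j) = if i = j then (1 / 2 : ℝ) else 0
  inner_other : ∀ i j, j ≠ 0 → inner ℝ (e' i) (e j) = 0
  smooth : ∀ i, IsSmooth (e i)
  ext : ∀ f g : L2, (∀ i, inner ℝ (e i) f = inner ℝ (e i) g) →
    (∀ i, inner ℝ (e' i) f = inner ℝ (e' i) g) → f = g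
  normSq_coeff : ∀ (f : L2) (n : ℤ),
    ‖coeff f n‖ ^ 2 = inner ℝ (e n.natAbs) f ^ 2 + inner ℝ (e' n.natAbs) f ^ 2

theorem normSq_coeff_eq (f : L2) (n : ℤ) :
    ‖coeff f n‖ ^ 2 = inner ℝ (cosMode n.natAbs) f ^ 2 + inner ℝ (sinMode n.natAbs) f ^ 2 := by
  have h : ∀ k : ℕ, ‖coeff f k‖ ^ 2 = inner ℝ (cosMode k) f ^ 2 + inner ℝ (sinMode k) f ^ 2 := by
    intro k
    rw [← Complex.normSq_eq_norm_sq, Complex.normSq_apply, coeff_re, coeff_im]; ring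
  obtain ⟨k, rfl | rfl⟩ := n.eq_nat_or_neg
  · simpa using h k
  · rw [coeff_neg_index, RCLike.norm_conj]; simpa using h k

theorem ext_of_inner {f g : L2} (h : ∀ i, inner ℝ (cosMode i) f = inner ℝ (cosMode i) g)
    (h' : ∀ i, inner ℝ (sinMode i) f = inner ℝ (sinMode i) g) : f = g :=
  coeff_ext fun n => Complex.ext (by rw [coeff_re, coeff_re, h]) (by rw [coeff_im, coeff_im, h'])

theorem isModePair_cos : IsModePair cosMode sinMode where
  inner_self := inner_cos_cos
  inner_other := inner_sin_cos
  smooth := isSmooth_cosMode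
  ext _ _ h h' := ext_of_inner h h'
  normSq_coeff := normSq_coeff_eq

theorem isModePair_sin : IsModePair sinMode cosMode where
  inner_self := inner_sin_sin
  inner_other := inner_cos_sin
  smooth := isSmooth_sinMode
  ext _ _ h h' := ext_of_inner h' h
  normSq_coeff f n := by rw [normSq_coeff_eq, add_comm]

namespace IsModePair

variable {e e' : ℕ → L2} (he : IsModePair e e') {m : ℕ} (hm : m ≠ 0)
include he hm

/-- Trades the existence of an expansion for closed linear conditions. Bessel's inequality for the
orthonormal family √2 e_{(j+1)m} makes the formal series of f converge, and f and the sum then have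
the same products with every mode of both families. -/
theorem mem_seriesSpace_iff {f : L2} : f ∈ seriesSpace e m ↔
    (∀ i, inner ℝ (e' i) f = 0) ∧ ∀ i, (i = 0 ∨ ¬ m ∣ i) → inner ℝ (e i) f = 0 := by
  have hne : ∀ j, (j + 1) * m ≠ 0 := fun j => mul_ne_zero (Nat.succ_ne_zero j) hm
  have hinj : ∀ {i j}, (i + 1) * m = (j + 1) * m ↔ i = j := fun {i j} => by
    rw [Nat.mul_left_inj hm]; omega
  constructor
  · rintro ⟨a, ha⟩
    constructor
    · intro i
      have h := (innerSL ℝ (e' i)).hasSum ha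
      simp only [innerSL_apply_apply, inner_smul_right, he.inner_other _ _ (hne _), mul_zero] at h
      exact h.unique hasSum_zero
    · intro i hi
      have h := (innerSL ℝ (e i)).hasSum ha
      have h0 : ∀ j, i ≠ (j + 1) * m := by
        rintro j rfl
        rcases hi with hi | hi
        · exact hne j hi
        · exact hi (dvd_mul_left _ _)
      simp only [innerSL_apply_apply, inner_smul_right, he.inner_self _ _ (hne _), h0,
        if_false, mul_zero] at h
      exact h.unique hasSum_zero
  · rintro ⟨h1, h2⟩
    have hs : (Real.sqrt 2) ^ 2 = 2 := Real.sq_sqrt (by norm_num)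
    have ho : Orthonormal ℝ fun j => Real.sqrt 2 • e ((j + 1) * m) := by
      rw [orthonormal_iff_ite]
      intro i j
      rw [inner_smul_left, inner_smul_right, he.inner_self _ _ (hne j)]
      simp only [conj_trivial, hinj]
      split_ifs
      · linear_combination (1 / 2) * hs
      · ring
    have hsum : Summable fun j => (2 * inner ℝ (e ((j + 1) * m)) f) • e ((j + 1) * m) := by
      have h3 := ho.inner_products_summable (x := f)
      have h4 := (ho.orthogonalFamily.summable_iff_norm_sq_summable
        fun j => inner ℝ (Real.sqrt 2 • e ((j + 1) * m)) f).2 h3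
      refine h4.congr fun j => ?_
      simp only [LinearIsometry.toSpanSingleton_apply, inner_smul_left, conj_trivial, smul_smul]
      congr 1
      linear_combination (inner ℝ (e ((j + 1) * m)) f) * hs
    refine ⟨fun j => 2 * inner ℝ (e ((j + 1) * m)) f, ?_⟩
    obtain ⟨g, hg⟩ := hsum
    have : g = f := by
      refine he.ext _ _ (fun i => ?_) fun i => ?_
      · have h := (innerSL ℝ (e i)).hasSum hg
        simp only [innerSL_apply_apply, inner_smul_right, he.inner_self _ _ (hne _)] at h
        by_cases hi : i = 0 ∨ ¬ m ∣ i
        · rw [h2 i hi]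
          have h0 : ∀ j, i ≠ (j + 1) * m := by
            rintro j rfl
            rcases hi with hi | hi
            · exact hne j hi
            · exact hi (dvd_mul_left _ _)
          simp only [h0, if_false, mul_zero] at h
          exact h.unique hasSum_zero
        · push Not at hi
          obtain ⟨q, rfl⟩ := hi.2
          obtain ⟨j, rfl⟩ : ∃ j, q = j + 1 := ⟨q - 1, by
            have : q ≠ 0 := by rintro rfl; simp at hi
            omega⟩
          rw [mul_comm m] at h ⊢
          refine h.unique ?_
          refine (hasSum_ite_eq j (inner ℝ (e ((j + 1) * m)) f)).congr_fun fun i => ?_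
          simp only [hinj]
          by_cases hij : i = j
          · subst hij; rw [if_pos rfl, if_pos rfl]; ring
          · rw [if_neg (Ne.symm hij), if_neg hij, mul_zero]
      · have h := (innerSL ℝ (e' i)).hasSum hg
        simp only [innerSL_apply_apply, inner_smul_right, he.inner_other _ _ (hne _), mul_zero] at h
        rw [h1]
        exact h.unique hasSum_zero
    rwa [this] at hg

/-- An intersection of kernels of continuous functionals; it serves the completeness of `HSp S k`.
-/
theorem isClosed_seriesSpace : IsClosed (seriesSpace e m : Set L2) := by
  have : (seriesSpace e m : Set L2) = (⋂ i, {f | inner ℝ (e' i) f = 0}) ∩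
      ⋂ i, ⋂ _ : i = 0 ∨ ¬ m ∣ i, {f | inner ℝ (e i) f = 0} := by
    ext f
    simp only [SetLike.mem_coe, he.mem_seriesSpace_iff hm, Set.mem_inter_iff, Set.mem_iInter,
      Set.mem_ofPred_eq]
  rw [this]
  have hc : ∀ u : L2, IsClosed {f : L2 | inner ℝ u f = 0} := fun u =>
    isClosed_eq (innerSL ℝ u).continuous continuous_const
  exact (isClosed_iInter fun i => hc _).inter (isClosed_iInter fun i => isClosed_iInter fun _ => hc _)

end IsModePair

end NashMoser

/-! ### Sharp Fourier truncation on spaces of cosine or sine series. -/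

namespace NashMoser

/-- The positive frequencies `n` with `1 + n² ≤ N²`. -/
def lowFreq (N : ℝ) : Finset ℕ := (Finset.Icc 1 ⌊N⌋₊).filter fun n => 1 + (n : ℝ) ^ 2 ≤ N ^ 2

theorem mem_lowFreq {N : ℝ} (hN : 0 ≤ N) {n : ℕ} :
    n ∈ lowFreq N ↔ n ≠ 0 ∧ 1 + (n : ℝ) ^ 2 ≤ N ^ 2 := by
  rw [lowFreq, Finset.mem_filter, Finset.mem_Icc, Nat.le_floor_iff hN]
  constructor
  · rintro ⟨⟨h1, _⟩, h3⟩
    exact ⟨by omega, h3⟩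
  · rintro ⟨h1, h3⟩
    exact ⟨⟨by omega, abs_le_of_sq_le_sq' (by linarith) hN |>.2⟩, h3⟩

/-- The part of the Fourier series of `f` carried by the modes `e n`, `1 + n² ≤ N²`. -/
def modeCut (e : ℕ → L2) (N : ℝ) : L2 →ₗ[ℝ] L2 :=
  ∑ n ∈ lowFreq N, (2 : ℝ) • ((innerSL ℝ (e n)).toLinearMap.smulRight (e n))

theorem modeCut_apply (e : ℕ → L2) (N : ℝ) (f : L2) :
    modeCut e N f = ∑ n ∈ lowFreq N, (2 * inner ℝ (e n) f) • e n := by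
  simp [modeCut, LinearMap.sum_apply, smul_smul]

/-- Sharp Fourier truncation. -/
def cut (N : ℝ) : L2 →ₗ[ℝ] L2 := modeCut cosMode N + modeCut sinMode N

/-- The spaces of series in one of the two families of modes. -/
class TrigSpace (S : Submodule ℝ L2) : Prop where
  out : ∃ (e e' : ℕ → L2) (m : ℕ), IsModePair e e' ∧ m ≠ 0 ∧ S = seriesSpace e m ∧
    ∀ N, cut N = modeCut e N + modeCut e' N

instance (m : ℕ) [NeZero m] : TrigSpace (cosSpace m) :=
  ⟨_, _, m, isModePair_cos, NeZero.ne m, rfl, fun _ => rfl⟩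

instance (m : ℕ) [NeZero m] : TrigSpace (sinSpace m) :=
  ⟨_, _, m, isModePair_sin, NeZero.ne m, rfl, fun _ => add_comm _ _⟩

section TrigSpace

variable {S : Submodule ℝ L2} [hS : TrigSpace S]

theorem TrigSpace.isClosed : IsClosed (S : Set L2) := by
  obtain ⟨e, e', m, he, hm, rfl, -⟩ := hS.out
  exact he.isClosed_seriesSpace hm

/-- On S the other family of modes contributes nothing, and only frequencies that are nonzero
multiples of m survive, so the truncation is a finite sum of smooth elements of S. -/
theorem TrigSpace.cut_mem (N : ℝ) {f : L2} (hf : f ∈ S) : cut N f ∈ smoothSub S := by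
  obtain ⟨e, e', m, he, hm, rfl, hc⟩ := hS.out
  have hf' := (he.mem_seriesSpace_iff hm).1 hf
  have h0 : modeCut e' N f = 0 := by
    rw [modeCut_apply]
    exact Finset.sum_eq_zero fun n _ => by rw [hf'.1, mul_zero, zero_smul]
  rw [hc, LinearMap.add_apply, h0, add_zero, modeCut_apply]
  refine Submodule.sum_mem _ fun n hn => ?_
  by_cases h : n = 0 ∨ ¬ m ∣ n
  · rw [hf'.2 n h, mul_zero, zero_smul]; exact Submodule.zero_mem _
  · push Not at h
    refine Submodule.smul_mem _ _ ⟨(he.mem_seriesSpace_iff hm).2 ⟨fun i => ?_, fun i hi => ?_⟩,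
      he.smooth n⟩
    · exact he.inner_other _ _ h.1
    · rw [he.inner_self _ _ h.1, if_neg]
      rintro rfl
      rcases hi with hi | hi
      exacts [h.1 hi, hi h.2]

/-- Truncation keeps or kills each coefficient. The threshold uses 1 + n², the base of the Sobolev
weight, so all smoothing inequalities below have constant one. -/
theorem TrigSpace.norm_coeff_cut {N : ℝ} (hN : 0 ≤ N) {f : L2} (hf : f ∈ S) (n : ℤ) :
    ‖coeff (cut N f) n‖ = (if 1 + (n : ℝ) ^ 2 ≤ N ^ 2 then ‖coeff f n‖ else 0) ∧
    ‖coeff (f - cut N f) n‖ = (if 1 + (n : ℝ) ^ 2 ≤ N ^ 2 then 0 else ‖coeff f n‖) := by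
  have hmem := TrigSpace.cut_mem N hf
  obtain ⟨e, e', m, he, hm, rfl, hc⟩ := hS.out
  have hf' := (he.mem_seriesSpace_iff hm).1 hf
  have hcf := (he.mem_seriesSpace_iff hm).1 hmem.1
  have h0 : modeCut e' N f = 0 := by
    rw [modeCut_apply]
    exact Finset.sum_eq_zero fun n _ => by rw [hf'.1, mul_zero, zero_smul]
  have hna : ((n.natAbs : ℕ) : ℝ) ^ 2 = (n : ℝ) ^ 2 := by
    rw [Nat.cast_natAbs, Int.cast_abs, sq_abs]
  have key : inner ℝ (e n.natAbs) (cut N f)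
      = if 1 + (n : ℝ) ^ 2 ≤ N ^ 2 then inner ℝ (e n.natAbs) f else 0 := by
    rw [hc, LinearMap.add_apply, h0, add_zero, modeCut_apply, inner_sum]
    have h1 : ∀ i ∈ lowFreq N, inner ℝ (e n.natAbs) ((2 * inner ℝ (e i) f) • e i)
        = if i = n.natAbs then inner ℝ (e n.natAbs) f else 0 := by
      intro i hi
      rw [inner_smul_right, he.inner_self _ _ ((mem_lowFreq hN).1 hi).1]
      by_cases h : i = n.natAbs
      · subst h; rw [if_pos rfl, if_pos rfl]; ring
      · rw [if_neg (Ne.symm h), if_neg h, mul_zero]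
    rw [Finset.sum_congr rfl h1, Finset.sum_ite_eq', ← hna]
    -- The frequency 0 is not in `lowFreq`, but series in S have no constant mode, so both sides
    -- vanish.
    by_cases hn : n.natAbs = 0
    · rw [hn, hf'.2 0 (Or.inl rfl)]; simp
    · simp only [mem_lowFreq hN, ne_eq, hn, not_false_eq_true, true_and]
  constructor
  · rw [← sq_eq_sq₀ (norm_nonneg _) (by split_ifs <;> simp), he.normSq_coeff, key, hcf.1]
    split_ifs
    · rw [he.normSq_coeff, hf'.1]
    · simp
  · rw [← sq_eq_sq₀ (norm_nonneg _) (by split_ifs <;> simp), he.normSq_coeff, inner_sub_right,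
      inner_sub_right, key, hcf.1, hf'.1]
    split_ifs
    · simp
    · rw [he.normSq_coeff, hf'.1]; simp

end TrigSpace

/-! ### Comparison of Sobolev norms -/

theorem wt_add (k j : ℕ) (n : ℤ) : wt (k + j) n = wt k n * wt j n := by
  rw [wt, wt, wt, ← Real.sqrt_mul (by positivity), pow_add]

theorem wt_mono {k l : ℕ} (h : k ≤ l) (n : ℤ) : wt k n ≤ wt l n :=
  Real.sqrt_le_sqrt (pow_le_pow_right₀ (by nlinarith [sq_nonneg (n : ℝ)]) h)

theorem wt_eq_pow (j : ℕ) (n : ℤ) : wt j n = Real.sqrt (1 + (n : ℝ) ^ 2) ^ j := by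
  rw [wt, Real.sqrt_eq_iff_eq_sq (by positivity) (by positivity), ← pow_mul, mul_comm, pow_mul,
    Real.sq_sqrt (by positivity)]

namespace HSp

variable {S S' : Submodule ℝ L2} {k l : ℕ}

theorem norm_toSeq (f : HSp S k) : ‖toSeq f‖ = ‖f‖ := rfl

theorem norm_toSeq_apply (f : HSp S k) (n : ℤ) : ‖toSeq f n‖ = wt k n * ‖coeff (f : L2) n‖ := by
  change ‖wt k n • coeff (f : L2) n‖ = _
  rw [norm_smul, Real.norm_of_nonneg (wt_pos k n).le]

theorem norm_le_mul_norm {f : HSp S k} {g : HSp S' l} {c : ℝ} (hc : 0 ≤ c)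
    (h : ∀ n, wt k n * ‖coeff (f : L2) n‖ ≤ c * (wt l n * ‖coeff (g : L2) n‖)) :
    ‖f‖ ≤ c * ‖g‖ := by
  rw [← norm_toSeq f, ← norm_toSeq g, ← Real.norm_of_nonneg hc, ← norm_smul]
  refine lp.norm_mono (by norm_num) fun n => ?_
  rw [norm_toSeq_apply, lp.coeFn_smul, Pi.smul_apply, norm_smul, norm_toSeq_apply,
    Real.norm_of_nonneg hc]
  exact h n

theorem toL2_injective : Function.Injective (toL2 : HSp S k →ₗ[ℝ] L2) := Subtype.val_injective

/-- Parseval's identity, the weights being at least one. -/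
theorem norm_toL2_le (f : HSp S k) : ‖(f : L2)‖ ≤ ‖f‖ := by
  set u : L2 := (f : L2)
  have hm : MemLp (fun x => ((u x : ℝ) : ℂ)) 2 (AddCircle.haarAddCircle : Measure Circ) :=
    (Lp.memLp u).ofReal
  have h1 := hasSum_sq_fourierCoeff (hm.toLp _)
  have h2 : ∀ n, fourierCoeff (hm.toLp _ : Circ → ℂ) n = coeff u n := fun n =>
    congrFun (fourierCoeff_congr_ae hm.coeFn_toLp) n
  have h3 : ∫ t, ‖(hm.toLp _ : Circ → ℂ) t‖ ^ 2 ∂AddCircle.haarAddCircle = ‖u‖ ^ 2 := by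
    rw [← real_inner_self_eq_norm_sq, L2.inner_def]
    refine integral_congr_ae ?_
    filter_upwards [hm.coeFn_toLp] with x hx
    rw [hx]
    simp
  simp only [h2] at h1
  rw [h3] at h1
  rw [← sq_le_sq₀ (norm_nonneg _) (norm_nonneg _), ← h1.tsum_eq, norm_sq_eq]
  have h4 : Summable fun n : ℤ => (1 + (n : ℝ) ^ 2) ^ k * ‖coeff u n‖ ^ 2 := by
    have := (lp.memℓp (toSeq f)).summable (by norm_num)
    have e2 : (2 : ENNReal).toReal = ((2 : ℕ) : ℝ) := by norm_num
    simp only [e2, Real.rpow_natCast, norm_toSeq_apply] at this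
    refine this.congr fun n => ?_
    rw [mul_pow, wt, Real.sq_sqrt (by positivity)]
  refine h1.summable.tsum_le_tsum (fun n => ?_) h4
  exact le_mul_of_one_le_left (by positivity) (one_le_pow₀ (by nlinarith [sq_nonneg (n : ℝ)]))

/-- The inclusion of `S ∩ H^k` in `L²`. -/
def toL2L : HSp S k →L[ℝ] L2 :=
  toL2.mkContinuous 1 fun f => by rw [one_mul]; exact norm_toL2_le f

theorem toL2_mem (f : HSp S k) : (f : L2) ∈ S := f.2.1

theorem _root_.NashMoser.sobolevSub_mono (h : l ≤ k) : sobolevSub S k ≤ sobolevSub S l := by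
  rintro f ⟨hf, hf'⟩
  refine ⟨hf, hf'.mono' fun n => ?_⟩
  rw [wcoeff, wcoeff, norm_smul, norm_smul, Real.norm_of_nonneg (wt_pos l n).le,
    Real.norm_of_nonneg (wt_pos k n).le]
  exact mul_le_mul_of_nonneg_right (wt_mono h n) (norm_nonneg _)

/-- The inclusion `S ∩ H^k ⊆ S ∩ H^l` for `l ≤ k`. -/
def inclₗ (h : l ≤ k) : HSp S k →ₗ[ℝ] HSp S l :=
  LinearMap.codRestrict (sobolevSub S l) toL2 fun f => sobolevSub_mono h f.2

theorem coe_inclₗ_mk (h : l ≤ k) (x : L2) (hx : x ∈ sobolevSub S k) :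
    ((inclₗ h (⟨x, hx⟩ : sobolevSub S k) : HSp S l) : L2) = x := rfl

theorem coe_inclₗ (h : l ≤ k) (f : HSp S k) : ((inclₗ h f : HSp S l) : L2) = f :=
  coe_inclₗ_mk h _ f.2

theorem norm_inclₗ_le (h : l ≤ k) (f : HSp S k) : ‖inclₗ h f‖ ≤ 1 * ‖f‖ := by
  refine norm_le_mul_norm zero_le_one fun n => ?_
  rw [one_mul, coe_inclₗ]
  exact mul_le_mul_of_nonneg_right (wt_mono h n) (norm_nonneg _)

/-- The inclusion `S ∩ H^k ⊆ S ∩ H^l` for `l ≤ k`, as a continuous map. -/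
def incl (h : l ≤ k) : HSp S k →L[ℝ] HSp S l := (inclₗ h).mkContinuous 1 (norm_inclₗ_le h)

theorem coe_incl (h : l ≤ k) (f : HSp S k) : ((incl h f : HSp S l) : L2) = f :=
  coe_inclₗ h f

theorem norm_incl_le (h : l ≤ k) (f : HSp S k) : ‖(incl h f : HSp S l)‖ ≤ ‖f‖ :=
  (norm_inclₗ_le h f).trans_eq (one_mul _)

/-- A Cauchy sequence converges in L², its limit stays in the closed space S, and single
coefficients pass to the limit; boundedness of the weighted sequences puts the limit in H^k.
Completeness is used both to invert the bordered operator and to take the limit of the iterates. -/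
instance [TrigSpace S] : CompleteSpace (HSp S k) := by
  refine Metric.complete_of_cauchySeq_tendsto fun u hu => ?_
  have hu1 : CauchySeq fun i => toL2L (u i) := toL2L.uniformContinuous.comp_cauchySeq hu
  obtain ⟨f, hf⟩ := cauchySeq_tendsto_of_complete hu1
  have hfS : f ∈ S := TrigSpace.isClosed.mem_of_tendsto hf
    (Filter.Eventually.of_forall fun i => (u i).2.1)
  have hiso : Isometry (toSeq : HSp S k → lp (fun _ : ℤ => ℂ) 2) :=
    AddMonoidHomClass.isometry_of_norm toSeq norm_toSeq
  have hu2 : CauchySeq fun i => toSeq (u i) := hiso.uniformContinuous.comp_cauchySeq hu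
  have hcoef : ∀ n : ℕ, Filter.Tendsto (fun i => coeff (u i : L2) n) Filter.atTop
      (nhds (coeff f n)) := by
    intro n
    have e : ∀ g : L2, coeff g n = (inner ℝ (cosMode n) g : ℝ) + (-inner ℝ (sinMode n) g : ℝ) * Complex.I :=
      fun g => by rw [← coeff_re, ← coeff_im, Complex.re_add_im]
    have hc : Continuous fun g : L2 => coeff g n := by
      simp only [e]
      fun_prop
    exact (hc.tendsto f).comp hf
  have hcoef' : ∀ n : ℤ, Filter.Tendsto (fun i => coeff (u i : L2) n) Filter.atTop
      (nhds (coeff f n)) := by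
    intro n
    obtain ⟨j, rfl | rfl⟩ := n.eq_nat_or_neg
    · exact hcoef j
    · simp only [coeff_neg_index]
      exact (Complex.continuous_conj.tendsto _).comp (hcoef j)
  have hpt : Filter.Tendsto (id fun i => (toSeq (u i) : ℤ → ℂ)) Filter.atTop
      (nhds (wcoeff k f)) := by
    rw [tendsto_pi_nhds]
    exact fun n => (hcoef' n).const_smul _
  have hmem : Memℓp (wcoeff k f) 2 :=
    lp.memℓp_of_tendsto hu2.isBounded_range hpt
  let g : HSp S k := (⟨f, hfS, hmem⟩ : sobolevSub S k)
  refine ⟨g, hiso.isEmbedding.tendsto_nhds_iff.2 ?_⟩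
  exact lp.tendsto_lp_of_tendsto_pi hu2 hpt

end HSp

/-! ### Truncation -/

section trunc

variable {S : Submodule ℝ L2} [hS : TrigSpace S] {k : ℕ}

/-- Fourier truncation as a map to the smooth elements of `S`. -/
def trunc (N : ℝ) : HSp S k →ₗ[ℝ] CInf S :=
  LinearMap.codRestrict (smoothSub S) ((cut N).comp HSp.toL2)
    fun f => TrigSpace.cut_mem N (HSp.toL2_mem f)

theorem coe_trunc (N : ℝ) (f : HSp S k) : ((trunc N f : CInf S) : L2) = cut N (f : L2) := rfl

theorem coe_toH {S : Submodule ℝ L2} (k : ℕ) (f : CInf S) : ((toH k f : HSp S k) : L2) = f := rfl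

/-- Surviving weights are at most N, so gaining j derivatives costs N^j. -/
theorem norm_toH_trunc_le {N : ℝ} (hN : 0 ≤ N) (j : ℕ) (f : HSp S k) :
    ‖toH (k + j) (trunc N f)‖ ≤ N ^ j * ‖f‖ := by
  refine HSp.norm_le_mul_norm (by positivity) fun n => ?_
  rw [coe_toH, coe_trunc, (TrigSpace.norm_coeff_cut hN (HSp.toL2_mem f) n).1, wt_add, wt_eq_pow j]
  split_ifs with h
  · have h1 : Real.sqrt (1 + (n : ℝ) ^ 2) ≤ N := Real.sqrt_le_iff.2 ⟨hN, h⟩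
    have h2 := pow_le_pow_left₀ (Real.sqrt_nonneg _) h1 j
    have h3 : 0 ≤ wt k n * ‖coeff (f : L2) n‖ := mul_nonneg (HSp.wt_pos k n).le (norm_nonneg _)
    calc _ = Real.sqrt (1 + (n : ℝ) ^ 2) ^ j * (wt k n * ‖coeff (f : L2) n‖) := by
            rw [mul_right_comm, mul_comm]
      _ ≤ _ := mul_le_mul_of_nonneg_right h2 h3
  · rw [mul_zero]
    exact mul_nonneg (by positivity) (mul_nonneg (HSp.wt_pos k n).le (norm_nonneg _))

/-- On the discarded frequencies the weight exceeds N, so j extra derivatives of f buy a factor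
N^(-j). The division is avoided here, so N = 0 is allowed. -/
theorem pow_mul_norm_sub_trunc_le {N : ℝ} (hN : 0 ≤ N) (j : ℕ) (f : HSp S k) (g : HSp S (k + j))
    (hfg : (f : L2) = g) : N ^ j * ‖f - toH k (trunc N f)‖ ≤ ‖g‖ := by
  rw [← Real.norm_of_nonneg (pow_nonneg hN j), ← norm_smul, ← one_mul ‖g‖]
  refine HSp.norm_le_mul_norm zero_le_one fun n => ?_
  have e : ((N ^ j • (f - toH k (trunc N f)) : HSp S k) : L2) = N ^ j • ((f : L2) - cut N (f : L2)) := by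
    rw [map_smul, map_sub, coe_toH, coe_trunc]
  rw [e, coeff_smul, norm_smul, (TrigSpace.norm_coeff_cut hN (HSp.toL2_mem f) n).2, ← hfg, wt_add, wt_eq_pow j,
    Real.norm_of_nonneg (pow_nonneg hN j), one_mul]
  have h3 : 0 ≤ wt k n * ‖coeff (f : L2) n‖ := mul_nonneg (HSp.wt_pos k n).le (norm_nonneg _)
  split_ifs with h
  · rw [mul_zero, mul_zero, mul_right_comm]
    exact mul_nonneg h3 (by positivity)
  · have h1 : N ≤ Real.sqrt (1 + (n : ℝ) ^ 2) := Real.le_sqrt_of_sq_le (not_le.1 h).le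
    have h2 := pow_le_pow_left₀ hN h1 j
    calc _ = N ^ j * (wt k n * ‖coeff (f : L2) n‖) := by ring
      _ ≤ Real.sqrt (1 + (n : ℝ) ^ 2) ^ j * (wt k n * ‖coeff (f : L2) n‖) :=
        mul_le_mul_of_nonneg_right h2 h3
      _ = _ := by ring

/-- All frequencies of `f` satisfy `1 + n² ≤ M²`. -/
def Band (M : ℝ) (f : L2) : Prop := ∀ n : ℤ, M ^ 2 < 1 + (n : ℝ) ^ 2 → coeff f n = 0

theorem Band.add {M : ℝ} {f g : L2} (hf : Band M f) (hg : Band M g) : Band M (f + g) :=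
  fun n hn => by rw [coeff_add, hf n hn, hg n hn, add_zero]

theorem Band.mono {M N : ℝ} (hM : 0 ≤ M) (h : M ≤ N) {f : L2} (hf : Band M f) : Band N f :=
  fun n hn => hf n ((pow_le_pow_left₀ hM h 2).trans_lt hn)

theorem band_trunc {N : ℝ} (hN : 0 ≤ N) (f : HSp S k) : Band N (trunc N f : CInf S) :=
  fun n hn => by
    rw [coe_trunc, ← norm_eq_zero, (TrigSpace.norm_coeff_cut hN (HSp.toL2_mem f) n).1, if_neg (not_le.2 hn)]

/-- Bernstein's inequality. -/
theorem Band.norm_toH_le {S : Submodule ℝ L2} {M : ℝ} (hM : 0 ≤ M) {f : CInf S} (hf : Band M f)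
    (k j : ℕ) : ‖toH (k + j) f‖ ≤ M ^ j * ‖toH k f‖ := by
  refine HSp.norm_le_mul_norm (by positivity) fun n => ?_
  rw [coe_toH, coe_toH, wt_add, wt_eq_pow j]
  by_cases h : M ^ 2 < 1 + (n : ℝ) ^ 2
  · rw [hf n h]; simp
  · have h1 : Real.sqrt (1 + (n : ℝ) ^ 2) ≤ M := Real.sqrt_le_iff.2 ⟨hM, not_lt.1 h⟩
    have h2 := pow_le_pow_left₀ (Real.sqrt_nonneg _) h1 j
    have h3 : 0 ≤ wt k n * ‖coeff (f : L2) n‖ := mul_nonneg (HSp.wt_pos k n).le (norm_nonneg _)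
    calc _ = Real.sqrt (1 + (n : ℝ) ^ 2) ^ j * (wt k n * ‖coeff (f : L2) n‖) := by ring
      _ ≤ _ := mul_le_mul_of_nonneg_right h2 h3

/-- Without extra regularity there is no rate: a finite set of frequencies carries f up to ε, and a
large N keeps all of them. -/
theorem exists_norm_sub_trunc_lt (f : HSp S k) {ε : ℝ} (hε : 0 < ε) :
    ∃ N₀ : ℝ, 0 ≤ N₀ ∧ ∀ N, N₀ ≤ N → ‖f - toH k (trunc N f)‖ < ε := by
  have hs := lp.hasSum_single (p := 2) (by norm_num) (HSp.toSeq f)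
  obtain ⟨s, hsε⟩ := Filter.eventually_atTop.1 (Metric.tendsto_nhds.1 hs ε hε)
  obtain ⟨B, hB⟩ : ∃ B : ℝ, ∀ n ∈ s, 1 + (n : ℝ) ^ 2 ≤ B := by
    obtain ⟨B, hB⟩ := (s.finite_toSet.image fun n : ℤ => 1 + (n : ℝ) ^ 2).bddAbove
    exact ⟨B, fun n hn => hB ⟨n, hn, rfl⟩⟩
  refine ⟨max 1 B, by positivity, fun N hN => ?_⟩
  have hN1 : 1 ≤ N := (le_max_left _ _).trans hN
  have hNB : B ≤ N ^ 2 := by nlinarith [(le_max_right 1 B).trans hN]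
  refine lt_of_le_of_lt ?_ (hsε s le_rfl)
  rw [dist_comm, dist_eq_norm, ← HSp.norm_toSeq]
  refine lp.norm_mono (by norm_num) fun n => ?_
  rw [HSp.norm_toSeq_apply, map_sub, coe_toH, coe_trunc,
    (TrigSpace.norm_coeff_cut (by linarith) (HSp.toL2_mem f) n).2, lp.coeFn_sub, Pi.sub_apply,
    lp.coeFn_sum, Finset.sum_apply]
  split_ifs with h
  · rw [mul_zero]; exact norm_nonneg _
  · have hn : n ∉ s := fun hn => h ((hB n hn).trans hNB)
    rw [Finset.sum_eq_zero, sub_zero, HSp.norm_toSeq_apply]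
    intro i hi
    exact lp.single_apply_ne _ _ _ (by rintro rfl; exact hn hi)

end trunc

end NashMoser

namespace NashMoser

/-! ### Mean value estimates -/

section MeanValue

variable {F : Type*} [NormedAddCommGroup F] [NormedSpace ℝ F]

theorem norm_sub_sub_le_of_deriv_sub_le {φ φ' : ℝ → F} {c : F} {C : ℝ}
    (h : ∀ t ∈ Set.Icc (0 : ℝ) 1, HasDerivAt φ (φ' t) t)
    (hC : ∀ t ∈ Set.Icc (0 : ℝ) 1, ‖φ' t - c‖ ≤ C) : ‖φ 1 - φ 0 - c‖ ≤ C := by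
  have h1 : ∀ t ∈ Set.Icc (0 : ℝ) 1,
      HasDerivWithinAt (fun t => φ t - t • c) (φ' t - c) (Set.Icc 0 1) t := fun t ht => by
    simpa using ((h t ht).fun_sub ((hasDerivAt_id t).smul_const c)).hasDerivWithinAt
  have h2 := (convex_Icc (0 : ℝ) 1).norm_image_sub_le_of_norm_hasDerivWithin_le h1 hC
    (Set.left_mem_Icc.2 zero_le_one) (Set.right_mem_Icc.2 zero_le_one)
  simp only [one_smul, zero_smul, sub_zero, norm_one, mul_one] at h2
  rwa [sub_right_comm] at h2

theorem norm_sub_le_of_deriv_le {φ φ' : ℝ → F} {C : ℝ}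
    (h : ∀ t ∈ Set.Icc (0 : ℝ) 1, HasDerivAt φ (φ' t) t)
    (hC : ∀ t ∈ Set.Icc (0 : ℝ) 1, ‖φ' t‖ ≤ C) : ‖φ 1 - φ 0‖ ≤ C := by
  simpa using norm_sub_sub_le_of_deriv_sub_le (c := 0) h (by simpa using hC)

theorem norm_taylor_two_le {φ φ' φ'' : ℝ → F} {C : ℝ}
    (h : ∀ t ∈ Set.Icc (0 : ℝ) 1, HasDerivAt φ (φ' t) t)
    (h' : ∀ t ∈ Set.Icc (0 : ℝ) 1, HasDerivAt φ' (φ'' t) t)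
    (hC : ∀ t ∈ Set.Icc (0 : ℝ) 1, ‖φ'' t‖ ≤ C) : ‖φ 1 - φ 0 - φ' 0‖ ≤ C := by
  have hC0 : 0 ≤ C := (norm_nonneg _).trans (hC 0 (Set.left_mem_Icc.2 zero_le_one))
  refine norm_sub_sub_le_of_deriv_sub_le h fun t ht => ?_
  have h2 := (convex_Icc (0 : ℝ) 1).norm_image_sub_le_of_norm_hasDerivWithin_le
    (fun t ht => (h' t ht).hasDerivWithinAt) hC (Set.left_mem_Icc.2 zero_le_one) ht
  refine h2.trans (mul_le_of_le_one_right hC0 ?_)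
  rw [sub_zero, Real.norm_of_nonneg ht.1]
  exact ht.2

/-- Mean value inequality along the segment from `Θ` to `Θ + θ`. -/
theorem norm_sub_le_of_deriv_segment {f f' : ℝ → F} {Θ θ C : ℝ}
    (h : ∀ t ∈ Set.Icc (0 : ℝ) 1, HasDerivAt f (f' (Θ + t * θ)) (Θ + t * θ))
    (hC : ∀ t ∈ Set.Icc (0 : ℝ) 1, ‖f' (Θ + t * θ)‖ ≤ C) : ‖f (Θ + θ) - f Θ‖ ≤ |θ| * C := by
  have := norm_sub_le_of_deriv_le (φ := fun t => f (Θ + t * θ))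
    (φ' := fun t => θ • f' (Θ + t * θ)) (C := |θ| * C) (fun t ht => ?_) fun t ht => ?_
  · simpa using this
  · have h1 : HasDerivAt (fun t : ℝ => Θ + t * θ) θ t := by
      simpa using ((hasDerivAt_id t).mul_const θ).const_add Θ
    exact (h t ht).scomp t h1
  · rw [norm_smul, Real.norm_eq_abs]
    exact mul_le_mul_of_nonneg_left (hC t ht) (abs_nonneg _)

theorem norm_sub_sub_le_of_deriv_segment {f f' : ℝ → F} {c : F} {Θ θ C : ℝ}
    (h : ∀ t ∈ Set.Icc (0 : ℝ) 1, HasDerivAt f (f' (Θ + t * θ)) (Θ + t * θ))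
    (hC : ∀ t ∈ Set.Icc (0 : ℝ) 1, ‖f' (Θ + t * θ) - c‖ ≤ C) :
    ‖f (Θ + θ) - f Θ - θ • c‖ ≤ |θ| * C := by
  have h1 := norm_sub_le_of_deriv_segment (f := fun τ => f τ - τ • c) (f' := fun τ => f' τ - c)
    (fun t ht => by simpa using (h t ht).fun_sub ((hasDerivAt_id (Θ + t * θ)).smul_const c)) hC
  have e : f (Θ + θ) - (Θ + θ) • c - (f Θ - Θ • c) = f (Θ + θ) - f Θ - θ • c := by module
  rwa [e] at h1

theorem hasDerivAt_clm_apply_const {E : Type*} [NormedAddCommGroup E] [NormedSpace ℝ E]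
    {c : ℝ → E →L[ℝ] F} {c' : E →L[ℝ] F} {t : ℝ} (h : HasDerivAt c c' t) (x : E) :
    HasDerivAt (fun t => c t x) (c' x) t := by
  simpa using h.clm_apply (hasDerivAt_const t x)

end MeanValue

/-! ### Partial derivatives of a map of class `C²` on an open subset of `ℝ × E` -/

section Partial

variable {E F : Type*} [NormedAddCommGroup E] [NormedSpace ℝ E] [NormedAddCommGroup F]
  [NormedSpace ℝ F] {G : ℝ → E → F} {U : Set (ℝ × E)} (hU : IsOpen U)
  (hG : ContDiffOn ℝ 2 (fun p : ℝ × E => G p.1 p.2) U) {Θ : ℝ} {R : E}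
include hU hG

theorem contDiffAt_pair (hp : (Θ, R) ∈ U) : ContDiffAt ℝ 2 (fun p : ℝ × E => G p.1 p.2) (Θ, R) :=
  hG.contDiffAt (hU.mem_nhds hp)

theorem hasFDerivAt_pair (hp : (Θ, R) ∈ U) :
    HasFDerivAt (fun p : ℝ × E => G p.1 p.2) (fderiv ℝ (fun p : ℝ × E => G p.1 p.2) (Θ, R)) (Θ, R) :=
  ((contDiffAt_pair hU hG hp).differentiableAt (by norm_num)).hasFDerivAt

theorem hasFDerivAt_fderiv_pair (hp : (Θ, R) ∈ U) :
    HasFDerivAt (fderiv ℝ (fun p : ℝ × E => G p.1 p.2))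
      (fderiv ℝ (fderiv ℝ (fun p : ℝ × E => G p.1 p.2)) (Θ, R)) (Θ, R) :=
  (((contDiffAt_pair hU hG hp).fderiv_right (m := 1) (by norm_num)).differentiableAt
    (by norm_num)).hasFDerivAt

theorem snd_fderiv_symm (hp : (Θ, R) ∈ U) (x y : ℝ × E) :
    fderiv ℝ (fderiv ℝ (fun p : ℝ × E => G p.1 p.2)) (Θ, R) x y
      = fderiv ℝ (fderiv ℝ (fun p : ℝ × E => G p.1 p.2)) (Θ, R) y x :=
  ((contDiffAt_pair hU hG hp).isSymmSndFDerivAt (by simp)) x y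

theorem hasFDerivAt_snd (hp : (Θ, R) ∈ U) :
    HasFDerivAt (G Θ) ((fderiv ℝ (fun p : ℝ × E => G p.1 p.2) (Θ, R)).comp
      (ContinuousLinearMap.inr ℝ ℝ E)) R :=
  (hasFDerivAt_pair hU hG hp).comp R (hasFDerivAt_prodMk_right Θ R)

theorem fderiv_snd_apply (hp : (Θ, R) ∈ U) (h : E) :
    fderiv ℝ (G Θ) R h = fderiv ℝ (fun p : ℝ × E => G p.1 p.2) (Θ, R) (0, h) := by
  rw [(hasFDerivAt_snd hU hG hp).fderiv]; rfl

theorem hasDerivAt_fst (hp : (Θ, R) ∈ U) :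
    HasDerivAt (fun τ => G τ R) (fderiv ℝ (fun p : ℝ × E => G p.1 p.2) (Θ, R) (1, 0)) Θ := by
  have h1 : HasDerivAt (fun τ : ℝ => (τ, R)) ((1 : ℝ), (0 : E)) Θ :=
    (hasDerivAt_id Θ).prodMk (hasDerivAt_const Θ R)
  exact (hasFDerivAt_pair hU hG hp).comp_hasDerivAt Θ h1

theorem deriv_fst_eq (hp : (Θ, R) ∈ U) :
    deriv (fun τ => G τ R) Θ = fderiv ℝ (fun p : ℝ × E => G p.1 p.2) (Θ, R) (1, 0) :=
  (hasDerivAt_fst hU hG hp).deriv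

theorem hasDerivAt_fderiv_snd (hp : (Θ, R) ∈ U) (h : E) :
    HasDerivAt (fun τ => fderiv ℝ (G τ) R h)
      (fderiv ℝ (fderiv ℝ (fun p : ℝ × E => G p.1 p.2)) (Θ, R) (1, 0) (0, h)) Θ := by
  have h1 : HasDerivAt (fun τ : ℝ => (τ, R)) ((1 : ℝ), (0 : E)) Θ :=
    (hasDerivAt_id Θ).prodMk (hasDerivAt_const Θ R)
  have h2 := hasDerivAt_clm_apply_const
    (HasFDerivAt.comp_hasDerivAt (f := fun τ : ℝ => (τ, R)) Θ
      (hasFDerivAt_fderiv_pair hU hG hp) h1) ((0 : ℝ), h)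
  refine h2.congr_of_eventuallyEq ?_
  have hc : ContinuousAt (fun τ : ℝ => (τ, R)) Θ := h1.continuousAt
  filter_upwards [hc.eventually (hU.mem_nhds hp)] with τ hτ
  exact fderiv_snd_apply hU hG hτ h

theorem iteratedFDeriv_two_snd (hp : (Θ, R) ∈ U) (h : E) :
    iteratedFDeriv ℝ 2 (G Θ) R (fun _ => h)
      = fderiv ℝ (fderiv ℝ (fun p : ℝ × E => G p.1 p.2)) (Θ, R) (0, h) (0, h) := by
  rw [iteratedFDeriv_two_apply]
  have h1 : HasFDerivAt (fun x : E => (Θ, x)) (ContinuousLinearMap.inr ℝ ℝ E) R :=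
    hasFDerivAt_prodMk_right Θ R
  have h2 : HasFDerivAt (fun x : E => (fderiv ℝ (fun p : ℝ × E => G p.1 p.2) (Θ, x)).comp
      (ContinuousLinearMap.inr ℝ ℝ E)) _ R :=
    ((hasFDerivAt_fderiv_pair hU hG hp).comp R h1).clm_comp
      (hasFDerivAt_const (ContinuousLinearMap.inr ℝ ℝ E) R)
  have h3 : fderiv ℝ (G Θ) =ᶠ[nhds R] fun x : E =>
      (fderiv ℝ (fun p : ℝ × E => G p.1 p.2) (Θ, x)).comp (ContinuousLinearMap.inr ℝ ℝ E) := by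
    filter_upwards [h1.continuousAt.eventually (hU.mem_nhds hp)] with x hx
    exact (hasFDerivAt_snd hU hG hx).fderiv
  rw [h3.fderiv_eq, h2.fderiv]
  simp

theorem hasDerivAt_line {g : E} {t : ℝ} (hp : (Θ, R + t • g) ∈ U) :
    HasDerivAt (fun t : ℝ => G Θ (R + t • g)) (fderiv ℝ (G Θ) (R + t • g) g) t := by
  have h1 : HasDerivAt (fun t : ℝ => R + t • g) g t := by
    simpa using ((hasDerivAt_id t).smul_const g).const_add R
  exact ((hasFDerivAt_snd hU hG hp).differentiableAt.hasFDerivAt).comp_hasDerivAt t h1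

theorem hasDerivAt_fderiv_line {g : E} {t : ℝ} (hp : (Θ, R + t • g) ∈ U) (x : ℝ × E) :
    HasDerivAt (fun t : ℝ => fderiv ℝ (fun p : ℝ × E => G p.1 p.2) (Θ, R + t • g) x)
      (fderiv ℝ (fderiv ℝ (fun p : ℝ × E => G p.1 p.2)) (Θ, R + t • g) (0, g) x) t := by
  have h1 : HasDerivAt (fun t : ℝ => (Θ, R + t • g)) ((0 : ℝ), g) t := by
    have : HasDerivAt (fun t : ℝ => R + t • g) g t := by
      simpa using ((hasDerivAt_id t).smul_const g).const_add R
    exact (hasDerivAt_const t Θ).prodMk this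
  exact hasDerivAt_clm_apply_const (HasFDerivAt.comp_hasDerivAt (f := fun t : ℝ => (Θ, R + t • g)) t
    (hasFDerivAt_fderiv_pair hU hG hp) h1) x

omit [NormedAddCommGroup F] [NormedSpace ℝ F] hG in
theorem eventually_line {g : E} {t : ℝ} (hp : (Θ, R + t • g) ∈ U) :
    ∀ᶠ t' in nhds t, (Θ, R + t' • g) ∈ U := by
  have hc : Continuous fun t : ℝ => (Θ, R + t • g) := by fun_prop
  exact hc.continuousAt.eventually (hU.mem_nhds hp)

theorem hasDerivAt_fderiv_snd_line {g : E} {t : ℝ} (hp : (Θ, R + t • g) ∈ U) :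
    HasDerivAt (fun t : ℝ => fderiv ℝ (G Θ) (R + t • g) g)
      (iteratedFDeriv ℝ 2 (G Θ) (R + t • g) (fun _ => g)) t := by
  rw [iteratedFDeriv_two_snd hU hG hp]
  refine (hasDerivAt_fderiv_line hU hG hp _).congr_of_eventuallyEq ?_
  filter_upwards [eventually_line hU hp] with t' ht'
  exact fderiv_snd_apply hU hG ht' g

/-- Symmetry of the second derivative turns the R-derivative of ∂_ΘG into ∂_ΘDG, the quantity for
which bounds are assumed. -/
theorem hasDerivAt_deriv_fst_line {g : E} {t : ℝ} (hp : (Θ, R + t • g) ∈ U) :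
    HasDerivAt (fun t : ℝ => deriv (fun τ => G τ (R + t • g)) Θ)
      (deriv (fun τ => fderiv ℝ (G τ) (R + t • g) g) Θ) t := by
  rw [(hasDerivAt_fderiv_snd hU hG hp g).deriv, snd_fderiv_symm hU hG hp]
  refine (hasDerivAt_fderiv_line hU hG hp _).congr_of_eventuallyEq ?_
  filter_upwards [eventually_line hU hp] with t' ht'
  exact deriv_fst_eq hU hG ht'

theorem norm_taylor_snd_le {g : E} {C : ℝ} (hp : ∀ t ∈ Set.Icc (0 : ℝ) 1, (Θ, R + t • g) ∈ U)
    (hC : ∀ t ∈ Set.Icc (0 : ℝ) 1,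
      ‖iteratedFDeriv ℝ 2 (G Θ) (R + t • g) (fun _ => g)‖ ≤ C) :
    ‖G Θ (R + g) - G Θ R - fderiv ℝ (G Θ) R g‖ ≤ C := by
  simpa using norm_taylor_two_le (fun t ht => hasDerivAt_line hU hG (hp t ht))
    (fun t ht => hasDerivAt_fderiv_snd_line hU hG (hp t ht)) hC

theorem norm_deriv_fst_sub_le {g : E} {C : ℝ} (hp : ∀ t ∈ Set.Icc (0 : ℝ) 1, (Θ, R + t • g) ∈ U)
    (hC : ∀ t ∈ Set.Icc (0 : ℝ) 1,
      ‖deriv (fun τ => fderiv ℝ (G τ) (R + t • g) g) Θ‖ ≤ C) :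
    ‖deriv (fun τ => G τ (R + g)) Θ - deriv (fun τ => G τ R) Θ‖ ≤ C := by
  simpa using norm_sub_le_of_deriv_le
    (fun t ht => hasDerivAt_deriv_fst_line hU hG (hp t ht)) hC

theorem norm_deriv_fst_sub_sub_le {Θ' : ℝ} {g : E} {C : ℝ}
    (hp : ∀ t ∈ Set.Icc (0 : ℝ) 1, (Θ, R + t • g) ∈ U)
    (hp' : ∀ t ∈ Set.Icc (0 : ℝ) 1, (Θ', R + t • g) ∈ U)
    (hC : ∀ t ∈ Set.Icc (0 : ℝ) 1, ‖deriv (fun τ => fderiv ℝ (G τ) (R + t • g) g) Θ'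
      - deriv (fun τ => fderiv ℝ (G τ) (R + t • g) g) Θ‖ ≤ C) :
    ‖(deriv (fun τ => G τ (R + g)) Θ' - deriv (fun τ => G τ (R + g)) Θ)
      - (deriv (fun τ => G τ R) Θ' - deriv (fun τ => G τ R) Θ)‖ ≤ C := by
  simpa using norm_sub_le_of_deriv_le
    (fun t ht => (hasDerivAt_deriv_fst_line hU hG (hp' t ht)).sub
      (hasDerivAt_deriv_fst_line hU hG (hp t ht))) hC

theorem norm_fderiv_snd_sub_le {θ : ℝ} {g : E} {C : ℝ}
    (hp : ∀ t ∈ Set.Icc (0 : ℝ) 1, (Θ + t * θ, R) ∈ U)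
    (hC : ∀ t ∈ Set.Icc (0 : ℝ) 1, ‖deriv (fun τ => fderiv ℝ (G τ) R g) (Θ + t * θ)‖ ≤ C) :
    ‖fderiv ℝ (G (Θ + θ)) R g - fderiv ℝ (G Θ) R g‖ ≤ |θ| * C :=
  norm_sub_le_of_deriv_segment (f := fun τ => fderiv ℝ (G τ) R g)
    (f' := deriv fun τ => fderiv ℝ (G τ) R g)
    (fun t ht => (hasDerivAt_fderiv_snd hU hG (hp t ht) g).differentiableAt.hasDerivAt) hC

theorem norm_taylor_fst_le {θ : ℝ} {C : ℝ} (hp : ∀ t ∈ Set.Icc (0 : ℝ) 1, (Θ + t * θ, R) ∈ U)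
    (hC : ∀ t ∈ Set.Icc (0 : ℝ) 1,
      ‖deriv (fun τ => G τ R) (Θ + t * θ) - deriv (fun τ => G τ R) Θ‖ ≤ C) :
    ‖G (Θ + θ) R - G Θ R - θ • deriv (fun τ => G τ R) Θ‖ ≤ |θ| * C :=
  norm_sub_sub_le_of_deriv_segment (f := fun τ => G τ R) (f' := deriv fun τ => G τ R)
    (fun t ht => (hasDerivAt_fst hU hG (hp t ht)).differentiableAt.hasDerivAt) hC

/-- First order expansion of `∂_Θ G` in the second variable near a point where it is known. -/
theorem eventually_deriv_fst_expansion (hp : (Θ, R) ∈ U) (h0 : ∀ᶠ τ in nhds Θ, G τ R = 0)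
    {ε : ℝ} (hε : 0 < ε) : ∃ δ > 0, ∀ τ g, |τ - Θ| < δ → ‖g‖ < δ →
      ‖deriv (fun τ => G τ (R + g)) τ - deriv (fun τ => fderiv ℝ (G τ) R g) Θ‖ ≤ ε * ‖g‖ := by
  set P : ℝ × E → F := fun p => G p.1 p.2
  have hc1 : ContDiffAt ℝ 1 (fderiv ℝ P) (Θ, R) :=
    (contDiffAt_pair hU hG hp).fderiv_right (m := 1) (by norm_num)
  have hs := (hc1.hasStrictFDerivAt (by norm_num)).isLittleO
  obtain ⟨δ₁, hδ₁, h1⟩ := Metric.eventually_nhds_iff.1 (hs.def hε)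
  obtain ⟨δ₂, hδ₂, h2⟩ := Metric.eventually_nhds_iff.1 h0.eventually_nhds
  obtain ⟨δ₃, hδ₃, h3⟩ := Metric.mem_nhds_iff.1 (hU.mem_nhds hp)
  refine ⟨min δ₁ (min δ₂ δ₃), by positivity, fun τ g hτ hg => ?_⟩
  rw [lt_min_iff, lt_min_iff] at hτ hg
  have hd : ∀ (x : E) (ρ : ℝ), |τ - Θ| < ρ → ‖x‖ < ρ → dist (τ, R + x) (Θ, R) < ρ := by
    intro x ρ h h'
    rw [Prod.dist_eq, max_lt_iff]
    refine ⟨by simpa [Real.dist_eq] using h, by simpa [dist_eq_norm] using h'⟩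
  have hpg : (τ, R + g) ∈ U := h3 (hd g _ hτ.2.2 hg.2.2)
  have hp0 : (τ, R) ∈ U := h3 (by simpa using hd 0 _ hτ.2.2 (by simpa using hδ₃))
  have h4 := h1 (y := ((τ, R + g), (τ, R))) (by
    rw [Prod.dist_eq, max_lt_iff]
    exact ⟨hd g _ hτ.1 hg.1, by simpa using hd 0 _ hτ.1 (by simpa using hδ₁)⟩)
  -- The trivial branch G(τ, R) = 0 is differentiated in τ.
  have h5 : fderiv ℝ P (τ, R) (1, 0) = 0 := by
    rw [← deriv_fst_eq hU hG hp0]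
    have : (fun τ' => G τ' R) =ᶠ[nhds τ] fun _ => (0 : F) := h2 (by rw [Real.dist_eq]; exact hτ.2.1)
    rw [this.deriv_eq, deriv_const]
  have e : ((τ, R + g) : ℝ × E) - (τ, R) = (0, g) := by simp
  simp only [e] at h4
  rw [deriv_fst_eq hU hG hpg, (hasDerivAt_fderiv_snd hU hG hp g).deriv,
    snd_fderiv_symm hU hG hp]
  have h6 := (ContinuousLinearMap.le_opNorm _ ((1 : ℝ), (0 : E))).trans
    (mul_le_mul_of_nonneg_right h4 (norm_nonneg _))
  simp only [sub_apply, Prod.norm_mk, norm_one, norm_zero, norm_nonneg,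
    sup_of_le_right, sup_of_le_left, zero_le_one, mul_one] at h6
  rw [h5, sub_zero] at h6
  exact h6

/-- Strict differentiability compares (τ, R + g) with (τ, R), where G vanishes, and so gives an
expansion in g that is uniform in τ. -/
theorem eventually_expansion (hp : (Θ, R) ∈ U) (h0 : ∀ᶠ τ in nhds Θ, G τ R = 0)
    {ε : ℝ} (hε : 0 < ε) : ∃ δ > 0, ∀ τ g, |τ - Θ| < δ → ‖g‖ < δ →
      ‖G τ (R + g) - fderiv ℝ (G Θ) R g‖ ≤ ε * ‖g‖ := by
  set P : ℝ × E → F := fun p => G p.1 p.2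
  have hs := ((contDiffAt_pair hU hG hp).hasStrictFDerivAt (by norm_num)).isLittleO
  obtain ⟨δ₁, hδ₁, h1⟩ := Metric.eventually_nhds_iff.1 (hs.def hε)
  obtain ⟨δ₂, hδ₂, h2⟩ := Metric.eventually_nhds_iff.1 h0
  refine ⟨min δ₁ δ₂, by positivity, fun τ g hτ hg => ?_⟩
  rw [lt_min_iff] at hτ hg
  have hd : ∀ (x : E) (ρ : ℝ), |τ - Θ| < ρ → ‖x‖ < ρ → dist (τ, R + x) (Θ, R) < ρ := by
    intro x ρ h h'
    rw [Prod.dist_eq, max_lt_iff]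
    refine ⟨by simpa [Real.dist_eq] using h, by simpa [dist_eq_norm] using h'⟩
  have h4 := h1 (y := ((τ, R + g), (τ, R))) (by
    rw [Prod.dist_eq, max_lt_iff]
    exact ⟨hd g _ hτ.1 hg.1, by simpa using hd 0 _ hτ.1 (by simpa using hδ₁)⟩)
  have e : ((τ, R + g) : ℝ × E) - (τ, R) = (0, g) := by simp
  have h5 : G τ R = 0 := h2 (by rw [Real.dist_eq]; exact hτ.2)
  simp only [e, h5, sub_zero] at h4
  rw [fderiv_snd_apply hU hG hp]
  simpa using h4

end Partial

end NashMoser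

namespace NashMoser

/-! ### Triples -/

section Triples

variable {S : Submodule ℝ L2} {k l : ℕ}

/-- The inclusion of the smooth triples in the triples of Sobolev class `k`. -/
def to3 (k : ℕ) : (Fin 3 → CInf S) →ₗ[ℝ] (Fin 3 → HSp S k) := (toH k).compLeft (Fin 3)

theorem fn3_apply (f : Fin 3 → HSp S k) (i : Fin 3) : fn3 f i = HSp.toL2 (f i) := rfl

theorem fn3_to3 (k : ℕ) (R : Fin 3 → CInf S) : fn3 (to3 k R) = fnInf R := rfl

theorem fn3_injective : Function.Injective (fn3 : (Fin 3 → HSp S k) → Fin 3 → L2) := fun _ _ h =>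
  funext fun i => HSp.toL2_injective (congrFun h i)

theorem fnInf_injective : Function.Injective (fnInf : (Fin 3 → CInf S) → Fin 3 → L2) := fun _ _ h =>
  funext fun i => Subtype.ext (congrFun h i)

theorem fn3_add (f g : Fin 3 → HSp S k) : fn3 (f + g) = fn3 f + fn3 g :=
  funext fun i => map_add HSp.toL2 (f i) (g i)

theorem fn3_smul (c : ℝ) (f : Fin 3 → HSp S k) : fn3 (c • f) = c • fn3 f :=
  funext fun i => map_smul HSp.toL2 c (f i)

/-- The inclusion between triples of Sobolev classes `l ≤ k`. -/
def incl3 (h : l ≤ k) : (Fin 3 → HSp S k) →L[ℝ] (Fin 3 → HSp S l) :=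
  ContinuousLinearMap.pi fun i => (HSp.incl h).comp (ContinuousLinearMap.proj i)

theorem incl3_apply (h : l ≤ k) (f : Fin 3 → HSp S k) (i : Fin 3) :
    incl3 h f i = HSp.incl h (f i) := rfl

theorem fn3_incl3 (h : l ≤ k) (f : Fin 3 → HSp S k) : fn3 (incl3 h f) = fn3 f := by
  funext i
  rw [fn3_apply, incl3_apply, HSp.coe_incl, fn3_apply]

theorem norm_incl3_le (h : l ≤ k) (f : Fin 3 → HSp S k) : ‖incl3 h f‖ ≤ ‖f‖ :=
  (pi_norm_le_iff_of_nonneg (norm_nonneg _)).2 fun i =>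
    (HSp.norm_incl_le h (f i)).trans (norm_le_pi_norm f i)

theorem incl3_to3 (h : l ≤ k) (R : Fin 3 → CInf S) : incl3 h (to3 k R) = to3 l R :=
  fn3_injective (by rw [fn3_incl3, fn3_to3, fn3_to3])

theorem norm_to3_mono (h : l ≤ k) (R : Fin 3 → CInf S) : ‖to3 l R‖ ≤ ‖to3 k R‖ := by
  rw [← incl3_to3 h]; exact norm_incl3_le h _

/-- All frequencies of the components of `R` satisfy `1 + n² ≤ M²`. -/
def Band3 (M : ℝ) (R : Fin 3 → CInf S) : Prop := ∀ i, Band M (R i)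

theorem Band3.add {M : ℝ} {f g : Fin 3 → CInf S} (hf : Band3 M f) (hg : Band3 M g) :
    Band3 M (f + g) := fun i => (hf i).add (hg i)

theorem Band3.mono {M N : ℝ} (hM : 0 ≤ M) (h : M ≤ N) {f : Fin 3 → CInf S} (hf : Band3 M f) :
    Band3 N f := fun i => (hf i).mono hM h

theorem Band3.norm_to3_le {M : ℝ} (hM : 0 ≤ M) {f : Fin 3 → CInf S} (hf : Band3 M f) (k j : ℕ) :
    ‖to3 (k + j) f‖ ≤ M ^ j * ‖to3 k f‖ :=
  (pi_norm_le_iff_of_nonneg (by positivity)).2 fun i =>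
    ((hf i).norm_toH_le hM k j).trans
      (mul_le_mul_of_nonneg_left (norm_le_pi_norm (to3 k f) i) (by positivity))

variable [TrigSpace S]

/-- Fourier truncation of triples. -/
def trunc3 (N : ℝ) : (Fin 3 → HSp S k) →ₗ[ℝ] (Fin 3 → CInf S) := (trunc N).compLeft (Fin 3)

/-- Truncation sees only the underlying functions, so a residual may be truncated in whichever
Sobolev class is convenient. -/
theorem trunc3_congr (N : ℝ) {f : Fin 3 → HSp S k} {g : Fin 3 → HSp S l} (h : fn3 f = fn3 g) :
    trunc3 N f = trunc3 N g :=
  fnInf_injective (funext fun i => congrArg (cut N) (congrFun h i))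

theorem band3_trunc3 {N : ℝ} (hN : 0 ≤ N) (f : Fin 3 → HSp S k) : Band3 N (trunc3 N f) :=
  fun i => band_trunc hN (f i)

theorem norm_to3_trunc3_le {N : ℝ} (hN : 0 ≤ N) (j : ℕ) (f : Fin 3 → HSp S k) :
    ‖to3 (k + j) (trunc3 N f)‖ ≤ N ^ j * ‖f‖ :=
  (pi_norm_le_iff_of_nonneg (by positivity)).2 fun i =>
    (norm_toH_trunc_le hN j (f i)).trans
      (mul_le_mul_of_nonneg_left (norm_le_pi_norm f i) (by positivity))

theorem norm_to3_trunc3_le_self {N : ℝ} (hN : 0 ≤ N) (f : Fin 3 → HSp S k) :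
    ‖to3 k (trunc3 N f)‖ ≤ ‖f‖ := by
  simpa using norm_to3_trunc3_le hN 0 f

theorem norm_sub_trunc3_le {N : ℝ} (hN : 0 < N) (j : ℕ) (f : Fin 3 → HSp S k)
    (g : Fin 3 → HSp S (k + j)) (hfg : fn3 f = fn3 g) :
    ‖f - to3 k (trunc3 N f)‖ ≤ ‖g‖ / N ^ j := by
  refine (pi_norm_le_iff_of_nonneg (by positivity)).2 fun i => ?_
  rw [le_div_iff₀' (by positivity)]
  exact (pow_mul_norm_sub_trunc_le hN.le j (f i) (g i) (congrFun hfg i)).trans (norm_le_pi_norm g i)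

theorem exists_norm_sub_trunc3_lt (f : Fin 3 → HSp S k) {ε : ℝ} (hε : 0 < ε) :
    ∃ N₀ : ℝ, 0 ≤ N₀ ∧ ∀ N, N₀ ≤ N → ‖f - to3 k (trunc3 N f)‖ < ε := by
  choose N₀ h0 h1 using fun i => exists_norm_sub_trunc_lt (f i) hε
  refine ⟨∑ i, N₀ i, Finset.sum_nonneg fun i _ => h0 i, fun N hN => ?_⟩
  exact (pi_norm_lt_iff hε).2 fun i => h1 i N
    ((Finset.single_le_sum (fun i _ => h0 i) (Finset.mem_univ i)).trans hN)

/-- Fourier truncation as a continuous map between Sobolev classes. -/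
def trunc3L {N : ℝ} (hN : 0 ≤ N) (k l : ℕ) : (Fin 3 → HSp S k) →L[ℝ] (Fin 3 → HSp S l) :=
  ((to3 l).comp (trunc3 N)).mkContinuous (N ^ l) fun f =>
    (norm_to3_mono (Nat.le_add_left l k) (trunc3 N f)).trans (norm_to3_trunc3_le hN l f)

end Triples

/-! ### The chain (Y^{k+1})³ ⊆ Y^{k+1} × (Y^k)² ⊆ (Y^k)³. -/

section YT

variable {m k : ℕ}

/-- The inclusion `(Y^{k+1})³ ⊆ Y^{k+1} × (Y^k)²`. -/
def toYT : Y3 m (k + 1) →L[ℝ] YT m k :=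
  (ContinuousLinearMap.proj 0).prod
    (((HSp.incl (Nat.le_succ k)).comp (ContinuousLinearMap.proj 1)).prod
      ((HSp.incl (Nat.le_succ k)).comp (ContinuousLinearMap.proj 2)))

/-- The inclusion `Y^{k+1} × (Y^k)² ⊆ (Y^k)³`. -/
def ofYT : YT m k →L[ℝ] Y3 m k :=
  ContinuousLinearMap.pi ![(HSp.incl (Nat.le_succ k)).comp (ContinuousLinearMap.fst ℝ _ _),
    (ContinuousLinearMap.fst ℝ _ _).comp (ContinuousLinearMap.snd ℝ _ _),
    (ContinuousLinearMap.snd ℝ _ _).comp (ContinuousLinearMap.snd ℝ _ _)]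

theorem ofYT_apply (z : YT m k) : ofYT z = ![HSp.incl (Nat.le_succ k) z.1, z.2.1, z.2.2] := by
  funext i; fin_cases i <;> rfl

theorem toYT_apply (z : Y3 m (k + 1)) :
    toYT z = (z 0, HSp.incl (Nat.le_succ k) (z 1), HSp.incl (Nat.le_succ k) (z 2)) := rfl

theorem fnT_eq (z : YT m k) :
    fnT z = ![HSp.toL2 z.1, HSp.toL2 z.2.1, HSp.toL2 z.2.2] := rfl

theorem fn3_ofYT (z : YT m k) : fn3 (ofYT z) = fnT z := by
  rw [ofYT_apply, fnT_eq]
  funext i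
  rw [fn3_apply]
  fin_cases i
  · change HSp.toL2 (HSp.incl (Nat.le_succ k) z.1) = _
    rw [HSp.coe_incl]; rfl
  · rfl
  · rfl

theorem fnT_toYT (z : Y3 m (k + 1)) : fnT (toYT z) = fn3 z := by
  rw [toYT_apply, fnT_eq, HSp.coe_incl, HSp.coe_incl]
  funext i
  rw [fn3_apply]
  fin_cases i <;> rfl

theorem ofYT_injective : Function.Injective (ofYT : YT m k →L[ℝ] Y3 m k) := by
  rw [injective_iff_map_eq_zero]
  intro z hz
  have h : ∀ i, fnT z i = 0 := fun i => by rw [← fn3_ofYT, hz]; exact map_zero HSp.toL2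
  have h0 : (z.1 : L2) = (0 : Y m (k + 1)) := (h 0).trans (map_zero HSp.toL2).symm
  have h1 : (z.2.1 : L2) = (0 : Y m k) := (h 1).trans (map_zero HSp.toL2).symm
  have h2 : (z.2.2 : L2) = (0 : Y m k) := (h 2).trans (map_zero HSp.toL2).symm
  exact Prod.ext (HSp.toL2_injective h0)
    (Prod.ext (HSp.toL2_injective h1) (HSp.toL2_injective h2))

theorem fnT_injective : Function.Injective (fnT : YT m k → Fin 3 → L2) := fun z z' h =>
  ofYT_injective (fn3_injective (by rw [fn3_ofYT, fn3_ofYT, h]))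

theorem norm_toYT_le (z : Y3 m (k + 1)) : ‖toYT z‖ ≤ ‖z‖ := by
  rw [toYT_apply, Prod.norm_mk, Prod.norm_mk]
  exact max_le (norm_le_pi_norm z 0) (max_le
    ((HSp.norm_incl_le _ _).trans (norm_le_pi_norm z 1))
    ((HSp.norm_incl_le _ _).trans (norm_le_pi_norm z 2)))

theorem norm_ofYT_le (z : YT m k) : ‖ofYT z‖ ≤ ‖z‖ := by
  rw [ofYT_apply]
  refine (pi_norm_le_iff_of_nonneg (norm_nonneg _)).2 fun i => ?_
  have h1 : ‖z.2‖ ≤ ‖z‖ := le_max_right _ _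
  fin_cases i
  · exact (HSp.norm_incl_le (Nat.le_succ k) z.1).trans (le_max_left _ _)
  · exact (le_max_left ‖z.2.1‖ ‖z.2.2‖).trans h1
  · exact (le_max_right ‖z.2.1‖ ‖z.2.2‖).trans h1

theorem toYT_to3 (z : YInf m) : toYT (to3 (k + 1) z) = z.to k :=
  fnT_injective (by rw [fnT_toYT]; funext i; fin_cases i <;> rfl)

theorem ofYT_to (z : YInf m) : ofYT (z.to k) = to3 k z :=
  fn3_injective (by rw [fn3_ofYT]; funext i; fin_cases i <;> rfl)

end YT

/-! ### The bordered operator -/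

section Bordered

variable {m k : ℕ}

/-- The `L²` product with the smooth triple `v`. -/
def pairing (v : XInf m) (k : ℕ) : X3 m k →L[ℝ] ℝ :=
  ∑ i, (innerSL ℝ (fnInf v i)).comp (HSp.toL2L.comp (ContinuousLinearMap.proj i))

theorem pairing_apply (v : XInf m) (h : X3 m k) : pairing v k h = dot (fn3 h) (fnInf v) := by
  rw [pairing, sum_apply, dot]
  refine Finset.sum_congr rfl fun i _ => ?_
  rw [real_inner_comm]; rfl

theorem pairing_self_pos {v : XInf m} (hv : v ≠ 0) : 0 < pairing v k (to3 k v) := by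
  rw [pairing_apply, dot, fn3_to3]
  obtain ⟨i, hi⟩ := Function.ne_iff.1 hv
  refine Finset.sum_pos' (fun i _ => real_inner_self_nonneg) ⟨i, Finset.mem_univ i, ?_⟩
  exact real_inner_self_pos.2 fun h => hi (Subtype.ext h)

/-- The operator `(θ, h) ↦ (θ p + A h, ⟨h, v⟩)`. -/
def bordered (v : XInf m) (p : YT m k) (A : X3 m (k + 1) →L[ℝ] YT m k) :
    ℝ × X3 m (k + 1) →L[ℝ] YT m k × ℝ :=
  (((ContinuousLinearMap.fst ℝ ℝ (X3 m (k + 1))).smulRight p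
    + A.comp (ContinuousLinearMap.snd ℝ ℝ (X3 m (k + 1))))).prod
    ((pairing v (k + 1)).comp (ContinuousLinearMap.snd ℝ ℝ (X3 m (k + 1))))

theorem bordered_apply (v : XInf m) (p : YT m k) (A : X3 m (k + 1) →L[ℝ] YT m k)
    (x : ℝ × X3 m (k + 1)) : bordered v p A x = (x.1 • p + A x.2, pairing v (k + 1) x.2) := rfl

/-- The row ⟨·, v⟩ is fixed and cancels. This serves both the perturbation from (Θ*, 0) and the
continuity in s. -/
theorem norm_bordered_sub_le (v : XInf m) (p p' : YT m k) (A A' : X3 m (k + 1) →L[ℝ] YT m k) :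
    ‖bordered v p A - bordered v p' A'‖ ≤ ‖p - p'‖ + ‖A - A'‖ := by
  refine ContinuousLinearMap.opNorm_le_bound _ (by positivity) fun x => ?_
  have e : (bordered v p A - bordered v p' A') x = (x.1 • (p - p') + (A - A') x.2, 0) := by
    rw [sub_apply, bordered_apply, bordered_apply, Prod.mk_sub_mk, sub_self, sub_apply]
    congr 1; module
  rw [e, Prod.norm_mk, norm_zero, max_eq_left (norm_nonneg _), add_mul]
  refine (norm_add_le _ _).trans (add_le_add ?_ ?_)
  · rw [norm_smul, mul_comm]
    exact mul_le_mul_of_nonneg_left (norm_fst_le x) (norm_nonneg _)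
  · exact ((A - A').le_opNorm _).trans (mul_le_mul_of_nonneg_left (norm_snd_le x) (norm_nonneg _))

/-- The column b fills the one missing dimension of the range of A, since it is outside that range,
and the row ⟨·, v⟩ detects the one dimensional kernel, since ⟨v, v⟩ > 0. -/
theorem bordered_bijective {v : XInf m} (hv : v ≠ 0) {b : YT m k}
    {A : X3 m (k + 1) →L[ℝ] YT m k} (hb : b ∉ Set.range A)
    (hker : ∀ h, A h = 0 ↔ ∃ t : ℝ, h = t • to3 (k + 1) v)
    (hcoker : Module.finrank ℝ (YT m k ⧸ LinearMap.range (A : X3 m (k + 1) →ₗ[ℝ] YT m k)) = 1) :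
    Function.Bijective (bordered v b A) := by
  have hvv : 0 < pairing v (k + 1) (to3 (k + 1) v) := pairing_self_pos hv
  have hAv : A (to3 (k + 1) v) = 0 := (hker _).2 ⟨1, by rw [one_smul]⟩
  constructor
  · rw [injective_iff_map_eq_zero]
    rintro ⟨θ, h⟩ h0
    rw [bordered_apply, Prod.mk_eq_zero] at h0
    obtain ⟨h1, h2⟩ := h0
    have hθ : θ = 0 := by
      by_contra hne
      refine hb ⟨-(θ⁻¹ • h), ?_⟩
      have : A h = -(θ • b) := by rw [eq_neg_iff_add_eq_zero, add_comm]; exact h1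
      rw [map_neg, map_smul, this, smul_neg, neg_neg, smul_smul, inv_mul_cancel₀ hne, one_smul]
    subst hθ
    simp only [zero_smul, zero_add] at h1
    obtain ⟨t, rfl⟩ := (hker h).1 h1
    rw [map_smul, smul_eq_mul] at h2
    have ht : t = 0 := (mul_eq_zero.1 h2).resolve_right hvv.ne'
    rw [ht, zero_smul]; rfl
  · rintro ⟨y, c⟩
    have hb' : (Submodule.mkQ (LinearMap.range (A : X3 m (k + 1) →ₗ[ℝ] YT m k))) b ≠ 0 := by
      rw [Submodule.mkQ_apply, Ne, Submodule.Quotient.mk_eq_zero]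
      exact hb
    obtain ⟨θ, hθ⟩ := (finrank_eq_one_iff_of_nonzero' _ hb').1 hcoker
      (Submodule.mkQ (LinearMap.range (A : X3 m (k + 1) →ₗ[ℝ] YT m k)) y)
    rw [← map_smul, Submodule.mkQ_apply, Submodule.mkQ_apply, Submodule.Quotient.eq] at hθ
    obtain ⟨h, hh⟩ := hθ
    have hh' : A h = θ • b - y := hh
    -- The multiple of v is free because v is in the kernel; it is chosen to meet the scalar
    -- equation.
    set t := (c - pairing v (k + 1) (-h)) / pairing v (k + 1) (to3 (k + 1) v)
    refine ⟨(θ, -h + t • to3 (k + 1) v), ?_⟩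
    rw [bordered_apply]
    refine Prod.ext ?_ ?_
    · change θ • b + A (-h + t • to3 (k + 1) v) = y
      rw [map_add, map_neg, map_smul, hAv, hh']; module
    · change pairing v (k + 1) (-h + t • to3 (k + 1) v) = c
      rw [map_add, map_smul, smul_eq_mul, div_mul_cancel₀ _ hvv.ne']; ring

/-- Bounded invertibility persists near an invertible operator. -/
theorem exists_inverse_bound {E F : Type*} [NormedAddCommGroup E] [NormedSpace ℝ E]
    [CompleteSpace E] [NormedAddCommGroup F] [NormedSpace ℝ F] [CompleteSpace F] {M₀ : E →L[ℝ] F}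
    (h : Function.Bijective M₀) : ∃ δ > 0, ∃ C : ℝ, 1 ≤ C ∧ ∀ M : E →L[ℝ] F, ‖M - M₀‖ < δ →
      M.IsInvertible ∧ ‖M.inverse‖ ≤ C := by
  let e : E ≃L[ℝ] F := ContinuousLinearEquiv.ofBijective M₀
    (LinearMap.ker_eq_bot.2 h.1) (LinearMap.range_eq_top.2 h.2)
  have he : (e : E →L[ℝ] F) = M₀ := ContinuousLinearEquiv.coe_ofBijective _ _ _
  have h1 : ContinuousAt (ContinuousLinearMap.inverse : (E →L[ℝ] F) → (F →L[ℝ] E)) M₀ := by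
    rw [← he]; exact (contDiffAt_map_inverse (n := 0) e).continuousAt
  have h2 : ∀ᶠ M in nhds M₀, M.IsInvertible := by rw [← he]; exact e.nhds
  have h3 : ∀ᶠ M in nhds M₀, ‖ContinuousLinearMap.inverse M‖ < ‖M₀.inverse‖ + 1 :=
    h1.norm.eventually_lt_const (lt_add_one _)
  obtain ⟨δ, hδ, h4⟩ := Metric.eventually_nhds_iff.1 (h2.and h3)
  refine ⟨δ, hδ, ‖M₀.inverse‖ + 1, by linarith [norm_nonneg M₀.inverse], fun M hM => ?_⟩
  have := h4 (y := M) (by rwa [dist_eq_norm])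
  exact ⟨this.1, this.2.le⟩

end Bordered

end NashMoser

/-! ### The data of the problem, a common domain, and bounds for the rescaled map. -/

namespace NashMoser

/-- The data of the bifurcation theorem and the assumptions on them. -/
structure Bifurcation (m : ℕ) where
  (Θs : ℝ) (I : Set ℝ) (isOpen_I : IsOpen I) (Θs_mem : Θs ∈ I)
  (V : Set L2) (isOpen_V : IsOpen {f : X m 3 | (f : L2) ∈ V}) (zero_mem_V : (0 : L2) ∈ V)
  (G : ∀ k : ℕ, ℝ → X3 m (k + 1) → Y3 m k)
  (G_compat : ∀ k l : ℕ, 2 ≤ k → 2 ≤ l → ∀ Θ ∈ I, ∀ R ∈ cube V m (k + 1), ∀ R' ∈ cube V m (l + 1),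
      fn3 R = fn3 R' → fn3 (G k Θ R) = fn3 (G l Θ R'))
  (a : ∀ k : ℕ, ℝ → XInf m → (X3 m (k + 1) →L[ℝ] Y3 m k))
  (A : ∀ k : ℕ, ℝ → XInf m → (X3 m (k + 1) →L[ℝ] YT m k))
  (G_zero : ∀ k : ℕ, 2 ≤ k → ∀ Θ ∈ I, G k Θ 0 = 0)
  (contDiffOn_G : ∀ k : ℕ, 2 ≤ k →
      ContDiffOn ℝ 2 (fun p : ℝ × X3 m (k + 1) => G k p.1 p.2) (I ×ˢ cube V m (k + 1)))
  (differentiableAt_deriv : ∀ k : ℕ, 2 ≤ k → ∀ Θ ∈ I, ∀ R ∈ smoothCube V m, ∀ h : X3 m (k + 1),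
      DifferentiableAt ℝ (deriv (fun τ => fderiv ℝ (G k τ) (to3 (k + 1) R) h)) Θ)
  (bound : ∀ k : ℕ, 2 ≤ k → ∃ C : ℝ, ∀ Θ ∈ I, ∀ R ∈ smoothCube V m,
      ‖G k Θ (to3 (k + 1) R)‖ ≤ C * (1 + ‖to3 (k + 1) R‖) ∧
      ‖deriv (fun τ => G k τ (to3 (k + 1) R)) Θ‖ ≤ C * (1 + ‖to3 (k + 1) R‖) ∧
      ∀ h : X3 m (k + 1),
        ‖iteratedFDeriv ℝ 2 (G k Θ) (to3 (k + 1) R) (fun _ => h)‖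
          ≤ C * (1 + ‖to3 (k + 3) R‖) * ‖h‖ ^ 2 ∧
        ‖deriv (fun τ => fderiv ℝ (G k τ) (to3 (k + 1) R) h) Θ‖
          ≤ C * (1 + ‖to3 (k + 3) R‖) * ‖h‖ ∧
        ‖iteratedDeriv 2 (fun τ => fderiv ℝ (G k τ) (to3 (k + 1) R) h) Θ‖
          ≤ C * (1 + ‖to3 (k + 3) R‖) * ‖h‖)
  (decomp : ∀ k : ℕ, 2 ≤ k → ∀ Θ ∈ I, ∀ R ∈ smoothCube V m, ∀ h : X3 m (k + 1),
      fn3 (fderiv ℝ (G k Θ) (to3 (k + 1) R) h) = fn3 (a k Θ R h) + fnT (A k Θ R h))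
  (decomp_bound : ∀ k : ℕ, 2 ≤ k → ∃ η : ℝ, 0 < η ∧ η < 1 ∧ ∃ C : ℝ,
      ∀ Θ ∈ I, ∀ R ∈ smoothCube V m, ‖to3 (k + 2) R‖ ≤ η → ∀ h : X3 m (k + 1),
        ‖a k Θ R h‖ ≤ C * ‖G k Θ (to3 (k + 1) R)‖ * ‖h‖ ∧
        ‖A k Θ R h‖ ≤ C * (1 + ‖to3 (k + 3) R‖) * ‖h‖)
  (lipschitz : ∀ k : ℕ, 2 ≤ k → ∃ C : ℝ, ∀ Θ₁ ∈ I, ∀ Θ₂ ∈ I,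
      ∀ R₁ ∈ smoothCube V m, ∀ R₂ ∈ smoothCube V m, ‖to3 (k + 3) R₁‖ ≤ 1 → ‖to3 (k + 3) R₂‖ ≤ 1 →
        ∀ h : X3 m (k + 1),
          ‖A k Θ₁ R₁ h - A k Θ₂ R₂ h‖
            ≤ C * (|Θ₁ - Θ₂| + ‖to3 (k + 3) R₁ - to3 (k + 3) R₂‖) * ‖h‖)
  (tame : ∀ k : ℕ, 2 ≤ k → ∃ η : ℝ, 0 < η ∧ η < 1 ∧ ∃ C : ℕ → ℝ,
      ∀ Θ ∈ I, ∀ R ∈ smoothCube V m, ‖to3 (k + 3) R‖ ≤ η →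
        ∀ (h : X3 m (k + 1)) (z : YInf m), A k Θ R h = z.to k →
          (∀ g : X3 m (k + 1), A k Θs 0 g = 0 → dot (fn3 h) (fn3 g) = 0) →
          ∃ h' : XInf m, to3 (k + 1) h' = h ∧ ∀ σ : ℕ, Even σ →
            ‖to3 (k + 1 + σ) h'‖
              ≤ C σ * ((1 + ‖to3 (k + 4 + σ) R‖) * ‖z.to k‖ + ‖z.to (k + σ)‖))
  (v : XInf m) (v_ne : v ≠ 0)
  (v_mode : ∃ c : Fin 3 → ℝ, fnInf v = fun i => c i • cosMode m)
  (ker : ∀ k : ℕ, 2 ≤ k → ∀ h : X3 m (k + 1),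
      A k Θs 0 h = 0 ↔ ∃ t : ℝ, h = t • to3 (k + 1) v)
  (coker : ∀ k : ℕ, 2 ≤ k →
      Module.finrank ℝ (YT m k ⧸ LinearMap.range (A k Θs 0 : X3 m (k + 1) →ₗ[ℝ] YT m k)) = 1)
  (transversal : ∀ k : ℕ, 2 ≤ k →
      deriv (fun τ => A k τ 0 (to3 (k + 1) v)) Θs ∉ Set.range (A k Θs 0))

theorem mul_le_mul_one_add {C C' x : ℝ} (h : C ≤ C') (hx : 0 ≤ x) : C * (1 + x) ≤ C' * (1 + x) :=
  mul_le_mul_of_nonneg_right h (by linarith)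

namespace Bifurcation

variable {m : ℕ} (D : Bifurcation m) {k : ℕ}

/-- V is open in the topology of X³, and k + 1 ≥ 3, so the inclusion of X^{k+1} in X³ pulls it back.
-/
theorem isOpen_cube (hk : 2 ≤ k) : IsOpen (cube D.V m (k + 1)) := by
  have h3 : 3 ≤ k + 1 := by omega
  have e : cube D.V m (k + 1)
      = ⋂ i, (fun R : X3 m (k + 1) => incl3 h3 R i) ⁻¹' {f : X m 3 | (f : L2) ∈ D.V} := by
    ext R
    simp only [cube, Set.mem_iInter, Set.mem_preimage, Set.mem_ofPred_eq]
    refine forall_congr' fun i => ?_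
    rw [fn3_apply, incl3_apply, HSp.coe_incl]
  rw [e]
  refine isOpen_iInter_of_finite fun i => D.isOpen_V.preimage ?_
  exact (continuous_apply i).comp (incl3 h3).continuous

theorem isOpen_domain (hk : 2 ≤ k) : IsOpen (D.I ×ˢ cube D.V m (k + 1)) :=
  D.isOpen_I.prod (D.isOpen_cube hk)

/-- Membership in V is tested in X³, so one radius serves all k. -/
theorem exists_radius : ∃ r : ℝ, 0 < r ∧ r ≤ 1 ∧ (∀ Θ, |Θ - D.Θs| ≤ r → Θ ∈ D.I) ∧
    ∀ k, 2 ≤ k → ∀ R : X3 m (k + 1), ∀ R' : X3 m 3, fn3 R = fn3 R' → ‖R'‖ ≤ r →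
      R ∈ cube D.V m (k + 1) := by
  obtain ⟨r₁, h1, h1'⟩ := Metric.isOpen_iff.1 D.isOpen_I _ D.Θs_mem
  have h0 : (0 : X m 3) ∈ {f : X m 3 | (f : L2) ∈ D.V} := by
    change HSp.toL2 (0 : X m 3) ∈ D.V
    rw [map_zero]; exact D.zero_mem_V
  obtain ⟨r₂, h2, h2'⟩ := Metric.isOpen_iff.1 D.isOpen_V _ h0
  refine ⟨min 1 (min (r₁ / 2) (r₂ / 2)), by positivity, min_le_left _ _, fun Θ hΘ => h1' ?_,
    fun k _ R R' hR hn i => ?_⟩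
  · rw [Metric.mem_ball, Real.dist_eq]
    have := hΘ.trans ((min_le_right _ _).trans (min_le_left _ _))
    linarith
  · rw [hR]
    have hi : R' i ∈ Metric.ball (0 : X m 3) r₂ := by
      rw [mem_ball_zero_iff]
      have := (norm_le_pi_norm R' i).trans (hn.trans ((min_le_right _ _).trans (min_le_right _ _)))
      linarith
    exact h2' hi

/-- A radius of a ball around `(Θ*, 0)` contained in the domain. -/
def radius : ℝ := D.exists_radius.choose

theorem radius_pos : 0 < D.radius := D.exists_radius.choose_spec.1

/-- The points `(Θ, R)`, `R` smooth, of a ball around `(Θ*, 0)` contained in the domain. -/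
def Near (Θ : ℝ) (R : XInf m) : Prop := |Θ - D.Θs| ≤ D.radius ∧ ‖to3 3 R‖ ≤ D.radius

variable {D}

theorem mem_I_of_abs_le {Θ : ℝ} (h : |Θ - D.Θs| ≤ D.radius) : Θ ∈ D.I :=
  D.exists_radius.choose_spec.2.2.1 Θ h

theorem mem_cube_of_norm_le (hk : 2 ≤ k) {R : X3 m (k + 1)} {R' : X3 m 3} (h : fn3 R = fn3 R')
    (hR : ‖R'‖ ≤ D.radius) : R ∈ cube D.V m (k + 1) :=
  D.exists_radius.choose_spec.2.2.2 k hk R R' h hR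

variable {Θ : ℝ} {R : XInf m}

theorem Near.mem_I (h : D.Near Θ R) : Θ ∈ D.I := mem_I_of_abs_le h.1

theorem Near.mem_cube (h : D.Near Θ R) (hk : 2 ≤ k) : to3 (k + 1) R ∈ cube D.V m (k + 1) :=
  mem_cube_of_norm_le hk (by rw [fn3_to3, fn3_to3]) h.2

theorem Near.mem_smoothCube (h : D.Near Θ R) : R ∈ smoothCube D.V m := fun i =>
  h.mem_cube (k := 2) le_rfl i

theorem Near.mem_domain (h : D.Near Θ R) (hk : 2 ≤ k) :
    (Θ, to3 (k + 1) R) ∈ D.I ×ˢ cube D.V m (k + 1) := ⟨h.mem_I, h.mem_cube hk⟩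

theorem Near.smul (h : D.Near Θ R) {t : ℝ} (ht : t ∈ Set.Icc (0 : ℝ) 1) : D.Near Θ (t • R) := by
  refine ⟨h.1, ?_⟩
  rw [map_smul, norm_smul, Real.norm_of_nonneg ht.1]
  exact (mul_le_of_le_one_left (norm_nonneg _) ht.2).trans h.2

theorem near_zero (h : |Θ - D.Θs| ≤ D.radius) : D.Near Θ 0 :=
  ⟨h, by rw [map_zero, norm_zero]; exact D.radius_pos.le⟩

theorem abs_segment_le {x y r c t : ℝ} (hx : |x - c| ≤ r) (hy : |x + y - c| ≤ r)
    (ht : t ∈ Set.Icc (0 : ℝ) 1) : |x + t * y - c| ≤ r := by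
  have h1 := abs_le.1 hx
  have h2 := abs_le.1 hy
  rw [abs_le]
  constructor <;> nlinarith [ht.1, ht.2]

theorem fderiv_eq (hk : 2 ≤ k) (hR : D.Near Θ R) (h : X3 m (k + 1)) :
    fderiv ℝ (D.G k Θ) (to3 (k + 1) R) h = D.a k Θ R h + ofYT (D.A k Θ R h) :=
  fn3_injective (by
    rw [D.decomp k hk Θ hR.mem_I R hR.mem_smoothCube, fn3_add, fn3_ofYT])

/-- The bound of a by G makes a(Θ, 0) vanish, so on the trivial branch the linearization is exactly
A. -/
theorem fderiv_zero (hk : 2 ≤ k) (hΘ : |Θ - D.Θs| ≤ D.radius) (h : X3 m (k + 1)) :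
    fderiv ℝ (D.G k Θ) 0 h = ofYT (D.A k Θ 0 h) := by
  have h0 := near_zero hΘ
  obtain ⟨η, hη, -, C, hC⟩ := D.decomp_bound k hk
  have h1 := (hC Θ h0.mem_I 0 h0.mem_smoothCube (by rw [map_zero, norm_zero]; exact hη.le) h).1
  have h2 := fderiv_eq hk h0 h
  rw [map_zero] at h1 h2
  rw [D.G_zero k hk Θ h0.mem_I, norm_zero, mul_zero, zero_mul] at h1
  rw [h2, norm_le_zero_iff.1 h1, zero_add]

theorem exists_bound (D : Bifurcation m) (hk : 2 ≤ k) : ∃ C : ℝ, 1 ≤ C ∧ ∀ Θ R, D.Near Θ R →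
      ‖D.G k Θ (to3 (k + 1) R)‖ ≤ C * (1 + ‖to3 (k + 1) R‖) ∧
      ‖deriv (fun τ => D.G k τ (to3 (k + 1) R)) Θ‖ ≤ C * (1 + ‖to3 (k + 1) R‖) ∧
      ∀ h : X3 m (k + 1),
        ‖iteratedFDeriv ℝ 2 (D.G k Θ) (to3 (k + 1) R) (fun _ => h)‖
          ≤ C * (1 + ‖to3 (k + 3) R‖) * ‖h‖ ^ 2 ∧
        ‖deriv (fun τ => fderiv ℝ (D.G k τ) (to3 (k + 1) R) h) Θ‖
          ≤ C * (1 + ‖to3 (k + 3) R‖) * ‖h‖ ∧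
        ‖iteratedDeriv 2 (fun τ => fderiv ℝ (D.G k τ) (to3 (k + 1) R) h) Θ‖
          ≤ C * (1 + ‖to3 (k + 3) R‖) * ‖h‖ := by
  obtain ⟨C, hC⟩ := D.bound k hk
  refine ⟨max 1 C, le_max_left _ _, fun Θ R hR => ?_⟩
  obtain ⟨h1, h2, h3⟩ := hC Θ hR.mem_I R hR.mem_smoothCube
  have hm : ∀ x : ℝ, 0 ≤ x → C * (1 + x) ≤ max 1 C * (1 + x) := fun x hx =>
    mul_le_mul_one_add (le_max_right _ _) hx
  refine ⟨h1.trans (hm _ (norm_nonneg _)), h2.trans (hm _ (norm_nonneg _)), fun h => ?_⟩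
  obtain ⟨h4, h5, h6⟩ := h3 h
  exact ⟨h4.trans (mul_le_mul_of_nonneg_right (hm _ (norm_nonneg _)) (by positivity)),
    h5.trans (mul_le_mul_of_nonneg_right (hm _ (norm_nonneg _)) (by positivity)),
    h6.trans (mul_le_mul_of_nonneg_right (hm _ (norm_nonneg _)) (by positivity))⟩

theorem line_mem_domain (hk : 2 ≤ k) (hR : D.Near Θ R) :
    ∀ t ∈ Set.Icc (0 : ℝ) 1, (Θ, (0 : X3 m (k + 1)) + t • to3 (k + 1) R)
      ∈ D.I ×ˢ cube D.V m (k + 1) := fun t ht => by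
  rw [zero_add, ← map_smul]
  exact (hR.smul ht).mem_domain hk

theorem norm_to3_smul_le {t : ℝ} (ht : t ∈ Set.Icc (0 : ℝ) 1) (l : ℕ) (R : XInf m) :
    ‖to3 l (t • R)‖ ≤ ‖to3 l R‖ := by
  rw [map_smul, norm_smul, Real.norm_of_nonneg ht.1]
  exact mul_le_of_le_one_left (norm_nonneg _) ht.2

theorem deriv_G_zero (hk : 2 ≤ k) (hΘ : |Θ - D.Θs| ≤ D.radius) :
    deriv (fun τ => D.G k τ 0) Θ = 0 := by
  have : (fun τ => D.G k τ 0) =ᶠ[nhds Θ] fun _ => 0 := by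
    filter_upwards [D.isOpen_I.mem_nhds (mem_I_of_abs_le hΘ)] with τ hτ
    exact D.G_zero k hk τ hτ
  rw [this.deriv_eq, deriv_const]

/-- Bounds of `G` and `∂_Θ G` that vanish with `R`. -/
theorem exists_bound_vanishing (D : Bifurcation m) (hk : 2 ≤ k) : ∃ C : ℝ, 1 ≤ C ∧
    ∀ Θ R, D.Near Θ R →
      ‖D.G k Θ (to3 (k + 1) R)‖ ≤ C * ‖to3 (k + 1) R‖ * (1 + ‖to3 (k + 3) R‖) ^ 2 ∧
      ‖deriv (fun τ => D.G k τ (to3 (k + 1) R)) Θ‖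
        ≤ C * ‖to3 (k + 1) R‖ * (1 + ‖to3 (k + 3) R‖) := by
  obtain ⟨C, hC1, hC⟩ := D.exists_bound hk
  obtain ⟨η, hη, -, C', hC'⟩ := D.decomp_bound k hk
  refine ⟨C + |C'|, by linarith [abs_nonneg C'], fun Θ R hR => ?_⟩
  have hx := norm_nonneg (to3 (k + 1) R)
  have hxy := norm_to3_mono (show k + 1 ≤ k + 3 by omega) R
  have h0 := near_zero hR.1
  constructor
  -- Taylor's formula at R = 0, where G vanishes and its derivative is the bounded operator A(Θ, 0).
  · have h1 := norm_taylor_snd_le (D.isOpen_domain hk) (D.contDiffOn_G k hk)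
      (line_mem_domain hk hR) (C := C * (1 + ‖to3 (k + 3) R‖) * ‖to3 (k + 1) R‖ ^ 2) (by
        intro t ht
        rw [zero_add, ← map_smul]
        refine ((hC Θ (t • R) (hR.smul ht)).2.2 _).1.trans ?_
        gcongr
        exact norm_to3_smul_le ht _ _)
    rw [zero_add, D.G_zero k hk Θ hR.mem_I, sub_zero, fderiv_zero hk hR.1] at h1
    have h2 := (hC' Θ h0.mem_I 0 h0.mem_smoothCube (by rw [map_zero, norm_zero]; exact hη.le)
      (to3 (k + 1) R)).2
    rw [map_zero, norm_zero, add_zero, mul_one] at h2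
    have h3 := norm_ofYT_le (D.A k Θ 0 (to3 (k + 1) R))
    have h4 := norm_le_norm_add_norm_sub' (D.G k Θ (to3 (k + 1) R))
      (ofYT (D.A k Θ 0 (to3 (k + 1) R)))
    have h5 : C' * ‖to3 (k + 1) R‖ ≤ |C'| * ‖to3 (k + 1) R‖ :=
      mul_le_mul_of_nonneg_right (le_abs_self _) hx
    have h6 : C * (1 + ‖to3 (k + 3) R‖) * ‖to3 (k + 1) R‖ ^ 2
        ≤ C * ‖to3 (k + 1) R‖ * ((1 + ‖to3 (k + 3) R‖) * ‖to3 (k + 3) R‖) := by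
      calc _ = C * ‖to3 (k + 1) R‖ * ((1 + ‖to3 (k + 3) R‖) * ‖to3 (k + 1) R‖) := by ring
        _ ≤ _ := by gcongr
    have h7 : |C'| * ‖to3 (k + 1) R‖ ≤ |C'| * ‖to3 (k + 1) R‖ * (1 + ‖to3 (k + 3) R‖) ^ 2 :=
      le_mul_of_one_le_right (by positivity) (one_le_pow₀ (by linarith [norm_nonneg (to3 (k + 3) R)]))
    have h8 : C * ‖to3 (k + 1) R‖ * ((1 + ‖to3 (k + 3) R‖) * ‖to3 (k + 3) R‖)
        ≤ C * ‖to3 (k + 1) R‖ * (1 + ‖to3 (k + 3) R‖) ^ 2 := by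
      rw [sq]; gcongr; linarith
    linarith
  · have h1 := norm_deriv_fst_sub_le (D.isOpen_domain hk) (D.contDiffOn_G k hk)
      (line_mem_domain hk hR) (C := C * (1 + ‖to3 (k + 3) R‖) * ‖to3 (k + 1) R‖) (by
        intro t ht
        rw [zero_add, ← map_smul]
        refine ((hC Θ (t • R) (hR.smul ht)).2.2 _).2.1.trans ?_
        gcongr
        exact norm_to3_smul_le ht _ _)
    rw [zero_add, deriv_G_zero hk hR.1, sub_zero] at h1
    refine h1.trans ?_
    calc _ = C * ‖to3 (k + 1) R‖ * (1 + ‖to3 (k + 3) R‖) := by ring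
      _ ≤ _ := by gcongr; linarith [abs_nonneg C']

/-- Division by s forbids a bound C (1 + x), which does not vanish with R, and at high regularity
the factor (1 + y)² is too large. For sE ≤ 1 the second bound is linear since y ≤ 1; for sE ≥ 1 the
first one is, since 1 + x ≤ 2sE. So w is bounded linearly by sE in all cases. -/
theorem le_of_min_bounds {w C C' x y s E : ℝ} (hC : 0 ≤ C) (hC' : 0 ≤ C') (hx : 0 ≤ x)
    (h1 : w ≤ C * (1 + x)) (h2 : w ≤ C' * x * (1 + y) ^ 2) (hxy : x ≤ y) (hy : y ≤ s * E) :
    w ≤ (2 * C + 4 * C') * (s * E) := by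
  have hE : 0 ≤ s * E := hx.trans (hxy.trans hy)
  rcases le_total (s * E) 1 with h | h
  · have h3 : (1 + y) ^ 2 ≤ 4 := by nlinarith
    have h4 : C' * x * (1 + y) ^ 2 ≤ C' * (s * E) * 4 := by
      gcongr
      exact hxy.trans hy
    nlinarith [mul_nonneg hC hE]
  · have : C * (1 + x) ≤ C * (2 * (s * E)) := mul_le_mul_of_nonneg_left (by linarith) hC
    nlinarith [mul_nonneg hC' hE]

/-- The rescaled map `s⁻¹ G(Θ, R)` and its `Θ`-derivative are bounded in terms of `s⁻¹ R`. -/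
theorem exists_bound_rescaled (D : Bifurcation m) (hk : 2 ≤ k) : ∃ C : ℝ, 1 ≤ C ∧
    ∀ Θ R s E, D.Near Θ R → 0 < s → ‖to3 (k + 3) R‖ ≤ s * E →
      ‖s⁻¹ • D.G k Θ (to3 (k + 1) R)‖ ≤ C * E ∧
      ‖s⁻¹ • deriv (fun τ => D.G k τ (to3 (k + 1) R)) Θ‖ ≤ C * E := by
  obtain ⟨C, hC1, hC⟩ := D.exists_bound hk
  obtain ⟨C', hC1', hC'⟩ := D.exists_bound_vanishing hk
  refine ⟨2 * C + 4 * C', by linarith, fun Θ R s E hR hs hE => ?_⟩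
  obtain ⟨h1, h2, -⟩ := hC Θ R hR
  obtain ⟨h3, h4⟩ := hC' Θ R hR
  have hx := norm_nonneg (to3 (k + 1) R)
  have hxy := norm_to3_mono (show k + 1 ≤ k + 3 by omega) R
  have hCn : 0 ≤ C := by linarith
  have hCn' : 0 ≤ C' := by linarith
  have h4' : ‖deriv (fun τ => D.G k τ (to3 (k + 1) R)) Θ‖
        ≤ C' * ‖to3 (k + 1) R‖ * (1 + ‖to3 (k + 3) R‖) ^ 2 :=
    h4.trans (mul_le_mul_of_nonneg_left (le_self_pow₀ (by linarith) (by norm_num))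
      (by positivity))
  rw [norm_smul, norm_smul, norm_inv, Real.norm_of_nonneg hs.le, inv_mul_le_iff₀ hs,
    inv_mul_le_iff₀ hs, mul_left_comm]
  exact ⟨le_of_min_bounds hCn hCn' hx h1 h3 hxy hE, le_of_min_bounds hCn hCn' hx h2 h4' hxy hE⟩

end Bifurcation

end NashMoser

/-! ### Compatibility of derivatives between Sobolev classes, and the crossing vector. -/

namespace NashMoser

theorem ofYT_toYT {m k : ℕ} (z : Y3 m (k + 1)) : ofYT (toYT z) = incl3 (Nat.le_succ k) z :=
  fn3_injective (by rw [fn3_ofYT, fnT_toYT, fn3_incl3])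

namespace Bifurcation

variable {m : ℕ} {D : Bifurcation m} {k : ℕ} {Θ : ℝ} {R : XInf m}

theorem incl3_G {l : ℕ} (hl : 2 ≤ l) (hlk : l ≤ k) (hΘ : Θ ∈ D.I) {R : X3 m (k + 1)}
    {R' : X3 m (l + 1)} (hR : R ∈ cube D.V m (k + 1)) (hR' : R' ∈ cube D.V m (l + 1))
    (h : fn3 R = fn3 R') : incl3 hlk (D.G k Θ R) = D.G l Θ R' :=
  fn3_injective (by
    rw [fn3_incl3]; exact D.G_compat k l (hl.trans hlk) hl Θ hΘ R hR R' hR' h)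

theorem incl3_deriv_G {l : ℕ} (hl : 2 ≤ l) (hlk : l ≤ k) (hR : D.Near Θ R) :
    incl3 hlk (deriv (fun τ => D.G k τ (to3 (k + 1) R)) Θ)
      = deriv (fun τ => D.G l τ (to3 (l + 1) R)) Θ := by
  have hk := hl.trans hlk
  have h1 := (hasDerivAt_fst (D.isOpen_domain hk) (D.contDiffOn_G k hk)
    (hR.mem_domain hk)).differentiableAt.hasDerivAt
  have h2 := (incl3 hlk).hasFDerivAt.comp_hasDerivAt Θ h1
  have e : (⇑(incl3 hlk) ∘ fun τ => D.G k τ (to3 (k + 1) R))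
      =ᶠ[nhds Θ] fun τ => D.G l τ (to3 (l + 1) R) := by
    filter_upwards [D.isOpen_I.mem_nhds hR.mem_I] with τ hτ
    exact incl3_G hl hlk hτ (hR.mem_cube hk) (hR.mem_cube hl) (by rw [fn3_to3, fn3_to3])
  rw [← e.deriv_eq, h2.deriv]

/-- The two derivatives are limits of difference quotients of the same functions along the line
spanned by h. -/
theorem incl3_fderiv_zero {l : ℕ} (hl : 2 ≤ l) (hlk : l ≤ k) (hΘ : |Θ - D.Θs| ≤ D.radius)
    (h : XInf m) : incl3 hlk (fderiv ℝ (D.G k Θ) 0 (to3 (k + 1) h))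
      = fderiv ℝ (D.G l Θ) 0 (to3 (l + 1) h) := by
  have key : ∀ j, 2 ≤ j → (Θ, (0 : X3 m (j + 1)) + (0 : ℝ) • to3 (j + 1) h)
      ∈ D.I ×ˢ cube D.V m (j + 1) := fun j hj => by
    rw [zero_smul, add_zero]
    have := (near_zero hΘ).mem_domain hj
    rwa [map_zero] at this
  have hk := hl.trans hlk
  have h1 := hasDerivAt_line (D.isOpen_domain hk) (D.contDiffOn_G k hk) (key k hk)
  have h1' := (incl3 hlk).hasFDerivAt.comp_hasDerivAt 0 h1
  have h2 := hasDerivAt_line (D.isOpen_domain hl) (D.contDiffOn_G l hl) (key l hl)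
  have e : (⇑(incl3 hlk) ∘ fun t : ℝ => D.G k Θ (0 + t • to3 (k + 1) h))
      =ᶠ[nhds 0] fun t => D.G l Θ (0 + t • to3 (l + 1) h) := by
    filter_upwards [eventually_line (D.isOpen_domain hk) (key k hk),
      eventually_line (D.isOpen_domain hl) (key l hl)] with t ht ht'
    exact incl3_G hl hlk ht.1 ht.2 ht'.2 (by
      rw [zero_add, zero_add, ← map_smul, ← map_smul, fn3_to3, fn3_to3])
  have h3 := h1'.unique (h2.congr_of_eventuallyEq e)
  simpa using h3

variable (D) in
/-- The derivative `∂_Θ A(Θ*, 0)[v]`. -/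
def crossing (k : ℕ) : YT m k := deriv (fun τ => D.A k τ 0 (to3 (k + 1) D.v)) D.Θs

theorem abs_self_le_radius : |D.Θs - D.Θs| ≤ D.radius := by
  rw [sub_self, abs_zero]; exact D.radius_pos.le

theorem eventually_abs_le_radius : ∀ᶠ τ in nhds D.Θs, |τ - D.Θs| ≤ D.radius := by
  filter_upwards [Metric.ball_mem_nhds D.Θs D.radius_pos] with τ hτ
  rw [Metric.mem_ball, Real.dist_eq] at hτ
  exact hτ.le

/-- The estimates of s⁻¹ ∂_ΘG come from G in (Y^{k+1})³, whereas transversality speaks of A in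
Y^{k+1} × (Y^k)². Both vectors have the same image in (Y^k)³, by `fderiv_zero` near Θ*. -/
theorem toYT_deriv_fderiv (hk : 2 ≤ k) :
    toYT (deriv (fun τ => fderiv ℝ (D.G (k + 1) τ) 0 (to3 (k + 2) D.v)) D.Θs) = D.crossing k := by
  have hk1 : 2 ≤ k + 1 := by omega
  have h0 : (D.Θs, (0 : X3 m (k + 1 + 1))) ∈ D.I ×ˢ cube D.V m (k + 1 + 1) := by
    have := (near_zero D.abs_self_le_radius).mem_domain hk1
    rwa [map_zero] at this
  have h1 := (hasDerivAt_fderiv_snd (D.isOpen_domain hk1) (D.contDiffOn_G (k + 1) hk1) h0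
    (to3 (k + 2) D.v)).differentiableAt.hasDerivAt
  have h2 := (incl3 (Nat.le_succ k)).hasFDerivAt.comp_hasDerivAt D.Θs h1
  -- Otherwise `deriv` takes its default value 0, which lies in the range, against transversality.
  have hA : DifferentiableAt ℝ (fun τ => D.A k τ 0 (to3 (k + 1) D.v)) D.Θs := by
    by_contra hne
    refine D.transversal k hk ?_
    rw [deriv_zero_of_not_differentiableAt hne]
    exact ⟨0, map_zero _⟩
  have h3 := ofYT.hasFDerivAt.comp_hasDerivAt D.Θs hA.hasDerivAt
  have e : (⇑(incl3 (Nat.le_succ k)) ∘ fun τ => fderiv ℝ (D.G (k + 1) τ) 0 (to3 (k + 2) D.v))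
      =ᶠ[nhds D.Θs] (⇑ofYT ∘ fun τ => D.A k τ 0 (to3 (k + 1) D.v)) := by
    filter_upwards [D.eventually_abs_le_radius] with τ hτ
    exact (incl3_fderiv_zero hk (Nat.le_succ k) hτ D.v).trans (fderiv_zero hk hτ _)
  refine ofYT_injective ?_
  rw [ofYT_toYT]
  exact h2.unique (h3.congr_of_eventuallyEq e)

/-! ### The Newton step -/

variable (D) in
/-- The rescaled map `s⁻¹ G(Θ, s (v + ρ))`. -/
def resid (k : ℕ) (s Θ : ℝ) (ρ : XInf m) : Y3 m k :=
  s⁻¹ • D.G k Θ (to3 (k + 1) (s • (D.v + ρ)))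

variable (D) in
/-- The `Θ`-derivative of the rescaled map. -/
def residΘ (k : ℕ) (s Θ : ℝ) (ρ : XInf m) : Y3 m k :=
  s⁻¹ • deriv (fun τ => D.G k τ (to3 (k + 1) (s • (D.v + ρ)))) Θ

theorem norm_add_le_of_le {l : ℕ} (hl : l ≤ k + 3) {ρ : XInf m} {δ : ℝ}
    (hρ : ‖to3 (k + 3) ρ‖ ≤ δ) : ‖to3 l (D.v + ρ)‖ ≤ ‖to3 (k + 3) D.v‖ + δ :=
  (norm_to3_mono hl _).trans (by rw [map_add]; exact (norm_add_le _ _).trans (by linarith))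

/-- To first order ∂_ΘG(Θ, R) is ∂_ΘDG(Θ*, 0)[R], uniformly for Θ near Θ*. With R = s(v + ρ) the
factor s cancels, and the contribution of ρ is small. The level is k + 1 so that the limit is taken
in a norm that controls Y^{k+1} × (Y^k)². -/
theorem exists_residΘ_close (D : Bifurcation m) (hk : 2 ≤ k) {ε : ℝ} (hε : 0 < ε) :
    ∃ δ : ℝ, 0 < δ ∧ δ ≤ 1 ∧ ∀ s Θ ρ, 0 < s → s ≤ δ → |Θ - D.Θs| ≤ δ →
      ‖to3 (k + 3) ρ‖ ≤ δ →
      ‖D.residΘ (k + 1) s Θ ρ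
        - deriv (fun τ => fderiv ℝ (D.G (k + 1) τ) 0 (to3 (k + 2) D.v)) D.Θs‖ ≤ ε := by
  have hk1 : 2 ≤ k + 1 := by omega
  set Vn := ‖to3 (k + 3) D.v‖ + 1
  have hVn : 1 ≤ Vn := by simp [Vn]
  have h0 : (D.Θs, (0 : X3 m (k + 1 + 1))) ∈ D.I ×ˢ cube D.V m (k + 1 + 1) := by
    have := (near_zero D.abs_self_le_radius).mem_domain hk1
    rwa [map_zero] at this
  have hG0 : ∀ᶠ τ in nhds D.Θs, D.G (k + 1) τ 0 = 0 := by
    filter_upwards [D.isOpen_I.mem_nhds D.Θs_mem] with τ hτ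
    exact D.G_zero _ hk1 τ hτ
  obtain ⟨δ₁, hδ₁, hexp⟩ := eventually_deriv_fst_expansion (D.isOpen_domain hk1)
    (D.contDiffOn_G (k + 1) hk1) h0 hG0 (show 0 < ε / (2 * Vn) by positivity)
  obtain ⟨C, hC1, hC⟩ := D.exists_bound hk1
  set B : X3 m (k + 1 + 1) → Y3 m (k + 1) :=
    fun h => deriv (fun τ => fderiv ℝ (D.G (k + 1) τ) 0 h) D.Θs
  have hBadd : ∀ h h', B (h + h') = B h + B h' := by
    intro h h'
    simp only [B, fun h => (hasDerivAt_fderiv_snd (D.isOpen_domain hk1)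
      (D.contDiffOn_G (k + 1) hk1) h0 h).deriv]
    rw [← map_add, Prod.mk_add_mk, add_zero]
  have hBsmul : ∀ (c : ℝ) h, B (c • h) = c • B h := by
    intro c h
    simp only [B, fun h => (hasDerivAt_fderiv_snd (D.isOpen_domain hk1)
      (D.contDiffOn_G (k + 1) hk1) h0 h).deriv]
    rw [← map_smul, Prod.smul_mk, smul_zero]
  have hBle : ∀ h, ‖B h‖ ≤ C * ‖h‖ := by
    intro h
    have := ((hC D.Θs 0 (near_zero D.abs_self_le_radius)).2.2 h).2.1
    simpa only [map_zero, norm_zero, add_zero, mul_one] using this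
  refine ⟨min 1 (min (δ₁ / (2 * Vn)) (ε / (2 * C))), by positivity, min_le_left _ _, ?_⟩
  intro s Θ ρ hs hsδ hΘ hρ
  set δ := min 1 (min (δ₁ / (2 * Vn)) (ε / (2 * C))) with hδ
  have hVn0 : 0 < Vn := by linarith
  have d1 : δ ≤ 1 := min_le_left _ _
  have d2 : δ * (2 * Vn) ≤ δ₁ := by
    rw [← le_div_iff₀ (by positivity)]; simp [hδ]
  have d5 : δ * (2 * C) ≤ ε := by
    rw [← le_div_iff₀ (by positivity)]; simp [hδ]
  have hδ0 : 0 < δ := lt_of_lt_of_le hs hsδ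
  have hδVn : δ ≤ δ * Vn := le_mul_of_one_le_right hδ0.le hVn
  have hq : ∀ l, l ≤ k + 3 → ‖to3 l (D.v + ρ)‖ ≤ Vn := fun l hl =>
    norm_add_le_of_le hl (hρ.trans d1)
  have hR : ∀ l, l ≤ k + 3 → ‖to3 l (s • (D.v + ρ))‖ ≤ δ * Vn := fun l hl => by
    rw [map_smul, norm_smul, Real.norm_of_nonneg hs.le]
    exact mul_le_mul hsδ (hq l hl) (norm_nonneg _) hδ0.le
  have h1 := hexp Θ (to3 (k + 1 + 1) (s • (D.v + ρ)))
    (hΘ.trans_lt (by nlinarith)) ((hR _ (by omega)).trans_lt (by nlinarith))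
  have e : D.residΘ (k + 1) s Θ ρ - B (to3 (k + 2) D.v)
      = s⁻¹ • (deriv (fun τ => D.G (k + 1) τ (0 + to3 (k + 1 + 1) (s • (D.v + ρ)))) Θ
          - B (to3 (k + 1 + 1) (s • (D.v + ρ)))) + B (to3 (k + 2) ρ) := by
    have hBs : B (to3 (k + 1 + 1) (s • (D.v + ρ))) = s • (B (to3 (k + 2) D.v) + B (to3 (k + 2) ρ)) := by
      rw [← hBadd, ← map_add, map_smul, hBsmul]
    rw [hBs, smul_sub, smul_smul, inv_mul_cancel₀ hs.ne', one_smul, zero_add, residΘ]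
    abel
  rw [e]
  refine (norm_add_le _ _).trans ((add_le_add ?_ ?_).trans_eq (add_halves ε))
  · rw [norm_smul, norm_inv, Real.norm_of_nonneg hs.le, inv_mul_le_iff₀ hs]
    refine h1.trans ?_
    rw [map_smul, norm_smul, Real.norm_of_nonneg hs.le]
    calc ε / (2 * Vn) * (s * ‖to3 (k + 1 + 1) (D.v + ρ)‖) ≤ ε / (2 * Vn) * (s * Vn) := by
          gcongr; exact hq _ (by omega)
      _ = s * (ε / 2) := by field_simp
  · refine (hBle _).trans ?_
    have h2 : ‖to3 (k + 2) ρ‖ ≤ δ := (norm_to3_mono (by omega) ρ).trans hρ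
    have h3 : C * ‖to3 (k + 2) ρ‖ ≤ C * δ := mul_le_mul_of_nonneg_left h2 (by linarith)
    linarith

theorem norm_A_sub_le (hk : 2 ≤ k) : ∃ C : ℝ, 1 ≤ C ∧ ∀ Θ R Θ' R', D.Near Θ R → D.Near Θ' R' →
    ‖to3 (k + 3) R‖ ≤ 1 → ‖to3 (k + 3) R'‖ ≤ 1 → ‖D.A k Θ R - D.A k Θ' R'‖
      ≤ C * (|Θ - Θ'| + ‖to3 (k + 3) R - to3 (k + 3) R'‖) := by
  obtain ⟨C, hC⟩ := D.lipschitz k hk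
  refine ⟨|C| + 1, by simp, fun Θ R Θ' R' h h' h1 h1' => ?_⟩
  refine ContinuousLinearMap.opNorm_le_bound _ (by positivity) fun x => ?_
  refine (hC Θ h.mem_I Θ' h'.mem_I _ h.mem_smoothCube R' h'.mem_smoothCube h1 h1' x).trans ?_
  gcongr
  linarith [le_abs_self C]

variable [NeZero m]

variable (D) in
/-- The bordered approximate linearization of the rescaled map. -/
def newtonOp (k : ℕ) (N s Θ : ℝ) (ρ : XInf m) : ℝ × X3 m (k + 1) →L[ℝ] YT m k × ℝ :=
  bordered D.v (YInf.to k (trunc3 N (D.residΘ k s Θ ρ))) (D.A k Θ (s • (D.v + ρ)))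

variable (D) in
/-- The Newton increment, before truncation. -/
def newtonIncr (k : ℕ) (N s Θ : ℝ) (ρ : XInf m) : ℝ × X3 m (k + 1) :=
  (D.newtonOp k N s Θ ρ).inverse (-YInf.to k (trunc3 N (D.resid k s Θ ρ)), 0)

/-- Two perturbations are added: the truncated column tends to the crossing vector, and A(Θ, R)
tends to A(Θ*, 0) by its Lipschitz bound, which is where ρ must be small in X^{k+3}. -/
theorem exists_newtonOp_close (D : Bifurcation m) (hk : 2 ≤ k) {ε : ℝ} (hε : 0 < ε) :
    ∃ δ : ℝ, 0 < δ ∧ δ ≤ 1 ∧ ∃ N₀ : ℝ, 0 ≤ N₀ ∧ ∀ N s Θ ρ, 0 < s → s ≤ δ → |Θ - D.Θs| ≤ δ →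
      ‖to3 (k + 3) ρ‖ ≤ δ → N₀ ≤ N →
      ‖D.newtonOp k N s Θ ρ - bordered D.v (D.crossing k) (D.A k D.Θs 0)‖ < ε := by
  set Vn := ‖to3 (k + 3) D.v‖ + 1
  have hVn : 1 ≤ Vn := by simp [Vn]
  have hVn0 : 0 < Vn := by linarith
  set b := deriv (fun τ => fderiv ℝ (D.G (k + 1) τ) 0 (to3 (k + 2) D.v)) D.Θs
  obtain ⟨δ₁, hδ₁, hδ₁', hp⟩ := D.exists_residΘ_close hk (show 0 < ε / 4 by positivity)
  obtain ⟨N₀, hN₀, htr⟩ := exists_norm_sub_trunc3_lt b (show 0 < ε / 4 by positivity)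
  obtain ⟨C, hC, hlip⟩ := D.norm_A_sub_le hk
  have hr := D.radius_pos
  refine ⟨min δ₁ (min (D.radius / Vn) (min (1 / Vn) (ε / (4 * (C * (1 + Vn)))))), by positivity,
    (min_le_left _ _).trans hδ₁', N₀, hN₀, ?_⟩
  intro N s Θ ρ hs hsδ hΘ hρ hN
  set δ := min δ₁ (min (D.radius / Vn) (min (1 / Vn) (ε / (4 * (C * (1 + Vn)))))) with hδ
  have d1 : δ ≤ δ₁ := min_le_left _ _
  have d3 : δ * Vn ≤ D.radius := by
    rw [← le_div_iff₀ (by positivity)]; simp [hδ]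
  have d4 : δ * Vn ≤ 1 := by
    rw [← le_div_iff₀ (by positivity)]; simp [hδ]
  have d6 : δ * (4 * (C * (1 + Vn))) ≤ ε := by
    rw [← le_div_iff₀ (by positivity)]; simp [hδ]
  have hδ0 : 0 < δ := lt_of_lt_of_le hs hsδ
  have hδVn : δ ≤ δ * Vn := le_mul_of_one_le_right hδ0.le hVn
  have hR : ∀ l, l ≤ k + 3 → ‖to3 l (s • (D.v + ρ))‖ ≤ δ * Vn := fun l hl => by
    rw [map_smul, norm_smul, Real.norm_of_nonneg hs.le]
    exact mul_le_mul hsδ (norm_add_le_of_le hl (hρ.trans (d1.trans hδ₁'))) (norm_nonneg _) hδ0.le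
  have hnear : D.Near Θ (s • (D.v + ρ)) :=
    ⟨hΘ.trans (hδVn.trans d3), (hR 3 (by omega)).trans d3⟩
  have hN0 : 0 ≤ N := hN₀.trans hN
  -- The column is defined through the class k, but as a truncation it can be computed from the
  -- class k + 1, where the limit is known.
  have hcong : trunc3 N (D.residΘ k s Θ ρ) = trunc3 N (D.residΘ (k + 1) s Θ ρ) := by
    refine trunc3_congr N ?_
    rw [residΘ, residΘ, ← incl3_deriv_G hk (Nat.le_succ k) hnear, ← map_smul, fn3_incl3]
  have hp2 : ‖YInf.to k (trunc3 N (D.residΘ k s Θ ρ)) - D.crossing k‖ ≤ ε / 4 + ε / 4 := by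
    rw [hcong, ← toYT_to3, ← toYT_deriv_fderiv hk, ← map_sub]
    refine (norm_toYT_le _).trans ?_
    -- S_N is a contraction on the difference from b, and S_N b → b for the single vector b; hence
    -- N₀ does not depend on s, Θ, ρ.
    have e : to3 (k + 1) (trunc3 N (D.residΘ (k + 1) s Θ ρ)) - b
        = to3 (k + 1) (trunc3 N (D.residΘ (k + 1) s Θ ρ - b))
          - (b - to3 (k + 1) (trunc3 N b)) := by
      rw [map_sub, map_sub]; abel
    change ‖to3 (k + 1) (trunc3 N (D.residΘ (k + 1) s Θ ρ)) - b‖ ≤ _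
    rw [e]
    exact (norm_sub_le _ _).trans (add_le_add ((norm_to3_trunc3_le_self hN0 _).trans
      (hp s Θ ρ hs (hsδ.trans d1) (hΘ.trans d1) (hρ.trans d1))) (htr N hN).le)
  have hA : ‖D.A k Θ (s • (D.v + ρ)) - D.A k D.Θs 0‖ ≤ ε / 4 := by
    refine (hlip Θ _ D.Θs 0 hnear (near_zero D.abs_self_le_radius) ((hR _ le_rfl).trans d4)
      (by rw [map_zero, norm_zero]; exact zero_le_one)).trans ?_
    rw [map_zero, sub_zero]
    calc C * (|Θ - D.Θs| + ‖to3 (k + 3) (s • (D.v + ρ))‖) ≤ C * (δ + δ * Vn) := by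
          gcongr; exact hR _ le_rfl
      _ ≤ ε / 4 := by linarith
  refine (norm_bordered_sub_le _ _ _ _ _).trans_lt ?_
  linarith

/-- Uniform invertibility of the bordered operator. -/
theorem exists_newtonOp_inverse (D : Bifurcation m) (hk : 2 ≤ k) :
    ∃ δ : ℝ, 0 < δ ∧ δ ≤ 1 ∧ ∃ N₀ : ℝ, 0 ≤ N₀ ∧ ∃ C : ℝ, 1 ≤ C ∧
      ∀ N s Θ ρ, 0 < s → s ≤ δ → |Θ - D.Θs| ≤ δ → ‖to3 (k + 3) ρ‖ ≤ δ → N₀ ≤ N →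
      (D.newtonOp k N s Θ ρ).IsInvertible ∧ ‖(D.newtonOp k N s Θ ρ).inverse‖ ≤ C := by
  obtain ⟨ε, hε, C, hC, h⟩ := exists_inverse_bound
    (bordered_bijective D.v_ne (D.transversal k hk) (D.ker k hk) (D.coker k hk))
  obtain ⟨δ, hδ, hδ1, N₀, hN₀, h'⟩ := D.exists_newtonOp_close hk hε
  exact ⟨δ, hδ, hδ1, N₀, hN₀, C, hC, fun N s Θ ρ h1 h2 h3 h4 h5 => h _ (h' N s Θ ρ h1 h2 h3 h4 h5)⟩

end Bifurcation

end NashMoser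

/-! ### The residual after one Newton step: a quadratic part and truncation errors. -/

namespace NashMoser

theorem dot_smul_right (f g : Fin 3 → L2) (t : ℝ) : dot f (t • g) = t * dot f g := by
  simp only [dot, Finset.mul_sum]
  exact Finset.sum_congr rfl fun i _ => inner_smul_right _ _ _

namespace Bifurcation

variable {m : ℕ} {D : Bifurcation m} {k : ℕ} {Θ : ℝ} {R : XInf m}

/-- Second order Taylor expansion of `G`. -/
theorem exists_taylor (D : Bifurcation m) (hk : 2 ≤ k) : ∃ C : ℝ, 1 ≤ C ∧
    ∀ Θ θ (R g : XInf m), |Θ - D.Θs| ≤ D.radius → |Θ + θ - D.Θs| ≤ D.radius →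
      ‖to3 (k + 3) R‖ + ‖to3 (k + 3) g‖ ≤ min 1 D.radius →
      ‖D.G k (Θ + θ) (to3 (k + 1) (R + g)) - D.G k Θ (to3 (k + 1) R)
        - θ • deriv (fun τ => D.G k τ (to3 (k + 1) R)) Θ
        - fderiv ℝ (D.G k Θ) (to3 (k + 1) R) (to3 (k + 1) g)‖
      ≤ C * (‖to3 (k + 1) g‖ ^ 2 + |θ| * ‖to3 (k + 1) g‖ + θ ^ 2 * ‖to3 (k + 1) R‖) := by
  obtain ⟨C, hC1, hC⟩ := D.exists_bound hk
  have hC0 : 0 ≤ C := by linarith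
  refine ⟨2 * C, by linarith, fun Θ θ R g hΘ hΘ' hRg => ?_⟩
  have hU := D.isOpen_domain hk
  have hG := D.contDiffOn_G k hk
  have hline : ∀ t ∈ Set.Icc (0 : ℝ) 1, ∀ l, l ≤ k + 3 → ‖to3 l (R + t • g)‖ ≤ min 1 D.radius := by
    intro t ht l hl
    rw [map_add]
    refine (norm_add_le _ _).trans ((add_le_add (norm_to3_mono hl _)
      ((norm_to3_smul_le ht l g).trans (norm_to3_mono hl _))).trans hRg)
  have hlow : ∀ t ∈ Set.Icc (0 : ℝ) 1, ∀ l, l ≤ k + 3 → ‖to3 l (t • R)‖ ≤ min 1 D.radius := by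
    intro t ht l hl
    refine (norm_to3_smul_le ht l R).trans ((norm_to3_mono hl _).trans (le_trans ?_ hRg))
    linarith [norm_nonneg (to3 (k + 3) g)]
  have h3 : 3 ≤ k + 3 := by omega
  have hnear : ∀ τ, |τ - D.Θs| ≤ D.radius → ∀ t ∈ Set.Icc (0 : ℝ) 1, D.Near τ (R + t • g) :=
    fun τ hτ t ht => ⟨hτ, (hline t ht 3 h3).trans (min_le_right _ _)⟩
  have hnear0 : ∀ τ, |τ - D.Θs| ≤ D.radius → D.Near τ R := fun τ hτ => by
    simpa using hnear τ hτ 0 (Set.left_mem_Icc.2 zero_le_one)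
  have hseg : ∀ t ∈ Set.Icc (0 : ℝ) 1, |Θ + t * θ - D.Θs| ≤ D.radius := fun t ht =>
    abs_segment_le hΘ hΘ' ht
  have hR1 : ‖to3 (k + 3) R‖ ≤ 1 := by
    have := hlow 1 (Set.right_mem_Icc.2 zero_le_one) _ le_rfl
    rw [one_smul] at this
    exact this.trans (min_le_left _ _)
  have hC2 : ∀ x : ℝ, x ≤ 1 → C * (1 + x) ≤ 2 * C := fun x hx => by nlinarith
  -- the three parts of the remainder
  have q1 : ‖D.G k (Θ + θ) (to3 (k + 1) (R + g)) - D.G k (Θ + θ) (to3 (k + 1) R)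
      - fderiv ℝ (D.G k (Θ + θ)) (to3 (k + 1) R) (to3 (k + 1) g)‖
      ≤ 2 * C * ‖to3 (k + 1) g‖ ^ 2 := by
    rw [map_add]
    refine norm_taylor_snd_le hU hG (fun t ht => ?_) fun t ht => ?_
    · rw [← map_smul, ← map_add]
      exact (hnear _ hΘ' t ht).mem_domain hk
    · rw [← map_smul, ← map_add]
      refine ((hC _ _ (hnear _ hΘ' t ht)).2.2 _).1.trans ?_
      exact mul_le_mul_of_nonneg_right (hC2 _ ((hline t ht _ le_rfl).trans (min_le_left _ _))) (by positivity)
  have q2 : ‖fderiv ℝ (D.G k (Θ + θ)) (to3 (k + 1) R) (to3 (k + 1) g)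
      - fderiv ℝ (D.G k Θ) (to3 (k + 1) R) (to3 (k + 1) g)‖
      ≤ |θ| * (2 * C * ‖to3 (k + 1) g‖) := by
    refine norm_fderiv_snd_sub_le hU hG (fun t ht => (hnear0 _ (hseg t ht)).mem_domain hk)
      fun t ht => ?_
    refine ((hC _ _ (hnear0 _ (hseg t ht))).2.2 _).2.1.trans ?_
    exact mul_le_mul_of_nonneg_right (hC2 _ hR1) (by positivity)
  -- The second order term in θ is estimated through ∂_ΘΘDG: the increment of ∂_ΘG in Θ vanishes at
  -- R = 0 and is followed along the segment from 0 to R. The resulting factor ‖R‖ compensates the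
  -- later division by s.
  have q3 : ‖D.G k (Θ + θ) (to3 (k + 1) R) - D.G k Θ (to3 (k + 1) R)
      - θ • deriv (fun τ => D.G k τ (to3 (k + 1) R)) Θ‖
      ≤ |θ| * (|θ| * (2 * C * ‖to3 (k + 1) R‖)) := by
    refine norm_taylor_fst_le hU hG (fun t ht => (hnear0 _ (hseg t ht)).mem_domain hk)
      fun t ht => ?_
    have h1 := norm_deriv_fst_sub_sub_le (Θ := Θ) (Θ' := Θ + t * θ) (R := 0)
      (g := to3 (k + 1) R) (C := |θ| * (2 * C * ‖to3 (k + 1) R‖)) hU hG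
      (line_mem_domain hk (hnear0 _ hΘ)) (line_mem_domain hk (hnear0 _ (hseg t ht))) (by
        intro u hu
        rw [zero_add, ← map_smul]
        have hu' : ∀ τ, |τ - D.Θs| ≤ D.radius → D.Near τ (u • R) := fun τ hτ =>
          (hnear0 τ hτ).smul hu
        have h2 := norm_sub_le_of_deriv_segment
          (f := deriv fun τ => fderiv ℝ (D.G k τ) (to3 (k + 1) (u • R)) (to3 (k + 1) R))
          (f' := deriv (deriv fun τ => fderiv ℝ (D.G k τ) (to3 (k + 1) (u • R)) (to3 (k + 1) R)))
          (Θ := Θ) (θ := t * θ) (C := 2 * C * ‖to3 (k + 1) R‖)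
          (fun w hw => by
            have hw' : |Θ + w * (t * θ) - D.Θs| ≤ D.radius := abs_segment_le hΘ (hseg t ht) hw
            exact (D.differentiableAt_deriv k hk _ (mem_I_of_abs_le hw') _
              (hu' _ hw').mem_smoothCube _).hasDerivAt)
          (fun w hw => by
            have hw' : |Θ + w * (t * θ) - D.Θs| ≤ D.radius := abs_segment_le hΘ (hseg t ht) hw
            have h3 := ((hC _ _ (hu' _ hw')).2.2 (to3 (k + 1) R)).2.2
            rw [iteratedDeriv_succ, iteratedDeriv_one] at h3
            refine h3.trans ?_
            exact mul_le_mul_of_nonneg_right (hC2 _ ((hlow u hu _ le_rfl).trans (min_le_left _ _))) (by positivity))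
        refine h2.trans (mul_le_mul_of_nonneg_right ?_ (by positivity))
        rw [abs_mul, abs_of_nonneg ht.1]
        exact mul_le_of_le_one_left (abs_nonneg _) ht.2)
    rw [zero_add, deriv_G_zero hk hΘ, deriv_G_zero hk (hseg t ht), sub_zero, sub_zero] at h1
    exact h1
  have e : D.G k (Θ + θ) (to3 (k + 1) (R + g)) - D.G k Θ (to3 (k + 1) R)
        - θ • deriv (fun τ => D.G k τ (to3 (k + 1) R)) Θ
        - fderiv ℝ (D.G k Θ) (to3 (k + 1) R) (to3 (k + 1) g)
      = (D.G k (Θ + θ) (to3 (k + 1) (R + g)) - D.G k (Θ + θ) (to3 (k + 1) R)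
          - fderiv ℝ (D.G k (Θ + θ)) (to3 (k + 1) R) (to3 (k + 1) g))
        + (fderiv ℝ (D.G k (Θ + θ)) (to3 (k + 1) R) (to3 (k + 1) g)
          - fderiv ℝ (D.G k Θ) (to3 (k + 1) R) (to3 (k + 1) g))
        + (D.G k (Θ + θ) (to3 (k + 1) R) - D.G k Θ (to3 (k + 1) R)
          - θ • deriv (fun τ => D.G k τ (to3 (k + 1) R)) Θ) := by abel
  rw [e]
  refine (norm_add₃_le).trans ((add_le_add (add_le_add q1 q2) q3).trans_eq ?_)
  rw [← sq_abs θ]; ring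

theorem fn3_resid {l : ℕ} (hl : 2 ≤ l) (hlk : l ≤ k) {s : ℝ} {ρ : XInf m}
    (h : D.Near Θ (s • (D.v + ρ))) : fn3 (D.resid l s Θ ρ) = fn3 (D.resid k s Θ ρ) := by
  have h1 := incl3_G hl hlk h.mem_I (h.mem_cube (hl.trans hlk)) (h.mem_cube hl)
    (by rw [fn3_to3, fn3_to3])
  rw [resid, resid, ← h1, ← map_smul, fn3_incl3]

theorem fn3_residΘ {l : ℕ} (hl : 2 ≤ l) (hlk : l ≤ k) {s : ℝ} {ρ : XInf m}
    (h : D.Near Θ (s • (D.v + ρ))) : fn3 (D.residΘ l s Θ ρ) = fn3 (D.residΘ k s Θ ρ) := by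
  rw [residΘ, residΘ, ← incl3_deriv_G hl hlk h, ← map_smul, fn3_incl3]

variable (D) in
/-- High norms of the rescaled residual of band limited triples. -/
theorem exists_resid_high {K j : ℕ} (hK : 2 ≤ K) (hKj : K + 3 = k + 3 + j) : ∃ C : ℝ, 1 ≤ C ∧
    ∀ M s Θ ρ, 1 ≤ M → 0 < s → D.Near Θ (s • (D.v + ρ)) → ‖to3 (k + 3) ρ‖ ≤ 1 →
      Band3 M (D.v + ρ) → ‖D.resid K s Θ ρ‖ ≤ C * M ^ j ∧ ‖D.residΘ K s Θ ρ‖ ≤ C * M ^ j := by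
  obtain ⟨C, hC1, hC⟩ := D.exists_bound_rescaled hK
  set Vn := ‖to3 (k + 3) D.v‖ + 1
  have hVn : 1 ≤ Vn := by simp [Vn]
  refine ⟨C * Vn, one_le_mul_of_one_le_of_one_le hC1 hVn, fun M s Θ ρ hM hs hnear hρ hband => ?_⟩
  have h1 : ‖to3 (K + 3) (s • (D.v + ρ))‖ ≤ s * (M ^ j * Vn) := by
    rw [map_smul, norm_smul, Real.norm_of_nonneg hs.le, hKj]
    refine mul_le_mul_of_nonneg_left ((hband.norm_to3_le (by linarith) _ _).trans ?_) hs.le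
    exact mul_le_mul_of_nonneg_left (norm_add_le_of_le le_rfl hρ) (by positivity)
  have h2 := hC Θ _ s _ hnear hs h1
  rw [mul_assoc, mul_comm Vn]
  exact h2

variable [NeZero m]

/-- The form required by the tame estimate: A[h] is a smooth triple and h is orthogonal to v, which
spans the kernel of A(Θ*, 0). -/
theorem newtonIncr_spec {N s : ℝ} {ρ : XInf m}
    (h : (D.newtonOp k N s Θ ρ).IsInvertible) :
    D.A k Θ (s • (D.v + ρ)) (D.newtonIncr k N s Θ ρ).2
      = YInf.to k (-(trunc3 N (D.resid k s Θ ρ))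
          - (D.newtonIncr k N s Θ ρ).1 • trunc3 N (D.residΘ k s Θ ρ)) ∧
    pairing D.v (k + 1) (D.newtonIncr k N s Θ ρ).2 = 0 := by
  have h1 : D.newtonOp k N s Θ ρ (D.newtonIncr k N s Θ ρ)
      = (-YInf.to k (trunc3 N (D.resid k s Θ ρ)), 0) := by
    rw [newtonIncr, h.self_apply_inverse]
  rw [newtonOp, bordered_apply, Prod.mk_inj] at h1
  refine ⟨?_, h1.2⟩
  rw [← toYT_to3, ← toYT_to3, ← map_smul, ← map_smul, ← map_neg, ← map_neg, ← eq_sub_iff_add_eq',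
    ← map_sub, ← map_sub] at h1
  rw [← toYT_to3]
  exact h1.1

/-- The factor N pays for the derivative missing between (Y^k)³ and Y^{k+1} × (Y^k)². -/
theorem norm_to_le (N : ℝ) (hN : 0 ≤ N) (f : Y3 m k) : ‖YInf.to k (trunc3 N f)‖ ≤ N * ‖f‖ := by
  rw [← toYT_to3]
  refine (norm_toYT_le _).trans ?_
  simpa using norm_to3_trunc3_le hN 1 f

theorem norm_newtonIncr_le {N s C : ℝ} (hN : 0 ≤ N) {ρ : XInf m}
    (h : ‖(D.newtonOp k N s Θ ρ).inverse‖ ≤ C) :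
    ‖D.newtonIncr k N s Θ ρ‖ ≤ C * (N * ‖D.resid k s Θ ρ‖) := by
  refine (ContinuousLinearMap.le_opNorm _ _).trans ?_
  refine mul_le_mul h ?_ (norm_nonneg _) ((norm_nonneg _).trans h)
  rw [Prod.norm_mk, norm_zero, max_eq_left (norm_nonneg _), norm_neg]
  exact norm_to_le N hN _

variable (D) in
/-- The tail of the Newton increment. -/
theorem exists_tail (hk : 2 ≤ k) {σ : ℕ} (hσ : Even σ) : ∃ η : ℝ, 0 < η ∧ ∃ C : ℝ, 1 ≤ C ∧
    ∀ M N s Θ ρ, 1 ≤ M → 0 < N → 0 < s → s ≤ 1 → D.Near Θ (s • (D.v + ρ)) →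
      ‖to3 (k + 3) ρ‖ ≤ 1 →
      ‖to3 (k + 3) (s • (D.v + ρ))‖ ≤ η → Band3 M (D.v + ρ) →
      (D.newtonOp k N s Θ ρ).IsInvertible → |(D.newtonIncr k N s Θ ρ).1| ≤ 2 →
      ‖(D.newtonIncr k N s Θ ρ).2 - to3 (k + 1) (trunc3 N (D.newtonIncr k N s Θ ρ).2)‖
        ≤ C * M ^ (σ + 2) / N ^ σ := by
  obtain ⟨η, hη, -, T, hT⟩ := D.tame k hk
  -- Level k + 1 controls the right-hand side in Y^{k+1} × (Y^k)², level k + σ + 1 controls it with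
  -- σ more derivatives.
  obtain ⟨C₁, hC₁, h₁⟩ := D.exists_resid_high (k := k) (K := k + 1) (j := 1) (by omega) (by omega)
  obtain ⟨C₂, hC₂, h₂⟩ := D.exists_resid_high (k := k) (K := k + σ + 1) (j := σ + 1)
    (by omega) (by omega)
  set Vn := ‖to3 (k + 3) D.v‖ + 1
  have hVn : 1 ≤ Vn := by simp [Vn]
  refine ⟨η, hη, (|T σ| + 1) * (2 * Vn * (3 * C₁) + 3 * C₂),
    one_le_mul_of_one_le_of_one_le (by simp) (by nlinarith),
    fun M N s Θ ρ hM hN hs hs1 hnear hρ hRη hband hinv hθ => ?_⟩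
  obtain ⟨heq, horth⟩ := newtonIncr_spec hinv
  set θ := (D.newtonIncr k N s Θ ρ).1
  set h := (D.newtonIncr k N s Θ ρ).2
  set z : YInf m := -(trunc3 N (D.resid k s Θ ρ)) - θ • trunc3 N (D.residΘ k s Θ ρ) with hz
  obtain ⟨h', hh', hbd⟩ := hT Θ hnear.mem_I _ hnear.mem_smoothCube hRη h z heq (by
    intro g hg
    obtain ⟨t, rfl⟩ := (D.ker k hk g).1 hg
    rw [fn3_smul, fn3_to3, dot_smul_right, ← pairing_apply, horth, mul_zero])
  have hz3 : ∀ K, 2 ≤ K → k ≤ K → ∀ B, ‖D.resid K s Θ ρ‖ ≤ B → ‖D.residΘ K s Θ ρ‖ ≤ B →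
      ‖to3 K z‖ ≤ 3 * B := by
    intro K hK hkK B h1 h2
    rw [hz, trunc3_congr N (fn3_resid hk hkK hnear), trunc3_congr N (fn3_residΘ hk hkK hnear),
      map_sub, map_neg, map_smul]
    refine (norm_sub_le _ _).trans ?_
    rw [norm_neg, norm_smul, Real.norm_eq_abs]
    have h3 := (norm_to3_trunc3_le_self hN.le (D.resid K s Θ ρ)).trans h1
    have h4 := (norm_to3_trunc3_le_self hN.le (D.residΘ K s Θ ρ)).trans h2
    have h5 := mul_le_mul hθ h4 (norm_nonneg _) zero_le_two
    linarith
  have hzk : ‖z.to k‖ ≤ 3 * (C₁ * M ^ 1) := by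
    rw [← toYT_to3]
    obtain ⟨h1, h2⟩ := h₁ M s Θ ρ hM hs hnear hρ hband
    exact (norm_toYT_le _).trans (hz3 (k + 1) (by omega) (by omega) _ h1 h2)
  have hzσ : ‖z.to (k + σ)‖ ≤ 3 * (C₂ * M ^ (σ + 1)) := by
    rw [← toYT_to3]
    obtain ⟨h1, h2⟩ := h₂ M s Θ ρ hM hs hnear hρ hband
    exact (norm_toYT_le _).trans (hz3 (k + σ + 1) (by omega) (by omega) _ h1 h2)
  have hRh : 1 + ‖to3 (k + 4 + σ) (s • (D.v + ρ))‖ ≤ 2 * Vn * M ^ (σ + 1) := by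
    have e : k + 4 + σ = k + 3 + (σ + 1) := by omega
    rw [map_smul, norm_smul, Real.norm_of_nonneg hs.le, e]
    have h1 := (hband.norm_to3_le (by linarith) (k + 3) (σ + 1)).trans
      (mul_le_mul_of_nonneg_left (norm_add_le_of_le (D := D) le_rfl hρ) (by positivity))
    have h2 : s * ‖to3 (k + 3 + (σ + 1)) (D.v + ρ)‖ ≤ M ^ (σ + 1) * Vn :=
      (mul_le_of_le_one_left (norm_nonneg _) hs1).trans h1
    have h3 : 1 ≤ M ^ (σ + 1) * Vn := one_le_mul_of_one_le_of_one_le (one_le_pow₀ hM) hVn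
    linarith
  have hMp : M ^ (σ + 1) ≤ M ^ (σ + 2) := pow_le_pow_right₀ hM (by omega)
  -- The exponent σ + 2 comes from the product in the tame estimate: σ + 1 from R in X^{k+4+σ},
  -- bounded in X^{k+3}, and one from the right-hand side.
  have hh2 : ‖to3 (k + 1 + σ) h'‖
      ≤ (|T σ| + 1) * (2 * Vn * (3 * C₁) + 3 * C₂) * M ^ (σ + 2) := by
    refine (hbd σ hσ).trans ?_
    have h1 : (1 + ‖to3 (k + 4 + σ) (s • (D.v + ρ))‖) * ‖z.to k‖
        ≤ (2 * Vn * M ^ (σ + 1)) * (3 * (C₁ * M ^ 1)) :=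
      mul_le_mul hRh hzk (norm_nonneg _) (by positivity)
    have h2 : (2 * Vn * M ^ (σ + 1)) * (3 * (C₁ * M ^ 1)) = 2 * Vn * (3 * C₁) * M ^ (σ + 2) := by
      ring
    have h3 : 3 * (C₂ * M ^ (σ + 1)) ≤ 3 * C₂ * M ^ (σ + 2) := by
      rw [← mul_assoc]; gcongr
    rw [mul_assoc]
    refine mul_le_mul (by linarith [le_abs_self (T σ)]) ?_ (by positivity) (by positivity)
    linarith
  have h3 := norm_sub_trunc3_le hN σ h (to3 (k + 1 + σ) h')
    (by rw [fn3_to3, ← hh', fn3_to3])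
  refine h3.trans ?_
  gcongr

/-- The residual after a Newton step. -/
theorem resid_newton_eq (hk : 2 ≤ k) {N s θ : ℝ} (hs : s ≠ 0) {ρ : XInf m} {h : X3 m (k + 1)}
    (hnear : D.Near Θ (s • (D.v + ρ)))
    (heq : D.A k Θ (s • (D.v + ρ)) h = YInf.to k (-(trunc3 N (D.resid k s Θ ρ))
          - θ • trunc3 N (D.residΘ k s Θ ρ))) :
    D.resid k s (Θ + θ) (ρ + trunc3 N h)
      = s⁻¹ • (D.G k (Θ + θ) (to3 (k + 1) (s • (D.v + ρ) + s • trunc3 N h))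
          - D.G k Θ (to3 (k + 1) (s • (D.v + ρ)))
          - θ • deriv (fun τ => D.G k τ (to3 (k + 1) (s • (D.v + ρ)))) Θ
          - fderiv ℝ (D.G k Θ) (to3 (k + 1) (s • (D.v + ρ))) (to3 (k + 1) (s • trunc3 N h)))
        + (D.resid k s Θ ρ - to3 k (trunc3 N (D.resid k s Θ ρ)))
        + θ • (D.residΘ k s Θ ρ - to3 k (trunc3 N (D.residΘ k s Θ ρ)))
        + D.a k Θ (s • (D.v + ρ)) (to3 (k + 1) (trunc3 N h))
        - ofYT (D.A k Θ (s • (D.v + ρ)) (h - to3 (k + 1) (trunc3 N h))) := by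
  have hRg : s • (D.v + (ρ + trunc3 N h)) = s • (D.v + ρ) + s • trunc3 N h := by
    rw [← smul_add, add_assoc]
  -- DG[S_N h] = a[S_N h] + A[h] - A[h - S_N h], where A[h] is prescribed by the Newton equation.
  have hdec : fderiv ℝ (D.G k Θ) (to3 (k + 1) (s • (D.v + ρ))) (to3 (k + 1) (s • trunc3 N h))
      = s • (D.a k Θ (s • (D.v + ρ)) (to3 (k + 1) (trunc3 N h))
        - to3 k (trunc3 N (D.resid k s Θ ρ)) - θ • to3 k (trunc3 N (D.residΘ k s Θ ρ))
        - ofYT (D.A k Θ (s • (D.v + ρ)) (h - to3 (k + 1) (trunc3 N h)))) := by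
    rw [map_smul (to3 (k + 1)) s (trunc3 N h), map_smul, fderiv_eq hk hnear,
      map_sub (D.A k Θ (s • (D.v + ρ))), map_sub ofYT, heq, ofYT_to, map_sub, map_neg, map_smul]
    congr 1; abel
  have hf : D.G k Θ (to3 (k + 1) (s • (D.v + ρ))) = s • D.resid k s Θ ρ := by
    rw [resid, smul_inv_smul₀ hs]
  have hp : deriv (fun τ => D.G k τ (to3 (k + 1) (s • (D.v + ρ)))) Θ = s • D.residΘ k s Θ ρ := by
    rw [residΘ, smul_inv_smul₀ hs]
  rw [hdec, hf, hp]
  conv_lhs => rw [resid, hRg]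
  generalize D.G k (Θ + θ) (to3 (k + 1) (s • (D.v + ρ) + s • trunc3 N h)) = u
  generalize D.resid k s Θ ρ = f
  generalize D.residΘ k s Θ ρ = p
  generalize D.a k Θ (s • (D.v + ρ)) (to3 (k + 1) (trunc3 N h)) = a
  generalize ofYT (D.A k Θ (s • (D.v + ρ)) (h - to3 (k + 1) (trunc3 N h))) = b
  rw [smul_sub, smul_sub, smul_sub, inv_smul_smul₀ hs, inv_smul_smul₀ hs, smul_comm θ s p,
    inv_smul_smul₀ hs, smul_sub]
  abel

/-- Each term of the remainder keeps a factor s, since both R and the increment of R are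
proportional to s; so the remainder stays quadratic in the Newton increment after division by s. -/
theorem taylor_remainder_le {CQ Vn s x g θ r : ℝ} (hC : 0 ≤ CQ) (hV : 1 ≤ Vn) (hs : 0 ≤ s)
    (hs1 : s ≤ 1) (hg0 : 0 ≤ g) (hr0 : 0 ≤ r) (hg : g ≤ s * x) (hθ : |θ| ≤ x) (hr : r ≤ s * Vn) :
    CQ * (g ^ 2 + |θ| * g + θ ^ 2 * r) ≤ s * (3 * CQ * Vn * x ^ 2) := by
  have hx : 0 ≤ x := (abs_nonneg θ).trans hθ
  have t1 : g ^ 2 ≤ s * (Vn * x ^ 2) := by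
    calc _ ≤ (s * x) ^ 2 := by gcongr
      _ = s * (s * x ^ 2) := by ring
      _ ≤ _ := by gcongr; linarith
  have t2 : |θ| * g ≤ s * (Vn * x ^ 2) := by
    calc _ ≤ x * (s * x) := by gcongr
      _ = s * (1 * x ^ 2) := by ring
      _ ≤ _ := by gcongr
  have t3 : θ ^ 2 * r ≤ s * (Vn * x ^ 2) := by
    rw [← sq_abs]
    calc _ ≤ x ^ 2 * (s * Vn) := by gcongr
      _ = _ := by ring
  calc _ ≤ CQ * (s * (Vn * x ^ 2) + s * (Vn * x ^ 2) + s * (Vn * x ^ 2)) := by gcongr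
    _ = _ := by ring

/-- Inserting x ≤ ci N F makes the Taylor and a terms quadratic in F, with N ≤ N². The summand ci in
the constant lets the same constant bound the increment itself. -/
theorem newton_step_bound {cQ cf ca ct ci x N F e : ℝ} (hQ : 0 ≤ cQ) (hcf : 0 ≤ cf) (hca : 0 ≤ ca)
    (hct : 0 ≤ ct) (hci : 0 ≤ ci) (hx0 : 0 ≤ x) (hN : 1 ≤ N) (hF : 0 ≤ F) (he : 0 ≤ e)
    (hx : x ≤ ci * (N * F)) :
    cQ * x ^ 2 + cf * e + 2 * (cf * e) + ca * F * x + 2 * ca * (ct * e)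
      ≤ (ci + (cQ * ci ^ 2 + ca * ci) + (3 * cf + 2 * ca * ct)) * (N ^ 2 * F ^ 2)
        + (ci + (cQ * ci ^ 2 + ca * ci) + (3 * cf + 2 * ca * ct)) * e := by
  have c1 : cQ * x ^ 2 ≤ cQ * ci ^ 2 * (N ^ 2 * F ^ 2) := by
    calc _ ≤ cQ * (ci * (N * F)) ^ 2 := by gcongr
      _ = _ := by ring
  have c2 : ca * F * x ≤ ca * ci * (N ^ 2 * F ^ 2) := by
    calc _ ≤ ca * F * (ci * (N * F)) := by gcongr
      _ = ca * ci * (N * F ^ 2) := by ring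
      _ ≤ _ := by gcongr; exact le_self_pow₀ hN (by norm_num)
  have e1 : 0 ≤ ci * (N ^ 2 * F ^ 2) := by positivity
  have e2 : 0 ≤ (3 * cf + 2 * ca * ct) * (N ^ 2 * F ^ 2) := by positivity
  have e3 : 0 ≤ ci * e := by positivity
  have e4 : 0 ≤ (cQ * ci ^ 2 + ca * ci) * e := by positivity
  linarith

/-- Estimate of the residual after a Newton step. -/
theorem exists_newton_step (D : Bifurcation m) (hk : 2 ≤ k) {σ : ℕ} (hσ : Even σ) :
    ∃ δ : ℝ, 0 < δ ∧ δ ≤ 1 ∧ δ ≤ D.radius ∧ ∃ N₀ : ℝ, 1 ≤ N₀ ∧ ∃ C : ℝ, 1 ≤ C ∧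
      (∀ s ρ, 0 < s → s ≤ δ → ‖to3 (k + 3) ρ‖ ≤ δ →
        ‖to3 (k + 3) (s • (D.v + ρ))‖ ≤ min 1 D.radius) ∧
      ∀ N s Θ ρ, N₀ ≤ N → 0 < s → s ≤ δ → |Θ - D.Θs| ≤ δ → ‖to3 (k + 3) ρ‖ ≤ δ →
        (D.newtonOp k N s Θ ρ).IsInvertible ∧
        ‖D.newtonIncr k N s Θ ρ‖ ≤ C * (N * ‖D.resid k s Θ ρ‖) ∧
        ∀ M, 1 ≤ M → Band3 M (D.v + ρ) →
          |Θ + (D.newtonIncr k N s Θ ρ).1 - D.Θs| ≤ δ →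
          ‖to3 (k + 3) (ρ + trunc3 N (D.newtonIncr k N s Θ ρ).2)‖ ≤ δ →
          ‖D.resid k s (Θ + (D.newtonIncr k N s Θ ρ).1)
              (ρ + trunc3 N (D.newtonIncr k N s Θ ρ).2)‖
            ≤ C * (N ^ 2 * ‖D.resid k s Θ ρ‖ ^ 2) + C * (M ^ (σ + 2) / N ^ σ) := by
  obtain ⟨δ₁, hδ₁, hδ₁', N₀, hN₀, Ci, hCi, hinv⟩ := D.exists_newtonOp_inverse hk
  obtain ⟨η₁, hη₁, Ct, hCt, htail⟩ := D.exists_tail hk hσ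
  obtain ⟨η₂, hη₂, -, Ca, hCa⟩ := D.decomp_bound k hk
  obtain ⟨CQ, hCQ, hQ⟩ := D.exists_taylor hk
  obtain ⟨Cf, hCf, hf⟩ := D.exists_resid_high (k := k) (K := k + σ) (j := σ) (by omega) (by omega)
  set Vn := ‖to3 (k + 3) D.v‖ + 1
  have hVn : 1 ≤ Vn := by simp [Vn]
  have hVn0 : 0 < Vn := by linarith
  have hr := D.radius_pos
  set B := min (min 1 D.radius) (min η₁ η₂)
  have hB : 0 < B := by positivity
  -- The factor 4 keeps R below B/4 before and after the step, so its increment is below B/2 and the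
  -- segment between them stays in the domain of the estimates.
  set δ := min δ₁ (min D.radius (B / (4 * Vn))) with hδdef
  have hδ : 0 < δ := by positivity
  have hδ1 : δ ≤ δ₁ := min_le_left _ _
  have hδr : δ ≤ D.radius := (min_le_right _ _).trans (min_le_left _ _)
  have hδB : δ * (4 * Vn) ≤ B := by
    rw [← le_div_iff₀ (by positivity)]; exact (min_le_right _ _).trans (min_le_right _ _)
  have hδone : δ ≤ 1 := hδ1.trans hδ₁'
  have hq : ∀ ρ : XInf m, ‖to3 (k + 3) ρ‖ ≤ δ → ∀ l, l ≤ k + 3 → ‖to3 l (D.v + ρ)‖ ≤ Vn :=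
    fun ρ hρ l hl => norm_add_le_of_le hl (hρ.trans hδone)
  have hRB : ∀ s ρ, 0 < s → s ≤ δ → ‖to3 (k + 3) ρ‖ ≤ δ →
      ‖to3 (k + 3) (s • (D.v + ρ))‖ ≤ B / 4 := fun s ρ hs hsδ hρ => by
    rw [map_smul, norm_smul, Real.norm_of_nonneg hs.le]
    have := mul_le_mul hsδ (hq ρ hρ _ le_rfl) (norm_nonneg _) hδ.le
    linarith
  have hB1 : B ≤ min 1 D.radius := min_le_left _ _
  set Ca' := |Ca| + 1
  have hCa' : 1 ≤ Ca' := by simp [Ca']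
  refine ⟨δ, hδ, hδone, hδr, max 1 N₀, le_max_left _ _,
    Ci + (3 * CQ * Vn * Ci ^ 2 + Ca' * Ci) + (3 * Cf + 2 * Ca' * Ct), ?_, ?_, ?_⟩
  · have : 0 ≤ (3 * CQ * Vn * Ci ^ 2 + Ca' * Ci) + (3 * Cf + 2 * Ca' * Ct) := by positivity
    linarith
  · intro s ρ hs hsδ hρ
    exact (hRB s ρ hs hsδ hρ).trans (by linarith)
  intro N s Θ ρ hN hs hsδ hΘ hρ
  have hN1 : 1 ≤ N := (le_max_left _ _).trans hN
  have hN0 : 0 < N := by linarith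
  obtain ⟨hI, hIle⟩ := hinv N s Θ ρ hs (hsδ.trans hδ1) (hΘ.trans hδ1) (hρ.trans hδ1)
    ((le_max_right _ _).trans hN)
  have hincr := norm_newtonIncr_le hN0.le hIle
  refine ⟨hI, hincr.trans (mul_le_mul_of_nonneg_right ?_ (by positivity)), ?_⟩
  · have : 0 ≤ (3 * CQ * Vn * Ci ^ 2 + Ca' * Ci) + (3 * Cf + 2 * Ca' * Ct) := by positivity
    linarith
  intro M hM hband hΘ' hρ'
  have hs1 : s ≤ 1 := hsδ.trans hδone
  have hR := hRB s ρ hs hsδ hρ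
  have hnear : D.Near Θ (s • (D.v + ρ)) := ⟨hΘ.trans hδr,
    (norm_to3_mono (by omega) _).trans (hR.trans (by linarith [hB1.trans (min_le_right _ _)]))⟩
  obtain ⟨heq, -⟩ := newtonIncr_spec hI
  -- Both Θ and Θ + θ lie within δ ≤ 1 of Θ*.
  have hθ2 : |(D.newtonIncr k N s Θ ρ).1| ≤ 2 := by
    rw [abs_le] at hΘ hΘ' ⊢
    constructor <;> linarith
  have htl := htail M N s Θ ρ hM hN0 hs hs1 hnear (hρ.trans hδone)
    (hR.trans (by linarith [(min_le_right (min 1 D.radius) (min η₁ η₂)).trans (min_le_left _ _)]))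
    hband hI hθ2
  have hx1 : |(D.newtonIncr k N s Θ ρ).1| ≤ ‖D.newtonIncr k N s Θ ρ‖ := by
    rw [← Real.norm_eq_abs]; exact norm_fst_le _
  have hx2 : ‖(D.newtonIncr k N s Θ ρ).2‖ ≤ ‖D.newtonIncr k N s Θ ρ‖ := norm_snd_le _
  have hx0 : 0 ≤ ‖D.newtonIncr k N s Θ ρ‖ := norm_nonneg _
  have hmain := resid_newton_eq hk hs.ne' hnear heq
  generalize ‖D.newtonIncr k N s Θ ρ‖ = x at *
  generalize (D.newtonIncr k N s Θ ρ).1 = θ at *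
  generalize (D.newtonIncr k N s Θ ρ).2 = h at *
  have hqh : ‖to3 (k + 1) (trunc3 N h)‖ ≤ x := (norm_to3_trunc3_le_self hN0.le h).trans hx2
  have hgn : ‖to3 (k + 3) (s • trunc3 N h)‖ ≤ B / 2 := by
    have e : s • trunc3 N h = s • (D.v + (ρ + trunc3 N h)) - s • (D.v + ρ) := by
      rw [← smul_sub]; congr 1; abel
    rw [e, map_sub]
    have := (norm_sub_le _ _).trans (add_le_add (hRB s (ρ + trunc3 N h) hs hsδ hρ') hR)
    linarith
  have hQ' := hQ Θ θ (s • (D.v + ρ)) (s • trunc3 N h) hnear.1 (hΘ'.trans hδr) (by linarith)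
  have hRk : ‖to3 (k + 1) (s • (D.v + ρ))‖ ≤ s * Vn := by
    rw [map_smul, norm_smul, Real.norm_of_nonneg hs.le]
    exact mul_le_mul_of_nonneg_left (hq ρ hρ _ (by omega)) hs.le
  have hgk : ‖to3 (k + 1) (s • trunc3 N h)‖ ≤ s * x := by
    rw [map_smul, norm_smul, Real.norm_of_nonneg hs.le]
    exact mul_le_mul_of_nonneg_left hqh hs.le
  obtain ⟨hf1, hf2⟩ := hf M s Θ ρ hM hs hnear (hρ.trans hδone) hband
  have hMσ : ∀ y : ℝ, y ≤ Cf * M ^ σ → y / N ^ σ ≤ Cf * (M ^ (σ + 2) / N ^ σ) := fun y hy => by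
    rw [← mul_div_assoc]
    gcongr
    exact hy.trans (mul_le_mul_of_nonneg_left (pow_le_pow_right₀ hM (by omega)) (by linarith))
  have b2 := (norm_sub_trunc3_le hN0 σ (D.resid k s Θ ρ) _
    (fn3_resid hk (Nat.le_add_right k σ) hnear)).trans (hMσ _ hf1)
  have b3' := (norm_sub_trunc3_le hN0 σ (D.residΘ k s Θ ρ) _
    (fn3_residΘ hk (Nat.le_add_right k σ) hnear)).trans (hMσ _ hf2)
  have hR2 : ‖to3 (k + 2) (s • (D.v + ρ))‖ ≤ η₂ := (norm_to3_mono (by omega) _).trans (hR.trans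
    (by linarith [(min_le_right (min 1 D.radius) (min η₁ η₂)).trans (min_le_right _ _)]))
  have hR1 : ‖to3 (k + 3) (s • (D.v + ρ))‖ ≤ 1 :=
    hR.trans (by linarith [hB1.trans (min_le_left _ _)])
  have hab := fun g => hCa Θ hnear.mem_I _ hnear.mem_smoothCube hR2 g
  -- G is s times the residual and s ≤ 1, so the bound of a by G makes its term quadratic.
  have hGf : ‖D.G k Θ (to3 (k + 1) (s • (D.v + ρ)))‖ ≤ ‖D.resid k s Θ ρ‖ := by
    rw [resid, norm_smul, norm_inv, Real.norm_of_nonneg hs.le, le_inv_mul_iff₀ hs]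
    exact mul_le_of_le_one_left (norm_nonneg _) hs1
  have hCaCa : Ca ≤ Ca' := by linarith [le_abs_self Ca]
  have b4 : ‖D.a k Θ (s • (D.v + ρ)) (to3 (k + 1) (trunc3 N h))‖
      ≤ Ca' * ‖D.resid k s Θ ρ‖ * x :=
    (hab _).1.trans (mul_le_mul (mul_le_mul hCaCa hGf (norm_nonneg _) (by linarith)) hqh
      (norm_nonneg _) (by positivity))
  have b5 : ‖ofYT (D.A k Θ (s • (D.v + ρ)) (h - to3 (k + 1) (trunc3 N h)))‖
      ≤ 2 * Ca' * (Ct * (M ^ (σ + 2) / N ^ σ)) := by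
    refine (norm_ofYT_le _).trans ((hab _).2.trans ?_)
    rw [← mul_div_assoc]
    have : Ca * (1 + ‖to3 (k + 3) (s • (D.v + ρ))‖) ≤ 2 * Ca' := by
      calc _ ≤ Ca' * (1 + ‖to3 (k + 3) (s • (D.v + ρ))‖) := by gcongr
        _ ≤ Ca' * 2 := by gcongr; linarith
        _ = _ := by ring
    exact mul_le_mul this htl (norm_nonneg _) (by positivity)
  have b1 := hQ'.trans (taylor_remainder_le (by linarith) hVn hs.le hs1 (norm_nonneg _)
    (norm_nonneg _) hgk hx1 hRk)
  rw [hmain]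
  refine le_trans ?_ (newton_step_bound (cQ := 3 * CQ * Vn) (by positivity)
    (by linarith : 0 ≤ Cf) (by linarith : 0 ≤ Ca') (by linarith : 0 ≤ Ct) (by linarith : 0 ≤ Ci)
    hx0 hN1 (norm_nonneg _) (show 0 ≤ M ^ (σ + 2) / N ^ σ by positivity) hincr)
  refine (norm_sub_le _ _).trans (add_le_add ((norm_add_le _ _).trans (add_le_add
    ((norm_add_le _ _).trans (add_le_add ((norm_add_le _ _).trans (add_le_add ?_ b2)) ?_)) b4)) b5)
  · rw [norm_smul, norm_inv, Real.norm_of_nonneg hs.le, inv_mul_le_iff₀ hs]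
    exact b1
  · rw [norm_smul, Real.norm_eq_abs]
    exact mul_le_mul hθ2 b3' (norm_nonneg _) zero_le_two

end Bifurcation

end NashMoser

/-! ### Smallness of the initial residual, the choice of scales, and the inductive bounds. -/

namespace NashMoser

namespace Bifurcation

variable {m : ℕ} {D : Bifurcation m} {k : ℕ}

theorem mem_domain_zero (D : Bifurcation m) (hk : 2 ≤ k) :
    (D.Θs, (0 : X3 m (k + 1))) ∈ D.I ×ˢ cube D.V m (k + 1) := by
  have := (near_zero D.abs_self_le_radius).mem_domain hk
  rwa [map_zero] at this

/-- As s → 0 the rescaled map tends to DG(Θ*, 0)[v + ρ], and DG(Θ*, 0)[v] = A(Θ*, 0)[v] = 0. -/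
theorem exists_resid_small (D : Bifurcation m) (hk : 2 ≤ k) {ε : ℝ} (hε : 0 < ε) :
    ∃ δ : ℝ, 0 < δ ∧ ∀ s Θ ρ, 0 < s → s < δ → |Θ - D.Θs| < δ → ‖to3 (k + 1) ρ‖ < δ →
      ‖D.resid k s Θ ρ‖ ≤ ε := by
  set Vn := ‖to3 (k + 1) D.v‖ + 1
  have hVn : 1 ≤ Vn := by simp [Vn]
  have hVn0 : 0 < Vn := by linarith
  have hG0 : ∀ᶠ τ in nhds D.Θs, D.G k τ 0 = 0 := by
    filter_upwards [D.isOpen_I.mem_nhds D.Θs_mem] with τ hτ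
    exact D.G_zero _ hk τ hτ
  obtain ⟨δ₁, hδ₁, hexp⟩ := eventually_expansion (D.isOpen_domain hk)
    (D.contDiffOn_G k hk) (D.mem_domain_zero hk) hG0 (show 0 < ε / (2 * Vn) by positivity)
  set L := fderiv ℝ (D.G k D.Θs) 0
  have hLv : L (to3 (k + 1) D.v) = 0 := by
    rw [fderiv_zero hk D.abs_self_le_radius, (D.ker k hk _).2 ⟨1, (one_smul _ _).symm⟩, map_zero]
  refine ⟨min 1 (min (δ₁ / (2 * Vn)) (ε / (2 * (‖L‖ + 1)))), by positivity, ?_⟩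
  intro s Θ ρ hs hsδ hΘ hρ
  simp only [lt_min_iff] at hsδ hΘ hρ
  have d1 := (lt_div_iff₀ (by positivity)).1 hsδ.2.1
  have d2 := (lt_div_iff₀ (by positivity)).1 hΘ.2.1
  have d3 := (lt_div_iff₀ (by positivity)).1 hρ.2.2
  have hq : ‖to3 (k + 1) (D.v + ρ)‖ ≤ Vn := by
    rw [map_add]
    exact (norm_add_le _ _).trans (add_le_add le_rfl hρ.1.le)
  have hg : ‖to3 (k + 1) (s • (D.v + ρ))‖ ≤ s * Vn := by
    rw [map_smul, norm_smul, Real.norm_of_nonneg hs.le]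
    exact mul_le_mul_of_nonneg_left hq hs.le
  have h1 := hexp Θ (to3 (k + 1) (s • (D.v + ρ)))
    (by nlinarith [abs_nonneg (Θ - D.Θs)]) (hg.trans_lt (by nlinarith))
  have e : D.resid k s Θ ρ = s⁻¹ • (D.G k Θ (0 + to3 (k + 1) (s • (D.v + ρ)))
      - L (to3 (k + 1) (s • (D.v + ρ)))) + L (to3 (k + 1) ρ) := by
    rw [zero_add, smul_sub, map_smul, map_smul, smul_smul, inv_mul_cancel₀ hs.ne', one_smul,
      map_add, map_add, hLv, zero_add, sub_add_cancel, resid, map_smul, map_add]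
  rw [e]
  refine (norm_add_le _ _).trans ((add_le_add ?_ ?_).trans_eq (add_halves ε))
  · rw [norm_smul, norm_inv, Real.norm_of_nonneg hs.le, inv_mul_le_iff₀ hs]
    refine h1.trans ((mul_le_mul_of_nonneg_left hg (by positivity)).trans_eq ?_)
    field_simp
  · refine (L.le_opNorm _).trans ?_
    nlinarith [norm_nonneg (to3 (k + 1) ρ), norm_nonneg L]

/-! ### The iteration -/

/-- The scales of the iteration, `τ_{n+1} = τ_n^{3/2}`. -/
def scale (t : ℝ) : ℕ → ℝ
  | 0 => t
  | n + 1 => scale t n * √(scale t n)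

/-- From 4 on, the factor √τ is at least 2, so the scales at least double. -/
theorem le_scale {t : ℝ} (ht : 4 ≤ t) (n : ℕ) : 2 ^ n * t ≤ scale t n := by
  induction n with
  | zero => simp [scale]
  | succ n ih =>
    have h1 : (1 : ℝ) ≤ 2 ^ n := one_le_pow₀ one_le_two
    have h4 : 4 ≤ scale t n := by nlinarith
    have h2 : 2 ≤ √(scale t n) := Real.le_sqrt_of_sq_le (by linarith)
    rw [scale, pow_succ]
    nlinarith

theorem le_scale_self {t : ℝ} (ht : 4 ≤ t) (n : ℕ) : t ≤ scale t n :=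
  (le_mul_of_one_le_left (by linarith) (one_le_pow₀ one_le_two)).trans (le_scale ht n)

theorem scale_succ_sq {t : ℝ} (ht : 4 ≤ t) (n : ℕ) : scale t (n + 1) ^ 2 = scale t n ^ 3 := by
  have := le_scale_self ht n
  rw [scale, mul_pow, Real.sq_sqrt (by linarith)]
  ring

/-- Here N = τ³. Passing from X^{k+1} to X^{k+3} costs N² and the inverse costs N, in all τ⁹,
against a residual of size τ^(-14); one further power of τ absorbs C, δ and 2^n. -/
theorem scale_increment_le {t C δ : ℝ} (ht : 4 ≤ t) (hδ : 0 < δ) (htC : 2 * C ≤ t * δ)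
    (n : ℕ) {f : ℝ} (hf : f * scale t n ^ 14 ≤ 1) (hf0 : 0 ≤ f) :
    (scale t n ^ 3) ^ 2 * (C * (scale t n ^ 3 * f)) ≤ δ / 2 / 2 ^ n := by
  have h1 := le_scale ht n
  have h2 : (1 : ℝ) ≤ 2 ^ n := one_le_pow₀ one_le_two
  rw [le_div_iff₀ (by positivity), le_div_iff₀ (by positivity)]
  set x := scale t n
  have hx : 1 ≤ x := by nlinarith
  have h3 : 2 * C * 2 ^ n ≤ x * δ := by nlinarith
  have h4 : x ^ 10 * f ≤ x ^ 14 * f :=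
    mul_le_mul_of_nonneg_right (pow_le_pow_right₀ hx (by norm_num)) hf0
  have h5 : 0 ≤ x ^ 9 * f := by positivity
  calc _ = x ^ 9 * f * (2 * C * 2 ^ n) := by ring
    _ ≤ x ^ 9 * f * (x * δ) := mul_le_mul_of_nonneg_left h3 h5
    _ = (x ^ 10 * f) * δ := by ring
    _ ≤ 1 * δ := mul_le_mul_of_nonneg_right (h4.trans (by linarith)) hδ.le
    _ = δ := one_mul _

/-- Here N = τ³, M = τ², σ = 34. The quadratic term is at most τ^(6-28) = τ^(-22) and the truncation
term is τ^(72-102) = τ^(-30), while the target is τ_{n+1}^(-14) = τ^(-21). The spare power of τ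
absorbs 2C. -/
theorem scale_residual_le {t C : ℝ} (ht : 4 ≤ t) (hC : 0 ≤ C) (htC : 2 * C ≤ t)
    (n : ℕ) {f f' : ℝ} (hf : f * scale t n ^ 14 ≤ 1) (hf0 : 0 ≤ f)
    (hf' : f' ≤ C * ((scale t n ^ 3) ^ 2 * f ^ 2)
      + C * ((scale t n ^ 2) ^ (34 + 2) / (scale t n ^ 3) ^ 34)) :
    f' * scale t (n + 1) ^ 14 ≤ 1 := by
  have e : scale t (n + 1) ^ 14 = scale t n ^ 21 := by
    rw [show 14 = 2 * 7 by norm_num, pow_mul, scale_succ_sq ht]; ring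
  have h1 := le_scale_self ht n
  rw [e]
  set x := scale t n
  have hx : 1 ≤ x := by linarith
  have hx0 : 0 < x := by linarith
  have h2 : (f * x ^ 14) ^ 2 ≤ 1 := pow_le_one₀ (by positivity) hf
  have e2 : (x ^ 2) ^ (34 + 2) / (x ^ 3) ^ 34 = (x ^ 30)⁻¹ := by
    field_simp
    ring
  rw [e2] at hf'
  have h3 : f' * x ^ 30 ≤ 2 * C * x ^ 8 := by
    have h4 : x ^ 8 * (f * x ^ 14) ^ 2 ≤ x ^ 8 * 1 := mul_le_mul_of_nonneg_left h2 (by positivity)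
    have h5 : 1 ≤ x ^ 8 := one_le_pow₀ hx
    calc f' * x ^ 30 ≤ (C * ((x ^ 3) ^ 2 * f ^ 2) + C * (x ^ 30)⁻¹) * x ^ 30 :=
          mul_le_mul_of_nonneg_right hf' (by positivity)
      _ = C * (x ^ 8 * (f * x ^ 14) ^ 2) + C := by field_simp
      _ ≤ C * (x ^ 8 * 1) + C * x ^ 8 :=
          add_le_add (mul_le_mul_of_nonneg_left h4 hC) (le_mul_of_one_le_right hC h5)
      _ = 2 * C * x ^ 8 := by ring
  have h6 : 2 * C * x ^ 8 ≤ x ^ 9 := by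
    rw [pow_succ' x 8]; exact mul_le_mul_of_nonneg_right (htC.trans h1) (by positivity)
  have h7 : (f' * x ^ 21) * x ^ 9 ≤ 1 * x ^ 9 := by
    rw [one_mul]; refine le_trans (le_of_eq ?_) (h3.trans h6); ring
  exact le_of_mul_le_mul_right h7 (by positivity)

/-- A single mode is band limited; this starts the induction on the frequency support of v + ρ_n. -/
theorem exists_band_v (D : Bifurcation m) (hm : m ≠ 0) : ∃ M : ℝ, 1 ≤ M ∧ Band3 M D.v := by
  obtain ⟨c, hc⟩ := D.v_mode
  refine ⟨1 + m, by simp, fun i n hn => ?_⟩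
  have e : (D.v i : L2) = c i • cosMode m := congrFun hc i
  have h0 : (0 : ℝ) ≤ m := Nat.cast_nonneg m
  rw [e, coeff_smul]
  have key : ∀ n : ℤ, (1 + (m : ℝ)) ^ 2 < 1 + (n : ℝ) ^ 2 → 0 ≤ n → coeff (cosMode m) n = 0 := by
    intro n hn hn0
    lift n to ℕ using hn0
    rw [coeff_cosMode m n hm, if_neg]
    rintro rfl
    push_cast at hn
    nlinarith
  rcases le_total 0 n with h | h
  · rw [key n hn h, smul_zero]
  · have := key (-n) (by push_cast; rwa [neg_sq]) (by omega)
    rw [← neg_neg n, coeff_neg_index, this, map_zero, smul_zero]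

variable [NeZero m]

variable (D) in
/-- The approximate solutions `(Θ_n, ρ_n)`. -/
def iter (k : ℕ) (t s : ℝ) : ℕ → ℝ × XInf m
  | 0 => (D.Θs, 0)
  | n + 1 =>
    ((iter k t s n).1
        + (D.newtonIncr k (scale t n ^ 3) s (iter k t s n).1 (iter k t s n).2).1,
      (iter k t s n).2 + trunc3 (scale t n ^ 3)
        (D.newtonIncr k (scale t n ^ 3) s (iter k t s n).1 (iter k t s n).2).2)

theorem sum_half_step {a δ : ℝ} {n : ℕ} (h : a ≤ δ * (1 - 1 / 2 ^ n) + δ / 2 / 2 ^ n) :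
    a ≤ δ * (1 - 1 / 2 ^ (n + 1)) := by
  refine h.trans (le_of_eq ?_)
  field_simp
  ring

theorem mul_one_sub_le {δ : ℝ} (hδ : 0 ≤ δ) (n : ℕ) : δ * (1 - 1 / 2 ^ n) ≤ δ :=
  mul_le_of_le_one_right hδ (by simp)

theorem exists_iter_bounds (D : Bifurcation m) (hk : 2 ≤ k) {ε : ℝ} (hε : 0 < ε) :
    ∃ δ t s₀ C : ℝ, 0 < δ ∧ δ ≤ ε ∧ δ ≤ D.radius ∧ 4 ≤ t ∧ 0 < s₀ ∧
      ∀ s, 0 < s → s < s₀ → ∀ n,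
        ‖D.resid k s (D.iter k t s n).1 (D.iter k t s n).2‖ * scale t n ^ 14 ≤ 1 ∧
        |(D.iter k t s n).1 - D.Θs| ≤ δ ∧ ‖to3 (k + 3) (D.iter k t s n).2‖ ≤ δ ∧
        ‖to3 (k + 3) (s • (D.v + (D.iter k t s n).2))‖ ≤ min 1 D.radius ∧
        (D.newtonOp k (scale t n ^ 3) s (D.iter k t s n).1 (D.iter k t s n).2).IsInvertible ∧
        ‖D.newtonIncr k (scale t n ^ 3) s (D.iter k t s n).1 (D.iter k t s n).2‖
          ≤ C * (scale t n ^ 3 * ‖D.resid k s (D.iter k t s n).1 (D.iter k t s n).2‖) ∧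
        |(D.iter k t s (n + 1)).1 - (D.iter k t s n).1| ≤ δ / 2 / 2 ^ n ∧
        ‖to3 (k + 3) (D.iter k t s (n + 1)).2 - to3 (k + 3) (D.iter k t s n).2‖
          ≤ δ / 2 / 2 ^ n := by
  obtain ⟨δ₀, hδ₀, -, hδr, N₀, hN₀, C, hC, hdom, hstep⟩ :=
    D.exists_newton_step hk (σ := 34) (by decide)
  obtain ⟨M, hM, hband⟩ := D.exists_band_v (NeZero.ne m)
  set δ := min δ₀ ε
  have hδ : 0 < δ := lt_min hδ₀ hε
  have hδδ : δ ≤ δ₀ := min_le_left _ _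
  -- Each summand serves one demand on all scales: doubling, N ≥ N₀, the band of v, the residual
  -- estimate and the increment estimate. Since t is fixed before s, the convergence is uniform in
  -- s.
  set t := 4 + N₀ + M + 2 * C + 2 * C / δ
  have hCδ : 0 ≤ 2 * C / δ := by positivity
  have ht : 4 ≤ t := by simp only [t]; linarith
  have htδ : 2 * C ≤ t * δ := by
    rw [← div_le_iff₀ hδ]; simp only [t]; linarith
  -- Only now is s restricted: the first residual must be below t^(-14).
  obtain ⟨s₁, hs₁, hres⟩ := D.exists_resid_small hk (show 0 < (t ^ 14)⁻¹ by positivity)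
  have hx1 : ∀ n, 1 ≤ scale t n := fun n => by linarith [le_scale_self ht n]
  have hNn : ∀ n, N₀ ≤ scale t n ^ 3 := fun n =>
    le_trans (by have := le_scale_self ht n; simp only [t] at this; linarith)
      (le_self_pow₀ (hx1 n) (by norm_num))
  have hinc : ∀ n s, 0 < s → s < min s₁ δ₀ →
      ‖D.resid k s (D.iter k t s n).1 (D.iter k t s n).2‖ * scale t n ^ 14 ≤ 1 →
      |(D.iter k t s n).1 - D.Θs| ≤ δ₀ → ‖to3 (k + 3) (D.iter k t s n).2‖ ≤ δ₀ →
      |(D.iter k t s (n + 1)).1 - (D.iter k t s n).1| ≤ δ / 2 / 2 ^ n ∧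
        ‖to3 (k + 3) (D.iter k t s (n + 1)).2 - to3 (k + 3) (D.iter k t s n).2‖
          ≤ δ / 2 / 2 ^ n := by
    intro n s hs hss hr hΘ hρ
    obtain ⟨-, h2, -⟩ := hstep _ s _ _ (hNn n) hs (hss.trans_le (min_le_right _ _)).le hΘ hρ
    have h3 := scale_increment_le ht hδ htδ n hr (norm_nonneg _)
    have hN1 : 1 ≤ (scale t n ^ 3) ^ 2 := one_le_pow₀ (one_le_pow₀ (hx1 n))
    rw [iter, add_sub_cancel_left, map_add, add_sub_cancel_left]
    refine ⟨?_, ?_⟩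
    · rw [← Real.norm_eq_abs]
      exact (norm_fst_le _).trans ((le_mul_of_one_le_left (norm_nonneg _) hN1).trans
        ((mul_le_mul_of_nonneg_left h2 (by positivity)).trans h3))
    · exact (norm_to3_trunc3_le (k := k + 1) (by have := hx1 n; positivity) 2 _).trans
        ((mul_le_mul_of_nonneg_left ((norm_snd_le _).trans h2) (by positivity)).trans h3)
  have hind : ∀ s, 0 < s → s < min s₁ δ₀ → ∀ n,
      ‖D.resid k s (D.iter k t s n).1 (D.iter k t s n).2‖ * scale t n ^ 14 ≤ 1 ∧
      |(D.iter k t s n).1 - D.Θs| ≤ δ * (1 - 1 / 2 ^ n) ∧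
      ‖to3 (k + 3) (D.iter k t s n).2‖ ≤ δ * (1 - 1 / 2 ^ n) ∧
      Band3 (scale t n ^ 2) (D.v + (D.iter k t s n).2) := by
    intro s hs hss n
    induction n with
    | zero =>
      have h := hres s D.Θs 0 hs (hss.trans_le (min_le_left _ _)) (by simpa using hs₁)
        (by rw [map_zero, norm_zero]; exact hs₁)
      refine ⟨?_, by simp [iter], by simp [iter], ?_⟩
      · rw [iter, scale, ← le_inv_mul_iff₀' (by positivity), mul_one]
        exact h
      · rw [iter, scale, add_zero]
        refine hband.mono (by linarith) (le_trans ?_ (le_self_pow₀ (by linarith) (by norm_num)))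
        simp only [t]; linarith
    | succ n ih =>
      obtain ⟨h1, h2, h3, h4⟩ := ih
      have hle := (mul_one_sub_le hδ.le n).trans hδδ
      obtain ⟨h5, h6⟩ := hinc n s hs hss h1 (h2.trans hle) (h3.trans hle)
      have h7 : |(D.iter k t s (n + 1)).1 - D.Θs| ≤ δ * (1 - 1 / 2 ^ (n + 1)) :=
        sum_half_step ((abs_sub_le _ _ _).trans ((add_comm _ _).trans_le (add_le_add h2 h5)))
      have h8 : ‖to3 (k + 3) (D.iter k t s (n + 1)).2‖ ≤ δ * (1 - 1 / 2 ^ (n + 1)) :=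
        sum_half_step ((norm_le_norm_add_norm_sub' _ _).trans (add_le_add h3 h6))
      have hle' := (mul_one_sub_le hδ.le (n + 1)).trans hδδ
      obtain ⟨-, -, h9⟩ := hstep _ s _ _ (hNn n) hs (hss.trans_le (min_le_right _ _)).le
        (h2.trans hle) (h3.trans hle)
      have h10 := h9 _ (one_le_pow₀ (hx1 n)) h4 (h7.trans hle') (h8.trans hle')
      refine ⟨scale_residual_le ht (by linarith) (by simp only [t]; linarith) n h1
        (norm_nonneg _) h10, h7, h8, ?_⟩
      have hx := hx1 n
      -- The new band M_{n+1} = τ_{n+1}² equals N_n = τ_n³, the cutoff of the increment just added.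
      rw [scale_succ_sq ht, iter, ← add_assoc]
      exact (h4.mono (by positivity) (pow_le_pow_right₀ hx (by norm_num))).add
        (band3_trunc3 (by positivity) _)
  refine ⟨δ, t, min s₁ δ₀, C, hδ, min_le_right _ _, hδδ.trans hδr, ht, lt_min hs₁ hδ₀,
    fun s hs hss n => ?_⟩
  obtain ⟨h1, h2, h3, -⟩ := hind s hs hss n
  have hle := mul_one_sub_le hδ.le n
  have hsδ : s ≤ δ₀ := (hss.trans_le (min_le_right _ _)).le
  obtain ⟨h5, h6⟩ := hinc n s hs hss h1 (h2.trans (hle.trans hδδ)) (h3.trans (hle.trans hδδ))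
  obtain ⟨h7, h8, -⟩ := hstep _ s _ _ (hNn n) hs hsδ (h2.trans (hle.trans hδδ))
    (h3.trans (hle.trans hδδ))
  exact ⟨h1, h2.trans hle, h3.trans hle, hdom s _ hs hsδ (h3.trans (hle.trans hδδ)), h7, h8, h5, h6⟩

end Bifurcation

end NashMoser

namespace NashMoser

namespace Bifurcation

variable {m : ℕ} {D : Bifurcation m} {k : ℕ}

open Filter Topology

/-! ### Continuity of the iterates -/

section Continuity

variable {S : Set ℝ} {s : ℝ} {Θ : ℝ → ℝ} {ρ : ℝ → XInf m}

/-- The Lipschitz bound of A, which holds in operator norm. -/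
theorem continuousWithinAt_A (hk : 2 ≤ k) {R : ℝ → XInf m} (hs : s ∈ S)
    (hnear : ∀ᶠ s' in 𝓝[S] s, D.Near (Θ s') (R s') ∧ ‖to3 (k + 3) (R s')‖ ≤ 1)
    (hΘ : ContinuousWithinAt Θ S s) (hR : ContinuousWithinAt (fun s => to3 (k + 3) (R s)) S s) :
    ContinuousWithinAt (fun s => D.A k (Θ s) (R s)) S s := by
  obtain ⟨C, -, hC⟩ := D.norm_A_sub_le hk
  have h0 := hnear.self_of_nhdsWithin hs
  have hlim : Tendsto (fun s' => C * (|Θ s' - Θ s| + ‖to3 (k + 3) (R s') - to3 (k + 3) (R s)‖))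
      (𝓝[S] s) (𝓝 0) := by
    have h1 := (hΘ.sub (continuousWithinAt_const (b := Θ s))).abs.add
      (hR.sub (continuousWithinAt_const (b := to3 (k + 3) (R s)))).norm
    simpa [ContinuousWithinAt] using h1.const_mul C
  refine tendsto_iff_norm_sub_tendsto_zero.2 (squeeze_zero' (Eventually.of_forall fun _ =>
    norm_nonneg _) ?_ hlim)
  filter_upwards [hnear] with s' hs'
  exact hC _ _ _ _ hs'.1 h0.1 hs'.2 h0.2

theorem continuousWithinAt_smul_v_add (hρ : ∀ K, ContinuousWithinAt (fun s => to3 K (ρ s)) S s)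
    (K : ℕ) : ContinuousWithinAt (fun s => to3 K (s • (D.v + ρ s))) S s := by
  simp only [map_smul, map_add]
  exact continuousWithinAt_id.smul (continuousWithinAt_const.add (hρ K))

theorem continuousWithinAt_resid (hk : 2 ≤ k) (hs0 : s ≠ 0)
    (hnear : D.Near (Θ s) (s • (D.v + ρ s))) (hΘ : ContinuousWithinAt Θ S s)
    (hρ : ∀ K, ContinuousWithinAt (fun s => to3 K (ρ s)) S s) :
    ContinuousWithinAt (fun s => D.resid k s (Θ s) (ρ s)) S s := by
  have h1 := (contDiffAt_pair (D.isOpen_domain hk) (D.contDiffOn_G k hk)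
    (hnear.mem_domain hk)).continuousAt
  exact (continuousWithinAt_id.inv₀ hs0).smul (h1.comp_continuousWithinAt
    (f := fun s => (Θ s, to3 (k + 1) (s • (D.v + ρ s))))
    (hΘ.prodMk (continuousWithinAt_smul_v_add hρ (k + 1))))

theorem continuousWithinAt_residΘ (hk : 2 ≤ k) (hs0 : s ≠ 0) (hs : s ∈ S)
    (hnear : ∀ᶠ s' in 𝓝[S] s, D.Near (Θ s') (s' • (D.v + ρ s'))) (hΘ : ContinuousWithinAt Θ S s)
    (hρ : ∀ K, ContinuousWithinAt (fun s => to3 K (ρ s)) S s) :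
    ContinuousWithinAt (fun s => D.residΘ k s (Θ s) (ρ s)) S s := by
  have h0 := hnear.self_of_nhdsWithin hs
  have h1 := ((contDiffAt_pair (D.isOpen_domain hk) (D.contDiffOn_G k hk)
    (h0.mem_domain hk)).fderiv_right (m := 0) (by norm_num)).continuousAt
  have h2 := (h1.comp_continuousWithinAt
    (f := fun s => (Θ s, to3 (k + 1) (s • (D.v + ρ s))))
    (hΘ.prodMk (continuousWithinAt_smul_v_add hρ (k + 1)))).clm_apply
      (continuousWithinAt_const (b := ((1 : ℝ), (0 : X3 m (k + 1)))))
  refine (continuousWithinAt_id.inv₀ hs0).smul (h2.congr_of_eventuallyEq ?_ ?_)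
  · filter_upwards [hnear] with s' hs'
    exact deriv_fst_eq (D.isOpen_domain hk) (D.contDiffOn_G k hk) (hs'.mem_domain hk)
  · exact deriv_fst_eq (D.isOpen_domain hk) (D.contDiffOn_G k hk) (h0.mem_domain hk)

theorem continuousWithinAt_bordered {v : XInf m} {p : ℝ → YT m k}
    {A : ℝ → X3 m (k + 1) →L[ℝ] YT m k} (hp : ContinuousWithinAt p S s)
    (hA : ContinuousWithinAt A S s) : ContinuousWithinAt (fun s => bordered v (p s) (A s)) S s := by
  refine tendsto_iff_norm_sub_tendsto_zero.2 (squeeze_zero (fun _ => norm_nonneg _)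
    (fun s' => norm_bordered_sub_le v (p s') (p s) (A s') (A s)) ?_)
  simpa using (tendsto_iff_norm_sub_tendsto_zero.1 hp).add (tendsto_iff_norm_sub_tendsto_zero.1 hA)

variable [NeZero m] {N : ℝ}

theorem continuousWithinAt_to_trunc3 (hN : 0 ≤ N) {f : ℝ → Y3 m k}
    (hf : ContinuousWithinAt f S s) :
    ContinuousWithinAt (fun s => YInf.to k (trunc3 N (f s))) S s := by
  have h := (toYT.comp (trunc3L hN k (k + 1))).continuous.continuousAt.comp_continuousWithinAt hf
  refine h.congr (fun s' _ => ?_) ?_ <;> exact (toYT_to3 _).symm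

/-- Inversion is continuous at an invertible operator, and the bordered operator and its right-hand
side depend continuously on s. -/
theorem continuousWithinAt_newtonIncr (hk : 2 ≤ k) (hN : 0 ≤ N) (hs0 : s ≠ 0) (hs : s ∈ S)
    (hnear : ∀ᶠ s' in 𝓝[S] s, D.Near (Θ s') (s' • (D.v + ρ s'))
      ∧ ‖to3 (k + 3) (s' • (D.v + ρ s'))‖ ≤ 1)
    (hinv : (D.newtonOp k N s (Θ s) (ρ s)).IsInvertible)
    (hΘ : ContinuousWithinAt Θ S s) (hρ : ∀ K, ContinuousWithinAt (fun s => to3 K (ρ s)) S s) :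
    ContinuousWithinAt (fun s => D.newtonIncr k N s (Θ s) (ρ s)) S s := by
  have hop : ContinuousWithinAt (fun s => D.newtonOp k N s (Θ s) (ρ s)) S s :=
    continuousWithinAt_bordered (continuousWithinAt_to_trunc3 hN
      (continuousWithinAt_residΘ hk hs0 hs (hnear.mono fun _ h => h.1) hΘ hρ))
      (continuousWithinAt_A hk hs hnear hΘ (continuousWithinAt_smul_v_add hρ (k + 3)))
  obtain ⟨e, he⟩ := hinv
  have h1 : ContinuousAt ContinuousLinearMap.inverse (D.newtonOp k N s (Θ s) (ρ s)) := by
    rw [← he]; exact (contDiffAt_map_inverse (n := 0) e).continuousAt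
  have hr := continuousWithinAt_to_trunc3 hN (continuousWithinAt_resid (S := S) hk hs0
    (hnear.self_of_nhdsWithin hs).1 hΘ hρ)
  exact (h1.comp_continuousWithinAt (f := fun s => D.newtonOp k N s (Θ s) (ρ s)) hop).clm_apply
    (hr.neg.prodMk continuousWithinAt_const)

/-- With 0⁻¹ = 0 the residual at s = 0 is zero, and so is its image under `inverse`, whether or not
the operator is invertible. The iteration thus stands still at s = 0. -/
theorem newtonIncr_zero (k : ℕ) (N Θ : ℝ) (ρ : XInf m) : D.newtonIncr k N 0 Θ ρ = 0 := by
  rw [newtonIncr, resid, inv_zero, zero_smul, map_zero, ← toYT_to3, map_zero, map_zero, neg_zero,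
    ← Prod.zero_eq_mk, map_zero]

theorem iter_zero (k : ℕ) (t : ℝ) (n : ℕ) : D.iter k t 0 n = (D.Θs, 0) := by
  induction n with
  | zero => rfl
  | succ n ih => rw [iter, newtonIncr_zero, ih, Prod.fst_zero, Prod.snd_zero, map_zero, add_zero,
      add_zero]

/-- For s > 0 the increment is composed of continuous maps. At s = 0 it is zero by convention, and
it tends to zero because it is bounded by a fixed multiple of the residual, which tends to zero with
s. -/
theorem continuousOn_iter (hk : 2 ≤ k) {t s₀ C δ : ℝ} (ht : 4 ≤ t)
    (hδr : δ ≤ D.radius)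
    (h : ∀ s, 0 < s → s < s₀ → ∀ n, |(D.iter k t s n).1 - D.Θs| ≤ δ ∧
        ‖to3 (k + 3) (s • (D.v + (D.iter k t s n).2))‖ ≤ min 1 D.radius ∧
        (D.newtonOp k (scale t n ^ 3) s (D.iter k t s n).1 (D.iter k t s n).2).IsInvertible ∧
        ‖D.newtonIncr k (scale t n ^ 3) s (D.iter k t s n).1 (D.iter k t s n).2‖
          ≤ C * (scale t n ^ 3 * ‖D.resid k s (D.iter k t s n).1 (D.iter k t s n).2‖)) (n : ℕ) :
    ContinuousOn (fun s => (D.iter k t s n).1) (Set.Ico 0 s₀) ∧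
      ∀ K, ContinuousOn (fun s => to3 K (D.iter k t s n).2) (Set.Ico 0 s₀) := by
  induction n with
  | zero => exact ⟨continuousOn_const, fun K => (continuousOn_const (c := to3 K 0))⟩
  | succ n ih =>
    have hN : 0 ≤ scale t n ^ 3 := pow_nonneg (by linarith [le_scale_self ht n]) 3
    have hincr : ContinuousOn (fun s => D.newtonIncr k (scale t n ^ 3) s (D.iter k t s n).1
        (D.iter k t s n).2) (Set.Ico 0 s₀) := by
      intro s hs
      rcases hs.1.eq_or_lt with rfl | hs0
      · refine tendsto_iff_norm_sub_tendsto_zero.2 ?_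
        simp only [newtonIncr_zero, sub_zero]
        have hΘ0 := ih.1 0 hs
        have hρ0 := ih.2 (k + 1) 0 hs
        have hlim : Tendsto (fun s => D.resid k s (D.iter k t s n).1 (D.iter k t s n).2)
            (𝓝[Set.Ico 0 s₀] 0) (𝓝 0) := by
          rw [Metric.tendsto_nhds]
          intro ε hε
          obtain ⟨r, hr, hr'⟩ := D.exists_resid_small hk (half_pos hε)
          have e1 := Metric.tendsto_nhds.1 hΘ0 r hr
          have e2 := Metric.tendsto_nhds.1 hρ0 r hr
          simp only [iter_zero, map_zero] at e1 e2
          have e3 : ∀ᶠ s' : ℝ in 𝓝[Set.Ico 0 s₀] 0, s' < r :=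
            (eventually_lt_nhds hr).filter_mono nhdsWithin_le_nhds
          filter_upwards [e1, e2, e3, self_mem_nhdsWithin] with s' h1 h2 h3 h4
          rw [dist_zero_right] at h2 ⊢
          rcases h4.1.eq_or_lt with rfl | h5
          · rw [resid, inv_zero, zero_smul, norm_zero]; exact hε
          · exact (hr' s' _ _ h5 h3 h1 h2).trans_lt (half_lt_self hε)
        have hlim2 : Tendsto (fun s => C * (scale t n ^ 3
            * ‖D.resid k s (D.iter k t s n).1 (D.iter k t s n).2‖))
            (𝓝[Set.Ico 0 s₀] 0) (𝓝 0) := by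
          simpa using (hlim.norm.const_mul (scale t n ^ 3)).const_mul C
        refine squeeze_zero' (Eventually.of_forall fun _ => norm_nonneg _) ?_ hlim2
        filter_upwards [self_mem_nhdsWithin] with s' hs'
        rcases hs'.1.eq_or_lt with rfl | h5
        · rw [newtonIncr_zero, resid, inv_zero, zero_smul, norm_zero, norm_zero, mul_zero, mul_zero]
        · exact (h s' h5 hs'.2 n).2.2.2
      · have hnear : ∀ᶠ s' in 𝓝[Set.Ico 0 s₀] s,
            D.Near (D.iter k t s' n).1 (s' • (D.v + (D.iter k t s' n).2))
              ∧ ‖to3 (k + 3) (s' • (D.v + (D.iter k t s' n).2))‖ ≤ 1 := by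
          filter_upwards [self_mem_nhdsWithin, mem_nhdsWithin_of_mem_nhds (lt_mem_nhds hs0)]
            with s' h1 h2
          obtain ⟨h3, h4, -⟩ := h s' h2 h1.2 n
          exact ⟨⟨h3.trans hδr, (norm_to3_mono (by omega) _).trans (h4.trans (min_le_right _ _))⟩,
            h4.trans (min_le_left _ _)⟩
        exact continuousWithinAt_newtonIncr hk hN hs0.ne' hs hnear (h s hs0 hs.2 n).2.2.1
          (ih.1 s hs) fun K => ih.2 K s hs
    -- Truncation is bounded from X^{k+1} into every X^K, so continuity of the increment in X^{k+1}
    -- gives continuity of the next iterate in all classes.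
    refine ⟨ih.1.add (continuous_fst.comp_continuousOn hincr), fun K => ?_⟩
    simp only [iter, map_add]
    exact (ih.2 K).add (((trunc3L hN (k + 1) K).continuous.comp continuous_snd).comp_continuousOn
      hincr)

end Continuity

end Bifurcation

end NashMoser

/-! ### Passage to the limit and the curve of solutions. -/

namespace NashMoser

-- Geometric increments uniform on S give uniform convergence, which preserves continuity.
open Filter Topology in
theorem exists_continuousOn_limit {E : Type*} [NormedAddCommGroup E] [CompleteSpace E]
    {f : ℕ → ℝ → E} {S : Set ℝ} {C : ℝ} (hc : ∀ n, ContinuousOn (f n) S)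
    (hd : ∀ n, ∀ s ∈ S, ‖f (n + 1) s - f n s‖ ≤ C / 2 / 2 ^ n) :
    ∃ g : ℝ → E, ContinuousOn g S ∧ ∀ s ∈ S, Tendsto (fun n => f n s) atTop (𝓝 (g s)) := by
  have hd' : ∀ s ∈ S, ∀ n, dist (f n s) (f (n + 1) s) ≤ C / 2 / 2 ^ n := fun s hs n => by
    rw [dist_comm, dist_eq_norm]; exact hd n s hs
  have hlim : ∀ s, ∃ a, s ∈ S → Tendsto (fun n => f n s) atTop (𝓝 a) := fun s => by
    by_cases hs : s ∈ S
    · obtain ⟨a, ha⟩ := cauchySeq_tendsto_of_complete (cauchySeq_of_le_geometric_two (hd' s hs))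
      exact ⟨a, fun _ => ha⟩
    · exact ⟨0, fun h => absurd h hs⟩
  choose g hg using hlim
  refine ⟨g, ?_, hg⟩
  have hu : TendstoUniformlyOn f g atTop S := by
    rw [Metric.tendstoUniformlyOn_iff]
    intro ε hε
    have h0 : Tendsto (fun n : ℕ => C / 2 ^ n) atTop (𝓝 0) := by
      simpa [div_eq_mul_inv] using
        (tendsto_pow_atTop_nhds_zero_of_lt_one (r := (2 : ℝ)⁻¹) (by norm_num)
          (by norm_num)).const_mul C
    filter_upwards [h0.eventually_lt_const hε] with n hn s hs
    rw [dist_comm]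
    exact (dist_le_of_le_geometric_two_of_tendsto (hd' s hs) (hg s hs) n).trans_lt hn
  exact hu.continuousOn (Frequently.of_forall hc)

namespace Bifurcation

open Filter Topology

variable {m : ℕ} {D : Bifurcation m} {k : ℕ}

theorem norm_to3_v_pos (k : ℕ) : 0 < ‖to3 k D.v‖ := by
  rw [norm_pos_iff]
  intro h
  have := pairing_self_pos (k := k) D.v_ne
  rw [h, map_zero] at this
  exact this.false

variable [NeZero m]

/-- G at the iterates is s times a residual that decays at least like 2^(-n), and G is continuous at
the limit point. -/
theorem G_eq_zero_of_tendsto (hk : 2 ≤ k) {s t : ℝ} (ht : 4 ≤ t) (hs : 0 < s)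
    (hres : ∀ n, ‖D.resid k s (D.iter k t s n).1 (D.iter k t s n).2‖ * scale t n ^ 14 ≤ 1)
    {Θ : ℝ} {R : X3 m (k + 1)} (hmem : (Θ, R) ∈ D.I ×ˢ cube D.V m (k + 1))
    (hΘ : Tendsto (fun n => (D.iter k t s n).1) atTop (𝓝 Θ))
    (hR : Tendsto (fun n => to3 (k + 1) (s • (D.v + (D.iter k t s n).2))) atTop (𝓝 R)) :
    D.G k Θ R = 0 := by
  have h1 := (contDiffAt_pair (D.isOpen_domain hk) (D.contDiffOn_G k hk) hmem).continuousAt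
  have h2 := h1.tendsto.comp (hΘ.prodMk_nhds hR)
  have h3 : ∀ n, ‖D.resid k s (D.iter k t s n).1 (D.iter k t s n).2‖ ≤ (1 / 2) ^ n := fun n => by
    have hx := le_scale ht n
    have h2n : (1 : ℝ) ≤ 2 ^ n := one_le_pow₀ one_le_two
    have hx2 : 2 ^ n ≤ scale t n := by nlinarith
    have hx3 : 2 ^ n ≤ scale t n ^ 14 :=
      hx2.trans (le_self_pow₀ (h2n.trans hx2) (by norm_num))
    rw [one_div, inv_pow, ← one_div, le_div_iff₀ (by positivity)]
    exact (mul_le_mul_of_nonneg_left hx3 (norm_nonneg _)).trans (hres n)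
  have h4 : Tendsto (fun n => D.resid k s (D.iter k t s n).1 (D.iter k t s n).2) atTop (𝓝 0) :=
    squeeze_zero_norm h3 (tendsto_pow_atTop_nhds_zero_of_lt_one (by norm_num) (by norm_num))
  have h5 := h4.const_smul s
  rw [smul_zero] at h5
  refine tendsto_nhds_unique h2 (h5.congr fun n => ?_)
  rw [resid, smul_smul, mul_inv_cancel₀ hs.ne', one_smul]
  rfl

/-- A curve of nontrivial solutions. -/
theorem exists_curve (D : Bifurcation m) (hk : 2 ≤ k) :
    ∃ s₀ : ℝ, 0 < s₀ ∧ ∃ (Θc : ℝ → ℝ) (Rc : ℝ → X3 m (k + 1)),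
      ContinuousOn Θc (Set.Ico 0 s₀) ∧ ContinuousOn Rc (Set.Ico 0 s₀) ∧
      Θc 0 = D.Θs ∧ Rc 0 = 0 ∧
      ∀ s ∈ Set.Ico 0 s₀, Θc s ∈ D.I ∧ Rc s ∈ cube D.V m (k + 1) ∧
        D.G k (Θc s) (Rc s) = 0 ∧ (0 < s → Rc s ≠ 0) := by
  have hv := D.norm_to3_v_pos (k + 1)
  -- The correction is kept below half the norm of v, which makes the solutions nontrivial.
  obtain ⟨δ, t, s₀, C, hδ, hδv, hδr, ht, hs₀, h⟩ := D.exists_iter_bounds hk (half_pos hv)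
  have hcont := fun n => D.continuousOn_iter hk ht hδr (fun s hs hss n =>
    ⟨(h s hs hss n).2.1, (h s hs hss n).2.2.2.1, (h s hs hss n).2.2.2.2.1,
      (h s hs hss n).2.2.2.2.2.1⟩) n
  have hle : k + 1 ≤ k + 3 := by omega
  have h0mem : (0 : ℝ) ∈ Set.Ico 0 s₀ := ⟨le_rfl, hs₀⟩
  obtain ⟨Θc, hΘc, hΘlim⟩ := exists_continuousOn_limit (C := δ) (fun n => (hcont n).1)
    (fun n s hs => by
      rcases hs.1.eq_or_lt with rfl | hs0
      · rw [iter_zero, iter_zero, sub_self, norm_zero]; positivity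
      · exact (h s hs0 hs.2 n).2.2.2.2.2.2.1)
  obtain ⟨g, hg, hglim⟩ := exists_continuousOn_limit (C := δ) (fun n => (hcont n).2 (k + 3))
    (fun n s hs => by
      rcases hs.1.eq_or_lt with rfl | hs0
      · rw [iter_zero, iter_zero, sub_self, norm_zero]; positivity
      · exact (h s hs0 hs.2 n).2.2.2.2.2.2.2)
  have hΘmem : ∀ s ∈ Set.Ico 0 s₀, Θc s ∈ D.I := fun s hs => by
    refine mem_I_of_abs_le (le_of_tendsto ((hΘlim s hs).sub_const D.Θs).abs
      (Eventually.of_forall fun n => ?_))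
    rcases hs.1.eq_or_lt with rfl | hs0
    · rw [iter_zero]; exact abs_self_le_radius
    · exact (h s hs0 hs.2 n).2.1.trans hδr
  have hRlim : ∀ s ∈ Set.Ico 0 s₀, Tendsto (fun n => to3 (k + 3) (s • (D.v + (D.iter k t s n).2)))
      atTop (𝓝 (s • (to3 (k + 3) D.v + g s))) := fun s hs => by
    simp only [map_smul, map_add]
    exact ((hglim s hs).const_add _).const_smul s
  have hRmem : ∀ s ∈ Set.Ico 0 s₀,
      incl3 hle (s • (to3 (k + 3) D.v + g s)) ∈ cube D.V m (k + 1) := fun s hs => by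
    refine mem_cube_of_norm_le hk (R' := incl3 (by omega) (s • (to3 (k + 3) D.v + g s)))
      (by rw [fn3_incl3, fn3_incl3]) ((norm_incl3_le _ _).trans (le_of_tendsto (hRlim s hs).norm
        (Eventually.of_forall fun n => ?_)))
    rcases hs.1.eq_or_lt with rfl | hs0
    · rw [zero_smul, map_zero, norm_zero]; exact D.radius_pos.le
    · exact (h s hs0 hs.2 n).2.2.2.1.trans (min_le_right _ _)
  refine ⟨s₀, hs₀, Θc, fun s => incl3 hle (s • (to3 (k + 3) D.v + g s)), hΘc,
    (incl3 hle).continuous.comp_continuousOn (continuousOn_id.smul (continuousOn_const.add hg)),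
    ?_, ?_, fun s hs => ⟨hΘmem s hs, hRmem s hs, ?_, fun hs0 hR => ?_⟩⟩
  · have := hΘlim 0 h0mem
    simp only [iter_zero] at this
    exact tendsto_nhds_unique this tendsto_const_nhds
  · beta_reduce
    rw [zero_smul, map_zero]
  · beta_reduce
    rcases hs.1.eq_or_lt with rfl | hs0
    · rw [zero_smul, map_zero]
      exact D.G_zero k hk _ (hΘmem 0 hs)
    · refine G_eq_zero_of_tendsto hk ht hs0 (fun n => (h s hs0 hs.2 n).1)
        ⟨hΘmem s hs, hRmem s hs⟩ (hΘlim s hs) ?_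
      have h1 := ((incl3 (S := cosSpace m) hle).continuous.tendsto
        _).comp (hRlim s hs)
      exact h1.congr fun n => incl3_to3 _ _
  · beta_reduce at hR
    rw [map_smul, smul_eq_zero_iff_right hs0.ne', map_add, incl3_to3] at hR
    -- If R(s) = 0 then v is minus the correction, so ‖v‖ ≤ δ ≤ ‖v‖ / 2 in X^{k+1}.
    have h1 : ‖g s‖ ≤ δ := le_of_tendsto (hglim s hs).norm
      (Eventually.of_forall fun n => (h s hs0 hs.2 n).2.2.1)
    have h2 := norm_incl3_le hle (g s)
    rw [eq_neg_of_add_eq_zero_left hR, norm_neg] at hv hδv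
    linarith

end Bifurcation

end NashMoser

end

theorem mainTheorem3 (m : ℕ) (hm : 2 ≤ m)
    -- the open neighbourhood `I × V³` of `(Θ*, 0)` in `ℝ × (X³)³`
    (Θs : ℝ) (I : Set ℝ) (hI : IsOpen I) (hΘs : Θs ∈ I)
    (V : Set L2) (hV : IsOpen {f : X m 3 | (f : L2) ∈ V}) (hV0 : (0 : L2) ∈ V)
    -- the map `G : I × ((X^{k+1})³ ∩ V³) → (Y^k)³`; the `G k` are restrictions of one map
    (G : ∀ k : ℕ, ℝ → X3 m (k + 1) → Y3 m k)
    (hG : ∀ k l : ℕ, 2 ≤ k → 2 ≤ l → ∀ Θ ∈ I, ∀ R ∈ cube V m (k + 1), ∀ R' ∈ cube V m (l + 1),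
      fn3 R = fn3 R' → fn3 (G k Θ R) = fn3 (G l Θ R'))
    -- the operators `a(Θ, R) : (X^{k+1})³ → (Y^k)³` and `A(Θ, R) : (X^{k+1})³ → Y^{k+1} × (Y^k)²`
    (a : ∀ k : ℕ, ℝ → XInf m → (X3 m (k + 1) →L[ℝ] Y3 m k))
    (A : ∀ k : ℕ, ℝ → XInf m → (X3 m (k + 1) →L[ℝ] YT m k))
    (hA : ∀ k l : ℕ, 2 ≤ k → 2 ≤ l → ∀ Θ ∈ I, ∀ R ∈ smoothCube V m,
      ∀ (h : X3 m (k + 1)) (h' : X3 m (l + 1)), fn3 h = fn3 h' →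
        fnT (A k Θ R h) = fnT (A l Θ R h'))
    -- trivial solutions
    (ha : ∀ k : ℕ, 2 ≤ k → ∀ Θ ∈ I, G k Θ 0 = 0)
    -- regularity: the derivatives exist
    (hb_C2 : ∀ k : ℕ, 2 ≤ k →
      ContDiffOn ℝ 2 (fun p : ℝ × X3 m (k + 1) => G k p.1 p.2) (I ×ˢ cube V m (k + 1)))
    (hb_ΘD2 : ∀ k : ℕ, 2 ≤ k → ∀ R ∈ smoothCube V m, ∀ h : X3 m (k + 1),
      DifferentiableAt ℝ
        (fun τ => iteratedFDeriv ℝ 2 (G k τ) (R.to (k + 1)) (fun _ => h)) Θs)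
    (hb_ΘΘD : ∀ k : ℕ, 2 ≤ k → ∀ Θ ∈ I, ∀ R ∈ smoothCube V m, ∀ h : X3 m (k + 1),
      DifferentiableAt ℝ (deriv (fun τ => fderiv ℝ (G k τ) (R.to (k + 1)) h)) Θ)
    -- regularity: the tame bounds
    (hb : ∀ k : ℕ, 2 ≤ k → ∃ C : ℝ, ∀ Θ ∈ I, ∀ R ∈ smoothCube V m,
      ‖G k Θ (R.to (k + 1))‖ ≤ C * (1 + ‖R.to (k + 1)‖) ∧
      ‖deriv (fun τ => G k τ (R.to (k + 1))) Θ‖ ≤ C * (1 + ‖R.to (k + 1)‖) ∧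
      ∀ h : X3 m (k + 1),
        ‖iteratedFDeriv ℝ 2 (G k Θ) (R.to (k + 1)) (fun _ => h)‖
          ≤ C * (1 + ‖R.to (k + 3)‖) * ‖h‖ ^ 2 ∧
        ‖deriv (fun τ => fderiv ℝ (G k τ) (R.to (k + 1)) h) Θ‖
          ≤ C * (1 + ‖R.to (k + 3)‖) * ‖h‖ ∧
        ‖deriv (fun τ => iteratedFDeriv ℝ 2 (G k τ) (R.to (k + 1)) (fun _ => h)) Θs‖
          ≤ C * (1 + ‖R.to (k + 3)‖) * ‖h‖ ^ 2 ∧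
        ‖iteratedDeriv 2 (fun τ => fderiv ℝ (G k τ) (R.to (k + 1)) h) Θ‖
          ≤ C * (1 + ‖R.to (k + 3)‖) * ‖h‖)
    -- the decomposition `DG = a + A`
    (hc : ∀ k : ℕ, 2 ≤ k → ∀ Θ ∈ I, ∀ R ∈ smoothCube V m, ∀ h : X3 m (k + 1),
      fn3 (fderiv ℝ (G k Θ) (R.to (k + 1)) h) = fn3 (a k Θ R h) + fnT (A k Θ R h))
    (hc_bound : ∀ k : ℕ, 2 ≤ k → ∃ η : ℝ, 0 < η ∧ η < 1 ∧ ∃ C : ℝ,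
      ∀ Θ ∈ I, ∀ R ∈ smoothCube V m, ‖R.to (k + 2)‖ ≤ η → ∀ h : X3 m (k + 1),
        ‖a k Θ R h‖ ≤ C * ‖G k Θ (R.to (k + 1))‖ * ‖h‖ ∧
        ‖A k Θ R h‖ ≤ C * (1 + ‖R.to (k + 3)‖) * ‖h‖)
    -- Lipschitz continuity of `A`
    (hc1 : ∀ k : ℕ, 2 ≤ k → ∃ C : ℝ, ∀ Θ₁ ∈ I, ∀ Θ₂ ∈ I,
      ∀ R₁ ∈ smoothCube V m, ∀ R₂ ∈ smoothCube V m, ‖R₁.to (k + 3)‖ ≤ 1 → ‖R₂.to (k + 3)‖ ≤ 1 →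
        ∀ h : X3 m (k + 1),
          ‖A k Θ₁ R₁ h - A k Θ₂ R₂ h‖
            ≤ C * (|Θ₁ - Θ₂| + ‖R₁.to (k + 3) - R₂.to (k + 3)‖) * ‖h‖)
    -- tame estimates for the inversion of `A`
    (hc2 : ∀ k : ℕ, 2 ≤ k → ∃ η : ℝ, 0 < η ∧ η < 1 ∧ ∃ C : ℕ → ℝ,
      ∀ Θ ∈ I, ∀ R ∈ smoothCube V m, ‖R.to (k + 3)‖ ≤ η →
        ∀ (h : X3 m (k + 1)) (z : YInf m), A k Θ R h = z.to k →
          (∀ g : X3 m (k + 1), A k Θs 0 g = 0 → dot (fn3 h) (fn3 g) = 0) →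
          ∃ h' : XInf m, h'.to (k + 1) = h ∧ ∀ σ : ℕ, Even σ →
            ‖h'.to (k + 1 + σ)‖
              ≤ C σ * ((1 + ‖R.to (k + 4 + σ)‖) * ‖z.to k‖ + ‖z.to (k + σ)‖))
    -- `A(Θ*, 0)` has Fredholm index zero, with kernel and cokernel on the `m`-th Fourier mode
    (v : XInf m) (w : YInf m) (hv : v ≠ 0) (hw : w ≠ 0)
    (hv_mode : ∃ c : Fin 3 → ℝ, fnInf v = fun i => c i • cosMode m)
    (hw_mode : ∃ c : Fin 3 → ℝ, fnInf w = fun i => c i • sinMode m)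
    (hd_ker : ∀ k : ℕ, 2 ≤ k → ∀ h : X3 m (k + 1),
      A k Θs 0 h = 0 ↔ ∃ t : ℝ, h = t • v.to (k + 1))
    (hd_perp : ∀ k : ℕ, 2 ≤ k → ∀ z : YT m k,
      (∀ h : X3 m (k + 1), dot (fnT z) (fnT (A k Θs 0 h)) = 0) ↔ ∃ t : ℝ, z = t • w.to k)
    (hd_coker : ∀ k : ℕ, 2 ≤ k →
      Module.finrank ℝ (YT m k ⧸ LinearMap.range (A k Θs 0 : X3 m (k + 1) →ₗ[ℝ] YT m k)) = 1)
    -- transversality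
    (he : ∀ k : ℕ, 2 ≤ k →
      deriv (fun τ => A k τ 0 (v.to (k + 1))) Θs ∉ Set.range (A k Θs 0)) :
    -- a curve of nontrivial solutions emanates from `(Θ*, 0)`
    ∀ k₀ : ℕ, 2 ≤ k₀ → ∃ s₀ : ℝ, 0 < s₀ ∧ ∃ (Θc : ℝ → ℝ) (Rc : ℝ → X3 m (k₀ + 1)),
      ContinuousOn Θc (Set.Ico 0 s₀) ∧ ContinuousOn Rc (Set.Ico 0 s₀) ∧
      Θc 0 = Θs ∧ Rc 0 = 0 ∧
      ∀ s ∈ Set.Ico 0 s₀, Θc s ∈ I ∧ Rc s ∈ cube V m (k₀ + 1) ∧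
        G k₀ (Θc s) (Rc s) = 0 ∧ (0 < s → Rc s ≠ 0) := by
  have : NeZero m := ⟨by omega⟩
  intro k₀ hk₀
  -- The fields are stated with the linear map `to3`, which agrees with `XInf.to` by definition.
  exact Bifurcation.exists_curve (m := m)
    { Θs := Θs, I := I, isOpen_I := hI, Θs_mem := hΘs, V := V, isOpen_V := hV, zero_mem_V := hV0
      G := G, G_compat := hG, a := a, A := A, G_zero := ha, contDiffOn_G := hb_C2
      differentiableAt_deriv := hb_ΘΘD
      bound := fun k hk => by
        obtain ⟨C, hC⟩ := hb k hk
        refine ⟨C, fun Θ hΘ R hR => ?_⟩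
        obtain ⟨h1, h2, h3⟩ := hC Θ hΘ R hR
        exact ⟨h1, h2, fun h => ⟨(h3 h).1, (h3 h).2.1, (h3 h).2.2.2⟩⟩
      decomp := hc, decomp_bound := hc_bound, lipschitz := hc1, tame := hc2
      v := v, v_ne := hv, v_mode := hv_mode, ker := hd_ker, coker := hd_coker
      transversal := he } hk₀
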